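/- Let $\Omega=(A,\le)$ be a linear order ($\le$ reflexive, transitive and total; antisymmetry is not needed). Let $(\varepsilon_\Omega,\preceq)$ be the following notation system. Its terms are the constants $0$, $\omega$ and $\varepsilon_\alpha$ for $\alpha\in A$, and the terms $\langle t_0,\dots,t_{k-1}\rangle$ with $k\ge 1$, where $t_0\succ t_1\succ\dots\succ t_{k-1}$ are terms and, if $k=1$, $t_0$ is neither $\omega$ nor any $\varepsilon_\alpha$. The order is given by $0\prec\omega\prec\varepsilon_\alpha$; $\varepsilon_\alpha\preceq\varepsilon_\beta$ iff $\alpha\le\beta$; terms $\langle\dots\rangle$ are compared with each other lexicographically (a proper initial segment being smaller); and for a constant $c$ and a term $t=\langle t_0,\dots,t_{k-1}\rangle$, $c\prec t$ if $c\preceq t_0$, and $t\prec c$ if $t_0\prec c$. For a non-empty quasi-order $Q$, let $\mathsf{T_f}(Q)$ be the set of finite leaf-labelled trees over $Q$: the leaves $\cdot q$ for $q\in Q$, and the trees $\cdot(\tau_0,\dots,\tau_{k-1})$ for finite non-empty collections of trees $\tau_i\in\mathsf{T_f}(Q)$. It is quasi-ordered by: $\cdot x\le_T\cdot y$ iff $x\le_Q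 y$; $\cdot x\le_T\cdot(\tau_j)_{j<l}$ iff $\cdot x\le_T\tau_j$ for some $j<l$; $\cdot(\sigma_i)_{i<k}\le_T\cdot(\tau_j)_{j<l}$ iff for every $i<k$ there is $j<l$ with $\sigma_i\le_T\tau_j$; and never $\cdot(\sigma_i)_{i<k}\le_T\cdot y$. Let $2\cup\Omega$ be $\Omega$ with two new elements $0<1$ placed below all elements of $\Omega$. **Theorem.** $\mathsf{RCA_0}$ proves: for every linear order $\Omega$ (on a set of natural numbers), the systems $\varepsilon_\Omega$ and $\mathsf{T_f}(2\cup\Omega)$ exist (with terms and trees coded by natural numbers), and there is an order-reflecting map $h\colon\varepsilon_\Omega\to\mathsf{T_f}(2\cup\Omega)$, that is, a map such that $h(s)\le_T h(t)$ implies $s\preceq t$ for all $s,t\in\varepsilon_\Omega$. Equivalently, this statement holds in every model of $\mathsf{RCA_0}$, including those with non-standard numbers. -/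

import Mathlib

namespace RevMath

universe u

/-! ### The language of second-order arithmetic and the theory `RCA₀` -/

/-- A structure for the language of second-order arithmetic: a number domain `M` with
`0, 1, +, ·, <`, and a non-empty collection of subsets of `M` over which the set variables range.
Neither part needs to be standard. -/
class L2Structure (M : Type u) extends Zero M, One M, Add M, Mul M, LT M where
  /-- the range of the set variables -/
  sets : Set (Set M)
  sets_nonempty : sets.Nonempty

/-- The range of the set variables of `M`. -/
abbrev sets (M : Type u) [L2Structure M] : Set (Set M) := L2Structure.sets

/-- Numerical terms; number variables are de Bruijn indices. -/
inductive NumTerm : Type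
  | var : ℕ → NumTerm
  | zero : NumTerm
  | one : NumTerm
  | add : NumTerm → NumTerm → NumTerm
  | mul : NumTerm → NumTerm → NumTerm

/-- Bounded-quantifier (`Δ⁰₀`) formulas, with free number variables and free set variables.
In `bex t φ`, read `∃ x < t, φ`, variable `0` of `φ` is bound and the variables of `t` are not
shifted, so that `t` cannot mention `x`. -/
inductive BddFormula : Type
  | eq : NumTerm → NumTerm → BddFormula
  | lt : NumTerm → NumTerm → BddFormula
  | mem : NumTerm → ℕ → BddFormula
  | neg : BddFormula → BddFormula
  | and : BddFormula → BddFormula → BddFormula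
  | bex : NumTerm → BddFormula → BddFormula

section Semantics

variable {M : Type u} [L2Structure M]

/-- Prepend a value to an assignment of the number variables. -/
def push (a : M) (e : ℕ → M) : ℕ → M
  | 0 => a
  | n + 1 => e n

/-- Value of a term under an assignment. -/
def NumTerm.eval (e : ℕ → M) : NumTerm → M
  | .var i => e i
  | .zero => 0
  | .one => 1
  | .add s t => s.eval e + t.eval e
  | .mul s t => s.eval e * t.eval e

/-- Satisfaction of a bounded formula, under an assignment `X` of the set variables and an
assignment of the number variables. -/
def BddFormula.Sat (X : ℕ → Set M) : BddFormula → (ℕ → M) → Prop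
  | .eq s t, e => s.eval e = t.eval e
  | .lt s t, e => s.eval e < t.eval e
  | .mem t i, e => t.eval e ∈ X i
  | .neg φ, e => ¬ φ.Sat X e
  | .and φ ψ, e => φ.Sat X e ∧ ψ.Sat X e
  | .bex t φ, e => ∃ x : M, x < t.eval e ∧ φ.Sat X (push x e)

end Semantics

/-- `M` is a model of `RCA₀`: the basic axioms, induction for `Σ⁰₁` formulas `∃ x, φ(x, n)`, and
comprehension for `Δ⁰₁` formulas, both with arbitrary number and set parameters from `M`. -/
structure ModelsRCA0 (M : Type u) [L2Structure M] : Prop where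
  succ_ne_zero : ∀ n : M, n + 1 ≠ 0
  succ_inj : ∀ m n : M, m + 1 = n + 1 → m = n
  add_zero : ∀ m : M, m + 0 = m
  add_succ : ∀ m n : M, m + (n + 1) = (m + n) + 1
  mul_zero : ∀ m : M, m * 0 = 0
  mul_succ : ∀ m n : M, m * (n + 1) = m * n + m
  not_lt_zero : ∀ m : M, ¬ m < 0
  lt_succ_iff : ∀ m n : M, m < n + 1 ↔ m < n ∨ m = n
  sigma1_induction : ∀ (φ : BddFormula) (e : ℕ → M) (X : ℕ → Set M), (∀ i, X i ∈ sets M) →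
    (∃ x, φ.Sat X (push x (push 0 e))) →
    (∀ n, (∃ x, φ.Sat X (push x (push n e))) → ∃ x, φ.Sat X (push x (push (n + 1) e))) →
    ∀ n, ∃ x, φ.Sat X (push x (push n e))
  delta1_comprehension : ∀ (φ ψ : BddFormula) (e : ℕ → M) (X : ℕ → Set M), (∀ i, X i ∈ sets M) →
    (∀ n, (∃ x, φ.Sat X (push x (push n e))) ↔ ∀ x, ψ.Sat X (push x (push n e))) →
    ∃ Y ∈ sets M, ∀ n, n ∈ Y ↔ ∃ x, φ.Sat X (push x (push n e))

/-! ### Orders, finite lists and maps inside a structure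

From here on every quantifier ranges over the numbers or the sets of `M`, so that each notion is
the interpretation in `M` of a formula of second-order arithmetic. -/

section Coding

variable {M : Type u} [L2Structure M]

/-- Polynomial pairing. In a model of `RCA₀` it is injective, its value is never `0`, and its value
exceeds both arguments. Finite lists are coded by `nil = 0` and `cons t ℓ = pair t ℓ`. -/
def pair (a b : M) : M := (a + b) * (a + b) + a + 1

/-- The binary relation coded by a set of pairs. -/
def Rel (R : Set M) (a b : M) : Prop := pair a b ∈ R

/-- The strict part of the relation coded by a set of pairs. -/
def SRel (R : Set M) (a b : M) : Prop := Rel R a b ∧ ¬ Rel R b a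

/-- `A` is linearly quasi-ordered by the relation coded by `LA`; antisymmetry is not required. -/
structure IsLinearOrder (A LA : Set M) : Prop where
  refl : ∀ a ∈ A, Rel LA a a
  trans : ∀ a ∈ A, ∀ b ∈ A, ∀ c ∈ A, Rel LA a b → Rel LA b c → Rel LA a c
  total : ∀ a ∈ A, ∀ b ∈ A, Rel LA a b ∨ Rel LA b a

/-- `h` is the graph of a map from `P` to `Q` that reflects the relation coded by `LQ` to the
relation coded by `LP`. -/
structure IsOrderReflecting (P LP Q LQ h : Set M) : Prop where
  graph : ∀ n ∈ h, ∃ p ∈ P, ∃ q ∈ Q, n = pair p q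
  total : ∀ p ∈ P, ∃! q, Rel h p q
  reflects : ∀ p p' q q', Rel h p q → Rel h p' q' → Rel LQ q q' → Rel LP p p'

/-! ### The notation system `ε_Ω` -/

/-- The constant `0`. -/
def zeroC : M := pair 0 0

/-- The constant `ω`. -/
def omegaC : M := pair 0 1

/-- The constant `ε_α`. -/
def epsC (α : M) : M := pair 1 α

/-- The term `⟨t₀, …, tₖ₋₁⟩`, where `ℓ` codes the list of the `tᵢ`. -/
def seqC (ℓ : M) : M := pair (1 + 1) ℓ

/-- `c` is one of the constants `0`, `ω`, `ε_α` with `α ∈ A`. -/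
def IsConst (A : Set M) (c : M) : Prop := c = zeroC ∨ c = omegaC ∨ ∃ α ∈ A, c = epsC α

/-- The notation system `ε_Ω` for `Ω = (A, LA)`, as sets of `M`: its terms with their order, and
simultaneously the strictly descending lists of terms with their lexicographic order. The clauses
are recursive along the codes, so that they determine the terms, the lists and both orders. -/
structure EpsilonNotation (A LA : Set M) where
  /-- the terms -/
  terms : Set M
  /-- the order `⪯` of the terms -/
  le : Set M
  /-- the finite lists `t₀ ≻ t₁ ≻ ⋯` of terms -/
  lists : Set M
  /-- the lexicographic order of these lists -/
  lex : Set M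
  terms_mem : terms ∈ sets M
  le_mem : le ∈ sets M
  lists_mem : lists ∈ sets M
  lex_mem : lex ∈ sets M
  mem_terms_iff : ∀ n, n ∈ terms ↔ IsConst A n ∨ ∃ t ℓ, n = seqC (pair t ℓ) ∧
    pair t ℓ ∈ lists ∧ (ℓ = 0 → t ≠ omegaC ∧ ∀ α ∈ A, t ≠ epsC α)
  mem_lists_iff : ∀ n, n ∈ lists ↔ n = 0 ∨ ∃ t ℓ, n = pair t ℓ ∧ t ∈ terms ∧ ℓ ∈ lists ∧
    ∀ t' ℓ', ℓ = pair t' ℓ' → SRel le t' t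
  zero_lt_omega : SRel le zeroC omegaC
  zero_lt_eps : ∀ α ∈ A, SRel le zeroC (epsC α)
  omega_lt_eps : ∀ α ∈ A, SRel le omegaC (epsC α)
  zero_le_zero : Rel le zeroC zeroC
  omega_le_omega : Rel le omegaC omegaC
  eps_le_eps : ∀ α ∈ A, ∀ β ∈ A, (Rel le (epsC α) (epsC β) ↔ Rel LA α β)
  const_le_seq : ∀ c t ℓ, IsConst A c → seqC (pair t ℓ) ∈ terms →
    (Rel le c (seqC (pair t ℓ)) ↔ Rel le c t)
  seq_le_const : ∀ c t ℓ, IsConst A c → seqC (pair t ℓ) ∈ terms →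
    (Rel le (seqC (pair t ℓ)) c ↔ SRel le t c)
  seq_le_seq : ∀ k ℓ, seqC k ∈ terms → seqC ℓ ∈ terms →
    (Rel le (seqC k) (seqC ℓ) ↔ Rel lex k ℓ)
  nil_lex : ∀ ℓ ∈ lists, Rel lex 0 ℓ
  cons_lex_nil : ∀ t ℓ, pair t ℓ ∈ lists → ¬ Rel lex (pair t ℓ) 0
  cons_lex_cons : ∀ s k t ℓ, pair s k ∈ lists → pair t ℓ ∈ lists →
    (Rel lex (pair s k) (pair t ℓ) ↔ SRel le s t ∨ (Rel le s t ∧ Rel le t s ∧ Rel lex k ℓ))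

/-! ### Finite leaf-labelled trees -/

/-- The tree with a single vertex, labelled by `q`. -/
def leafC (q : M) : M := pair 0 q

/-- The tree whose root has the children listed by `ℓ`. -/
def nodeC (ℓ : M) : M := pair 1 ℓ

/-- The quasi-order `T_f(Q)` of finite leaf-labelled trees over the quasi-order `Q` with elements
`inQ` and order `leQ`, as sets of `M`. The finite set of children of an inner vertex is given by a
non-empty list; order and repetition of its entries do not matter for `≤_T`. The clauses
are recursive along the codes, so that they determine the trees, the lists of trees and the order
of the trees. -/
structure LeafTrees (inQ : M → Prop) (leQ : M → M → Prop) where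
  /-- the trees -/
  trees : Set M
  /-- the order `≤_T` of the trees -/
  le : Set M
  /-- the finite lists of trees -/
  lists : Set M
  /-- the relation "is an entry of the list" -/
  entry : Set M
  trees_mem : trees ∈ sets M
  le_mem : le ∈ sets M
  lists_mem : lists ∈ sets M
  entry_mem : entry ∈ sets M
  mem_trees_iff : ∀ n, n ∈ trees ↔
    (∃ q, inQ q ∧ n = leafC q) ∨ ∃ ℓ ∈ lists, ℓ ≠ 0 ∧ n = nodeC ℓ
  mem_lists_iff : ∀ n, n ∈ lists ↔ n = 0 ∨ ∃ τ ℓ, n = pair τ ℓ ∧ τ ∈ trees ∧ ℓ ∈ lists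
  not_entry_nil : ∀ σ, ¬ Rel entry σ 0
  entry_cons : ∀ σ τ ℓ, pair τ ℓ ∈ lists → (Rel entry σ (pair τ ℓ) ↔ σ = τ ∨ Rel entry σ ℓ)
  leaf_le_leaf : ∀ x y, inQ x → inQ y → (Rel le (leafC x) (leafC y) ↔ leQ x y)
  leaf_le_node : ∀ x ℓ, inQ x → nodeC ℓ ∈ trees →
    (Rel le (leafC x) (nodeC ℓ) ↔ ∃ τ, Rel entry τ ℓ ∧ Rel le (leafC x) τ)
  not_node_le_leaf : ∀ k y, nodeC k ∈ trees → inQ y → ¬ Rel le (nodeC k) (leafC y)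
  node_le_node : ∀ k ℓ, nodeC k ∈ trees → nodeC ℓ ∈ trees →
    (Rel le (nodeC k) (nodeC ℓ) ↔ ∀ σ, Rel entry σ k → ∃ τ, Rel entry τ ℓ ∧ Rel le σ τ)

/-! ### The labels `2 ∪ Ω` -/

/-- The label `0` of `2 ∪ Ω`. -/
def label0 : M := pair 0 0

/-- The label `1` of `2 ∪ Ω`. -/
def label1 : M := pair 0 1

/-- The label of `2 ∪ Ω` given by an element of `Ω`. -/
def labelOf (α : M) : M := pair 1 α

/-- The elements of `2 ∪ Ω`, for `Ω` with elements `A`. -/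
def InTwoUnion (A : Set M) (x : M) : Prop := x = label0 ∨ x = label1 ∨ ∃ α ∈ A, x = labelOf α

/-- The order of `2 ∪ Ω`: `0 < 1 < α` for all `α` in `Ω`, and the order of `Ω` above. -/
def LeTwoUnion (A LA : Set M) (x y : M) : Prop :=
  (x = label0 ∧ InTwoUnion A y) ∨
  (x = label1 ∧ (y = label1 ∨ ∃ β ∈ A, y = labelOf β)) ∨
  ∃ α ∈ A, ∃ β ∈ A, x = labelOf α ∧ y = labelOf β ∧ Rel LA α β

end Coding

end RevMath

set_option linter.unusedSectionVars false

/-! The constants 0, ω, ε_α go to leaves labelled 0, 1, α. A sequence term below ω goes to the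
linear tree `bar` of its `height`, and heights strictly increase along the order below ω
(`height_lt`). Any other term ⟨t_0, …, t_{k-1}⟩ goes to a tree with one child {guard(h(t_i)),
bar(n_i)} for each entry, where guard(x) = {1, {x}}. Trees do not see the order of their children,
so bar(n_i) records the position: n_i is the sum of 2^(height(t_j) + 3) over j < i. Comparing guards
reflects to comparing their contents, and the leaf 1 keeps a guard from lying below a bar, whose
only label is 0.

The central case is s ⋠ t for two sequences that are not below ω. Let i be the first index at which
the entries are not equivalent or t has ended. Then child i of s lies below no child of t. Against
child j ≥ i of t, guard(h(s_i)) would lie below guard(h(t_j)), and induction would give s_i ⪯ t_j ⪯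
t_i. Against child j < i, equivalent entries have equal heights (`height_eq`), so n_i is at least
the j-th offset of t plus 2^(height(t_j) + 3). Hence bar(n_i) is neither below the bar of that child
nor below its guard, because h(t_j) admits only bars of length at most height(t_j) below it
(`le_height_of_bar_le`). The remaining cases compare labels; a leaf α below the tree of a sequence
is traced to one of its entries (`leaf_le_tree_seq`). All this is assembled in `reflects_aux`.

To stay within RCA₀, every object is a number and every construction is shown to be `Comp`, that is,
to have a Σ⁰₁ graph with set parameters. Closure properties are registered for `fun_prop`. Gödel's β
function (`exists_code`) yields course-of-values recursion (`exists_course_rec`), and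
`Comp.setOf_mem` turns decidable predicates into sets. Arguments by recursion on terms use
`Comp.measure_induction`: the predicate must be decidable, but the induction hypothesis may vary all
side parameters. This is why existential claims proved by such inductions carry explicit bounds on
their witnesses. -/

namespace RevMath

universe u v w z

/-! ### Basic arithmetic: the model as a discretely ordered commutative semiring. -/

section Arithmetic

variable {M : Type u} [L2Structure M]

namespace ModelsRCA0

/-- Induction for a bounded formula without set parameters. The formula has the induction variable
at index `1` and parameters from index `2` on. -/
theorem bdd_induction (hM : ModelsRCA0 M) (φ : BddFormula) (e : ℕ → M) (P : M → Prop)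
    (hP : ∀ X x n, φ.Sat X (push x (push n e)) ↔ P n)
    (h0 : P 0) (hs : ∀ n, P n → P (n + 1)) (n : M) : P n := by
  obtain ⟨X, hX⟩ := L2Structure.sets_nonempty (M := M)
  obtain ⟨x, hx⟩ := hM.sigma1_induction φ e (fun _ => X) (fun _ => hX)
    ⟨0, (hP _ _ _).2 h0⟩ (fun n ⟨x, hx⟩ => ⟨0, (hP _ _ _).2 (hs n ((hP _ _ _).1 hx))⟩) n
  exact (hP _ _ _).1 hx

theorem zero_add (hM : ModelsRCA0 M) (n : M) : 0 + n = n :=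
  hM.bdd_induction (.eq (.add .zero (.var 1)) (.var 1)) (fun _ => 0) (fun n => 0 + n = n)
    (fun _ _ _ => Iff.rfl) (hM.add_zero 0) (fun n h => by rw [hM.add_succ, h]) n

theorem succ_add (hM : ModelsRCA0 M) (m n : M) : m + 1 + n = m + n + 1 :=
  hM.bdd_induction (.eq (.add (.add (.var 2) .one) (.var 1)) (.add (.add (.var 2) (.var 1)) .one))
    (fun _ => m) (fun n => m + 1 + n = m + n + 1) (fun _ _ _ => Iff.rfl)
    (by rw [hM.add_zero, hM.add_zero]) (fun n h => by rw [hM.add_succ, h, hM.add_succ]) n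

theorem add_comm (hM : ModelsRCA0 M) (m n : M) : m + n = n + m :=
  hM.bdd_induction (.eq (.add (.var 2) (.var 1)) (.add (.var 1) (.var 2)))
    (fun _ => m) (fun n => m + n = n + m) (fun _ _ _ => Iff.rfl)
    (by rw [hM.add_zero, hM.zero_add]) (fun n h => by rw [hM.add_succ, h, hM.succ_add]) n

theorem add_assoc (hM : ModelsRCA0 M) (a b n : M) : a + b + n = a + (b + n) :=
  hM.bdd_induction (.eq (.add (.add (.var 2) (.var 3)) (.var 1))
      (.add (.var 2) (.add (.var 3) (.var 1))))
    (push a fun _ => b) (fun n => a + b + n = a + (b + n)) (fun _ _ _ => Iff.rfl)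
    (by rw [hM.add_zero, hM.add_zero])
    (fun n h => by rw [hM.add_succ, h, hM.add_succ, hM.add_succ]) n

theorem zero_mul (hM : ModelsRCA0 M) (n : M) : 0 * n = 0 :=
  hM.bdd_induction (.eq (.mul .zero (.var 1)) .zero) (fun _ => 0) (fun n => 0 * n = 0)
    (fun _ _ _ => Iff.rfl) (hM.mul_zero 0) (fun n h => by rw [hM.mul_succ, h, hM.add_zero]) n

theorem succ_mul (hM : ModelsRCA0 M) (m n : M) : (m + 1) * n = m * n + n :=
  hM.bdd_induction (.eq (.mul (.add (.var 2) .one) (.var 1))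
      (.add (.mul (.var 2) (.var 1)) (.var 1)))
    (fun _ => m) (fun n => (m + 1) * n = m * n + n) (fun _ _ _ => Iff.rfl)
    (by rw [hM.mul_zero, hM.mul_zero, hM.add_zero])
    (fun n h => by
      rw [hM.mul_succ, h, hM.mul_succ, ← hM.add_assoc, hM.add_succ, hM.add_assoc (m * n),
        hM.add_comm n m, ← hM.add_assoc]) n

theorem mul_comm (hM : ModelsRCA0 M) (m n : M) : m * n = n * m :=
  hM.bdd_induction (.eq (.mul (.var 2) (.var 1)) (.mul (.var 1) (.var 2)))
    (fun _ => m) (fun n => m * n = n * m) (fun _ _ _ => Iff.rfl)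
    (by rw [hM.mul_zero, hM.zero_mul]) (fun n h => by rw [hM.mul_succ, h, hM.succ_mul]) n

theorem mul_add (hM : ModelsRCA0 M) (a b n : M) : a * (b + n) = a * b + a * n :=
  hM.bdd_induction (.eq (.mul (.var 2) (.add (.var 3) (.var 1)))
      (.add (.mul (.var 2) (.var 3)) (.mul (.var 2) (.var 1))))
    (push a fun _ => b) (fun n => a * (b + n) = a * b + a * n) (fun _ _ _ => Iff.rfl)
    (by rw [hM.add_zero, hM.mul_zero, hM.add_zero])
    (fun n h => by rw [hM.add_succ, hM.mul_succ, h, hM.mul_succ, hM.add_assoc]) n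

theorem mul_assoc (hM : ModelsRCA0 M) (a b n : M) : a * b * n = a * (b * n) :=
  hM.bdd_induction (.eq (.mul (.mul (.var 2) (.var 3)) (.var 1))
      (.mul (.var 2) (.mul (.var 3) (.var 1))))
    (push a fun _ => b) (fun n => a * b * n = a * (b * n)) (fun _ _ _ => Iff.rfl)
    (by rw [hM.mul_zero, hM.mul_zero, hM.mul_zero])
    (fun n h => by rw [hM.mul_succ, h, hM.mul_succ, hM.mul_add]) n

theorem mul_one (hM : ModelsRCA0 M) (n : M) : n * 1 = n := by
  conv_lhs => rw [← hM.zero_add 1]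
  rw [hM.mul_succ, hM.mul_zero, hM.zero_add]

theorem lt_add_succ (hM : ModelsRCA0 M) (a n : M) : a < a + n + 1 :=
  hM.bdd_induction (.lt (.var 2) (.add (.add (.var 2) (.var 1)) .one))
    (fun _ => a) (fun n => a < a + n + 1) (fun _ _ _ => Iff.rfl)
    ((hM.lt_succ_iff _ _).2 (Or.inr (hM.add_zero a).symm))
    (fun n h => by rw [hM.add_succ]; exact (hM.lt_succ_iff _ _).2 (Or.inl h)) n

/-- The difference is an existential witness, so unlike the other inductions of this section this
one uses genuinely Σ⁰₁ induction. The implication is spelled with negation and conjunction, the only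
connectives of the language. -/
theorem exists_of_lt (hM : ModelsRCA0 M) (a b : M) (h : a < b) : ∃ c, b = a + c + 1 := by
  obtain ⟨X, hX⟩ := L2Structure.sets_nonempty (M := M)
  have key : ∀ n, ∃ x, ¬ (a < n ∧ ¬ n = a + x + 1) :=
    hM.sigma1_induction (.neg (.and (.lt (.var 2) (.var 1))
      (.neg (.eq (.var 1) (.add (.add (.var 2) (.var 0)) .one))))) (fun _ => a) (fun _ => X)
      (fun _ => hX) ⟨0, fun h => hM.not_lt_zero _ h.1⟩ (fun n ⟨x, hx⟩ => by
        change ¬ (a < n ∧ ¬ n = a + x + 1) at hx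
        change ∃ x, ¬ (a < n + 1 ∧ ¬ n + 1 = a + x + 1)
        by_cases han : a < n
        · have : n = a + x + 1 := by tauto
          exact ⟨x + 1, fun h => h.2 (by rw [hM.add_succ, ← this])⟩
        · refine ⟨0, fun h => ?_⟩
          rcases (hM.lt_succ_iff _ _).1 h.1 with h' | h'
          · exact han h'
          · exact h.2 (by rw [hM.add_zero, h']))
  obtain ⟨x, hx⟩ := key b
  exact ⟨x, by tauto⟩

theorem lt_iff (hM : ModelsRCA0 M) (a b : M) : a < b ↔ ∃ c, b = a + c + 1 :=
  ⟨hM.exists_of_lt a b, fun ⟨c, h⟩ => h ▸ hM.lt_add_succ a c⟩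

theorem lt_trans (hM : ModelsRCA0 M) {a b c : M} (h : a < b) (h' : b < c) : a < c := by
  rw [hM.lt_iff] at *
  obtain ⟨x, rfl⟩ := h
  obtain ⟨y, rfl⟩ := h'
  exact ⟨x + 1 + y, by rw [hM.add_assoc a x 1, hM.add_assoc a]⟩

theorem add_right_cancel (hM : ModelsRCA0 M) {a b : M} (n : M) : a + n = b + n → a = b := by
  have : ∀ n, ¬ (a + n = b + n ∧ ¬ a = b) :=
    hM.bdd_induction (.neg (.and (.eq (.add (.var 2) (.var 1)) (.add (.var 3) (.var 1)))
      (.neg (.eq (.var 2) (.var 3))))) (push a fun _ => b)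
      (fun n => ¬ (a + n = b + n ∧ ¬ a = b)) (fun _ _ _ => Iff.rfl)
      (by rw [hM.add_zero, hM.add_zero]; tauto)
      (fun n h h' => h ⟨hM.succ_inj _ _ (by rw [← hM.add_succ, ← hM.add_succ, h'.1]), h'.2⟩)
  have := this n
  tauto

theorem lt_irrefl (hM : ModelsRCA0 M) (a : M) : ¬ a < a := by
  rw [hM.lt_iff]
  rintro ⟨c, hc⟩
  refine hM.succ_ne_zero c (hM.add_right_cancel a ?_)
  rw [hM.zero_add, hM.add_comm, ← hM.add_assoc, ← hc]

theorem zero_le (hM : ModelsRCA0 M) (n : M) : 0 < n ∨ 0 = n := by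
  have : ∀ n : M, ¬ (¬ 0 < n ∧ ¬ 0 = n) :=
    hM.bdd_induction (.neg (.and (.neg (.lt .zero (.var 1))) (.neg (.eq .zero (.var 1)))))
      (fun _ => 0) (fun n => ¬ (¬ 0 < n ∧ ¬ 0 = n)) (fun _ _ _ => Iff.rfl)
      (by tauto) (fun n h h' => by rw [hM.lt_succ_iff] at h'; tauto)
  have := this n
  tauto

theorem succ_le_of_lt (hM : ModelsRCA0 M) {a b : M} (h : a < b) : a + 1 < b ∨ a + 1 = b := by
  obtain ⟨c, rfl⟩ := (hM.lt_iff _ _).1 h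
  rcases hM.zero_le c with h0 | rfl
  · obtain ⟨d, rfl⟩ := (hM.lt_iff _ _).1 h0
    refine Or.inl ((hM.lt_iff _ _).2 ⟨d, ?_⟩)
    rw [hM.zero_add, hM.succ_add, hM.add_succ]
  · exact Or.inr (by rw [hM.add_zero])

theorem trichotomy (hM : ModelsRCA0 M) (a n : M) : a < n ∨ a = n ∨ n < a := by
  have : ∀ n : M, ¬ (¬ a < n ∧ ¬ a = n ∧ ¬ n < a) :=
    hM.bdd_induction (.neg (.and (.neg (.lt (.var 2) (.var 1)))
      (.and (.neg (.eq (.var 2) (.var 1))) (.neg (.lt (.var 1) (.var 2))))))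
      (fun _ => a) (fun n => ¬ (¬ a < n ∧ ¬ a = n ∧ ¬ n < a)) (fun _ _ _ => Iff.rfl)
      (fun h => (hM.zero_le a).elim h.2.2 fun h' => h.2.1 h'.symm)
      (fun n h h' => by
        rw [hM.lt_succ_iff] at h'
        have : n < a := by tauto
        rcases hM.succ_le_of_lt this with h2 | h2
        · exact h'.2.2 h2
        · exact h'.2.1 h2.symm)
  have := this n
  tauto

end ModelsRCA0

variable [hM : Fact (ModelsRCA0 M)]

noncomputable instance instCommSemiring : CommSemiring M where
  zero := 0
  one := 1
  add := (· + ·)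
  mul := (· * ·)
  nsmul := nsmulRec
  npow := npowRec
  zero_add := hM.out.zero_add
  add_zero := hM.out.add_zero
  add_comm := hM.out.add_comm
  add_assoc := hM.out.add_assoc
  zero_mul := hM.out.zero_mul
  mul_zero := hM.out.mul_zero
  one_mul n := by rw [hM.out.mul_comm, hM.out.mul_one]
  mul_one := hM.out.mul_one
  mul_comm := hM.out.mul_comm
  mul_assoc := hM.out.mul_assoc
  left_distrib := hM.out.mul_add
  right_distrib a b c := by
    rw [hM.out.mul_comm, hM.out.mul_add, hM.out.mul_comm c, hM.out.mul_comm c]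

open Classical in
noncomputable instance instLinearOrder : LinearOrder M where
  lt := (· < ·)
  le a b := a < b ∨ a = b
  le_refl a := Or.inr rfl
  le_trans a b c := by
    rintro (h | rfl) (h' | rfl)
    · exact Or.inl (hM.out.lt_trans h h')
    · exact Or.inl h
    · exact Or.inl h'
    · exact Or.inr rfl
  lt_iff_le_not_ge a b := by
    constructor
    · intro h
      refine ⟨Or.inl h, ?_⟩
      rintro (h' | rfl)
      · exact hM.out.lt_irrefl _ (hM.out.lt_trans h h')
      · exact hM.out.lt_irrefl _ h
    · rintro ⟨h | rfl, h'⟩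
      · exact h
      · exact (h' (Or.inr rfl)).elim
  le_antisymm a b := by
    rintro (h | h) (h' | h')
    · exact (hM.out.lt_irrefl _ (hM.out.lt_trans h h')).elim
    · exact h'.symm
    · exact h
    · exact h
  le_total a b := by
    have := hM.out.trichotomy a b
    tauto
  toDecidableLE := Classical.decRel _

theorem lt_iff_exists_add_succ {a b : M} : a < b ↔ ∃ c, b = a + c + 1 := hM.out.lt_iff a b

theorem lt_add_one_iff' {a b : M} : a < b + 1 ↔ a ≤ b := hM.out.lt_succ_iff a b

theorem add_one_le_iff' {a b : M} : a + 1 ≤ b ↔ a < b :=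
  ⟨fun h => (lt_add_one_iff'.2 le_rfl).trans_le h, fun h => hM.out.succ_le_of_lt h⟩

theorem zero_le' (a : M) : 0 ≤ a := hM.out.zero_le a

instance : Nontrivial M := ⟨1, 0, by simpa using hM.out.succ_ne_zero 0⟩

instance : IsOrderedAddMonoid M where
  add_le_add_left a b h c := by
    rcases h with h | rfl
    · obtain ⟨x, rfl⟩ := lt_iff_exists_add_succ.1 h
      exact Or.inl (lt_iff_exists_add_succ.2 ⟨x, by ring⟩)
    · exact le_rfl

instance : IsOrderedCancelAddMonoid M where
  le_of_add_le_add_left a b c h := by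
    by_contra h'
    rw [not_le] at h'
    obtain ⟨x, rfl⟩ := lt_iff_exists_add_succ.1 h'
    exact absurd h (not_le.2 (lt_iff_exists_add_succ.2 ⟨x, by ring⟩))

instance : IsStrictOrderedRing M where
  zero_le_one := zero_le' 1
  mul_lt_mul_of_pos_left c hc a b h := by
    obtain ⟨x, rfl⟩ := lt_iff_exists_add_succ.1 h
    obtain ⟨y, rfl⟩ := lt_iff_exists_add_succ.1 hc
    exact lt_iff_exists_add_succ.2 ⟨x * y + x + y, by ring⟩
  mul_lt_mul_of_pos_right c hc a b h := by
    obtain ⟨x, rfl⟩ := lt_iff_exists_add_succ.1 h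
    obtain ⟨y, rfl⟩ := lt_iff_exists_add_succ.1 hc
    exact lt_iff_exists_add_succ.2 ⟨x * y + x + y, by ring⟩

instance : CanonicallyOrderedAdd M where
  exists_add_of_le {a b} h := by
    rcases h with h | rfl
    · obtain ⟨x, rfl⟩ := lt_iff_exists_add_succ.1 h
      exact ⟨x + 1, by ring⟩
    · exact ⟨0, by simp⟩
  le_add_self a b := by
    have := add_le_add_right (zero_le' b) a
    simpa [add_comm] using this
  le_self_add a b := by
    have := add_le_add_right (zero_le' b) a
    simpa [add_comm] using this

end Arithmetic

/-! ### Definability by bounded and Σ⁰₁ formulas: closure, collection, comprehension, induction. -/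

section Formulas

variable {M : Type u} [L2Structure M]

/-- Renaming of the variables of a term. -/
def NumTerm.ren (ρ : ℕ → ℕ) : NumTerm → NumTerm
  | .var i => .var (ρ i)
  | .zero => .zero
  | .one => .one
  | .add s t => .add (s.ren ρ) (t.ren ρ)
  | .mul s t => .mul (s.ren ρ) (t.ren ρ)

theorem NumTerm.eval_ren (ρ : ℕ → ℕ) (e : ℕ → M) (t : NumTerm) :
    (t.ren ρ).eval e = t.eval (fun i => e (ρ i)) := by
  induction t <;> simp_all [NumTerm.ren, NumTerm.eval]

/-- A renaming of variables, extended below one quantifier. -/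
def liftRen (ρ : ℕ → ℕ) : ℕ → ℕ
  | 0 => 0
  | n + 1 => ρ n + 1

/-- Renaming of the number variables of a formula. -/
def BddFormula.ren : (ℕ → ℕ) → BddFormula → BddFormula
  | ρ, .eq s t => .eq (s.ren ρ) (t.ren ρ)
  | ρ, .lt s t => .lt (s.ren ρ) (t.ren ρ)
  | ρ, .mem t i => .mem (t.ren ρ) i
  | ρ, .neg φ => .neg (φ.ren ρ)
  | ρ, .and φ ψ => .and (φ.ren ρ) (ψ.ren ρ)
  | ρ, .bex t φ => .bex (t.ren ρ) (φ.ren (liftRen ρ))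

theorem push_liftRen {M : Type u} (ρ : ℕ → ℕ) (e : ℕ → M) (x : M) :
    (fun i => push x e (liftRen ρ i)) = push x (fun i => e (ρ i)) := by
  funext i
  cases i <;> rfl

theorem BddFormula.sat_ren (X : ℕ → Set M) (φ : BddFormula) (ρ : ℕ → ℕ) (e : ℕ → M) :
    (φ.ren ρ).Sat X e ↔ φ.Sat X (fun i => e (ρ i)) := by
  induction φ generalizing ρ e with
  | bex t φ ih => simp [BddFormula.ren, BddFormula.Sat, NumTerm.eval_ren, ih, push_liftRen]
  | _ => simp_all [BddFormula.ren, BddFormula.Sat, NumTerm.eval_ren]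

/-- Renaming of the set variables of a formula. -/
def BddFormula.renSet (f : ℕ → ℕ) : BddFormula → BddFormula
  | .eq s t => .eq s t
  | .lt s t => .lt s t
  | .mem t i => .mem t (f i)
  | .neg φ => .neg (φ.renSet f)
  | .and φ ψ => .and (φ.renSet f) (ψ.renSet f)
  | .bex t φ => .bex t (φ.renSet f)

theorem BddFormula.sat_renSet (X : ℕ → Set M) (f : ℕ → ℕ) (φ : BddFormula) (e : ℕ → M) :
    (φ.renSet f).Sat X e ↔ φ.Sat (fun i => X (f i)) e := by
  induction φ generalizing e <;> simp_all [BddFormula.renSet, BddFormula.Sat]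

/-- Predicates of assignments that are defined by a bounded formula with set parameters. -/
def IsBdd (P : (ℕ → M) → Prop) : Prop :=
  ∃ (φ : BddFormula) (X : ℕ → Set M), (∀ i, X i ∈ sets M) ∧ ∀ e, φ.Sat X e ↔ P e

/-- The two families of set parameters are interleaved on the even and the odd indices. -/
theorem IsBdd.common {P Q : (ℕ → M) → Prop} (hP : IsBdd P) (hQ : IsBdd Q) :
    ∃ (φ ψ : BddFormula) (X : ℕ → Set M), (∀ i, X i ∈ sets M) ∧ (∀ e, φ.Sat X e ↔ P e) ∧
      ∀ e, ψ.Sat X e ↔ Q e := by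
  obtain ⟨φ, X, hX, hφ⟩ := hP
  obtain ⟨ψ, Y, hY, hψ⟩ := hQ
  refine ⟨φ.renSet (fun i => 2 * i), ψ.renSet (fun i => 2 * i + 1),
    fun n => if n % 2 = 0 then X (n / 2) else Y (n / 2), ?_, ?_, ?_⟩
  · intro i
    dsimp only
    split_ifs
    exacts [hX _, hY _]
  · intro e
    rw [BddFormula.sat_renSet, ← hφ]
    simp
  · intro e
    rw [BddFormula.sat_renSet, ← hψ]
    have h1 (i : ℕ) : (2 * i + 1) / 2 = i := by omega
    have h2 (i : ℕ) : (2 * i + 1) % 2 = 1 := by omega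
    simp [h1, h2]

theorem IsBdd.congr {P Q : (ℕ → M) → Prop} (hP : IsBdd P) (h : ∀ e, Q e ↔ P e) : IsBdd Q := by
  obtain ⟨φ, X, hX, hφ⟩ := hP
  exact ⟨φ, X, hX, fun e => (hφ e).trans (h e).symm⟩

theorem IsBdd.eq (s t : NumTerm) : IsBdd fun e : ℕ → M => s.eval e = t.eval e := by
  obtain ⟨X, hX⟩ := L2Structure.sets_nonempty (M := M)
  exact ⟨.eq s t, fun _ => X, fun _ => hX, fun e => Iff.rfl⟩

theorem IsBdd.lt (s t : NumTerm) : IsBdd fun e : ℕ → M => s.eval e < t.eval e := by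
  obtain ⟨X, hX⟩ := L2Structure.sets_nonempty (M := M)
  exact ⟨.lt s t, fun _ => X, fun _ => hX, fun e => Iff.rfl⟩

theorem IsBdd.mem (t : NumTerm) {X : Set M} (hX : X ∈ sets M) :
    IsBdd fun e : ℕ → M => t.eval e ∈ X :=
  ⟨.mem t 0, fun _ => X, fun _ => hX, fun _ => Iff.rfl⟩

theorem IsBdd.not {P : (ℕ → M) → Prop} (hP : IsBdd P) : IsBdd fun e => ¬ P e := by
  obtain ⟨φ, X, hX, hφ⟩ := hP
  exact ⟨.neg φ, X, hX, fun e => not_congr (hφ e)⟩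

theorem IsBdd.and {P Q : (ℕ → M) → Prop} (hP : IsBdd P) (hQ : IsBdd Q) :
    IsBdd fun e => P e ∧ Q e := by
  obtain ⟨φ, ψ, X, hX, hφ, hψ⟩ := hP.common hQ
  exact ⟨.and φ ψ, X, hX, fun e => and_congr (hφ e) (hψ e)⟩

theorem IsBdd.or {P Q : (ℕ → M) → Prop} (hP : IsBdd P) (hQ : IsBdd Q) :
    IsBdd fun e => P e ∨ Q e :=
  (hP.not.and hQ.not).not.congr fun e => by tauto

theorem IsBdd.bex (t : NumTerm) {P : (ℕ → M) → Prop} (hP : IsBdd P) :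
    IsBdd fun e => ∃ x, x < t.eval e ∧ P (push x e) := by
  obtain ⟨φ, X, hX, hφ⟩ := hP
  exact ⟨.bex t φ, X, hX, fun e => exists_congr fun x => and_congr_right fun _ => hφ _⟩

theorem IsBdd.ball (t : NumTerm) {P : (ℕ → M) → Prop} (hP : IsBdd P) :
    IsBdd fun e => ∀ x, x < t.eval e → P (push x e) :=
  (hP.not.bex t).not.congr fun e => by simp

theorem IsBdd.ren {P : (ℕ → M) → Prop} (hP : IsBdd P) (ρ : ℕ → ℕ) :
    IsBdd fun e => P (fun i => e (ρ i)) := by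
  obtain ⟨φ, X, hX, hφ⟩ := hP
  exact ⟨φ.ren ρ, X, hX, fun e => by rw [BddFormula.sat_ren, hφ]⟩

/-- Predicates of assignments that are defined by a `Σ⁰₁` formula with set parameters. -/
def IsSigma (P : (ℕ → M) → Prop) : Prop :=
  ∃ Q : (ℕ → M) → Prop, IsBdd Q ∧ ∀ e, P e ↔ ∃ x, Q (push x e)

theorem IsSigma.congr {P Q : (ℕ → M) → Prop} (hP : IsSigma P) (h : ∀ e, Q e ↔ P e) :
    IsSigma Q := by
  obtain ⟨R, hR, hRP⟩ := hP
  exact ⟨R, hR, fun e => (h e).trans (hRP e)⟩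

theorem IsBdd.isSigma {P : (ℕ → M) → Prop} (hP : IsBdd P) : IsSigma P :=
  ⟨fun e => P (fun i => e (i + 1)), hP.ren _, fun e => by simp [push]⟩

theorem IsSigma.ren {P : (ℕ → M) → Prop} (hP : IsSigma P) (ρ : ℕ → ℕ) :
    IsSigma fun e => P (fun i => e (ρ i)) := by
  obtain ⟨R, hR, hRP⟩ := hP
  refine ⟨_, hR.ren (liftRen ρ), fun e => ?_⟩
  simp_rw [push_liftRen]
  exact hRP _

theorem IsSigma.or {P Q : (ℕ → M) → Prop} (hP : IsSigma P) (hQ : IsSigma Q) :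
    IsSigma fun e => P e ∨ Q e := by
  obtain ⟨R, hR, hRP⟩ := hP
  obtain ⟨S, hS, hSQ⟩ := hQ
  exact ⟨_, hR.or hS, fun e => by simp only [hRP, hSQ, exists_or]⟩

variable [hM : Fact (ModelsRCA0 M)]

/-- Two unbounded quantifiers are contracted by one common bound on both witnesses, so no pairing
function is needed at this stage. -/
theorem IsSigma.ex {P : (ℕ → M) → Prop} (hP : IsSigma P) :
    IsSigma fun e => ∃ x, P (push x e) := by
  obtain ⟨R, hR, hRP⟩ := hP
  let ρ : ℕ → ℕ := liftRen (liftRen Nat.succ)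
  refine ⟨_, ((hR.ren ρ).bex (.add (.var 1) .one)).bex (.add (.var 0) .one), fun e => ?_⟩
  have hρ (x y z : M) : (fun i => push x (push y (push z e)) (ρ i)) = push x (push y e) := by
    funext i
    match i with
    | 0 => rfl
    | 1 => rfl
    | i + 2 => rfl
  simp only [hρ]
  change _ ↔ ∃ z : M, ∃ y : M, y < z + 1 ∧ ∃ x : M, x < z + 1 ∧ R (push x (push y e))
  constructor
  · rintro ⟨y, hy⟩
    obtain ⟨x, hx⟩ := (hRP _).1 hy
    exact ⟨max x y, y, lt_add_one_iff'.2 (le_max_right _ _), x,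
      lt_add_one_iff'.2 (le_max_left _ _), hx⟩
  · rintro ⟨z, y, -, x, -, h⟩
    exact ⟨y, (hRP _).2 ⟨x, h⟩⟩

theorem IsSigma.and {P Q : (ℕ → M) → Prop} (hP : IsSigma P) (hQ : IsSigma Q) :
    IsSigma fun e => P e ∧ Q e := by
  obtain ⟨R, hR, hRP⟩ := hP
  obtain ⟨S, hS, hSQ⟩ := hQ
  have h1 : IsSigma fun e : ℕ → M => ∃ x, R (push x fun i => e (i + 1)) ∧ S (push (e 0)
      fun i => e (i + 1)) := by
    refine ⟨_, (hR.ren (liftRen Nat.succ)).and (hS.ren Nat.succ), fun e => ?_⟩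
    refine exists_congr fun x => and_congr (iff_of_eq (congrArg R ?_)) (iff_of_eq (congrArg S ?_))
    · funext i
      cases i <;> rfl
    · funext i
      cases i <;> rfl
  refine h1.ex.congr fun e => ?_
  rw [hRP, hSQ]
  exact ⟨fun ⟨⟨x, hx⟩, ⟨y, hy⟩⟩ => ⟨y, x, hx, hy⟩, fun ⟨y, x, hx, hy⟩ => ⟨⟨x, hx⟩, ⟨y, hy⟩⟩⟩

/-- The `Σ⁰₁` collection principle. -/
theorem IsSigma.ball (t : NumTerm) {P : (ℕ → M) → Prop} (hP : IsSigma P) :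
    IsSigma fun e => ∀ x, x < t.eval e → P (push x e) := by
  obtain ⟨R, hR, hRP⟩ := hP
  let ρ : ℕ → ℕ := liftRen (liftRen Nat.succ)
  have hρ (e : ℕ → M) (x y z : M) :
      (fun i => push x (push y (push z e)) (ρ i)) = push x (push y e) := by
    funext i
    match i with
    | 0 => rfl
    | 1 => rfl
    | i + 2 => rfl
  have h2 : IsBdd fun e : ℕ → M =>
      ∀ y : M, y < (t.ren Nat.succ).eval e → ∃ x : M, x < e 0 + 1 ∧
        R (fun i => push x (push y e) (ρ i)) :=
    ((hR.ren ρ).bex (.add (.var 1) .one)).ball (t.ren Nat.succ)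
  refine ⟨_, h2, fun e => ?_⟩
  simp only [NumTerm.eval_ren]
  change _ ↔ ∃ z : M, ∀ y : M, y < t.eval e → ∃ x : M, x < z + 1 ∧
    R (fun i => push x (push y (push z e)) (ρ i))
  simp only [hρ]
  constructor
  · intro h
    let σ : ℕ → ℕ := liftRen (liftRen (fun i => i + 2))
    have hσ (z n y x : M) : (fun i => push x (push y (push z (push n e))) (σ i))
        = push x (push y e) := by
      funext i
      match i with
      | 0 => rfl
      | 1 => rfl
      | i + 2 => rfl
    obtain ⟨φ, X, hX, hφ⟩ : IsBdd fun e : ℕ → M =>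
        ∀ y : M, y < e 1 → ∃ x : M, x < e 0 + 1 ∧ R (fun i => push x (push y e) (σ i)) :=
      ((hR.ren σ).bex (.add (.var 1) .one)).ball (.var 1)
    -- Σ⁰₁ induction on n collects the witnesses for all y < n under a single bound; the successor
    -- step takes a maximum.
    have key : ∀ n : M, n ≤ t.eval e → ∃ z : M, ∀ y, y < n → ∃ x, x < z + 1 ∧
        R (push x (push y e)) := by
      obtain ⟨ψ, Y, hY, hψ⟩ : IsBdd fun e : ℕ → M => ¬ (e 1 < (t.ren (fun i => i + 2)).eval e + 1 ∧
          ¬ ∀ y : M, y < e 1 → ∃ x : M, x < e 0 + 1 ∧ R (fun i => push x (push y e) (σ i))) :=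
        ((IsBdd.lt (.var 1) (.add (t.ren (fun i => i + 2)) .one)).and
          (IsBdd.not ⟨φ, X, hX, hφ⟩)).not
      have hψ' (z n : M) : ψ.Sat Y (push z (push n e)) ↔ (n ≤ t.eval e → ∀ y : M, y < n →
          ∃ x : M, x < z + 1 ∧ R (push x (push y e))) := by
        rw [hψ]
        simp only [NumTerm.eval_ren]
        change ¬ (n < t.eval e + 1 ∧ ¬ ∀ y : M, y < n → ∃ x : M, x < z + 1 ∧
          R (fun i => push x (push y (push z (push n e))) (σ i))) ↔ _
        simp only [hσ]
        rw [lt_add_one_iff']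
        tauto
      have := hM.out.sigma1_induction ψ e Y hY ⟨0, (hψ' _ _).2 fun _ y hy =>
        (hM.out.not_lt_zero _ hy).elim⟩ (by
          rintro n ⟨z, hz⟩
          rw [hψ'] at hz
          by_cases hn : n < t.eval e
          · obtain ⟨x, hx⟩ := (hRP _).1 (h n hn)
            refine ⟨max z x, (hψ' _ _).2 fun _ y hy => ?_⟩
            rcases (hM.out.lt_succ_iff _ _).1 hy with hy | rfl
            · obtain ⟨x', hx', hR'⟩ := hz hn.le y hy
              exact ⟨x', lt_add_one_iff'.2 ((lt_add_one_iff'.1 hx').trans (le_max_left _ _)), hR'⟩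
            · exact ⟨x, lt_add_one_iff'.2 (le_max_right _ _), hx⟩
          -- Past the value of t the claim is vacuous, so any bound serves.
          · exact ⟨0, (hψ' _ _).2 fun hn' => (hn (add_one_le_iff'.1 hn')).elim⟩)
      intro n hn
      obtain ⟨z, hz⟩ := this n
      exact ⟨z, (hψ' _ _).1 hz hn⟩
    exact key _ le_rfl
  · rintro ⟨z, hz⟩ y hy
    obtain ⟨x, -, hx⟩ := hz y hy
    exact (hRP _).2 ⟨x, hx⟩

/-- Lets a number parameter be passed as a set parameter, so that the definability predicates carry
set parameters only. -/
theorem singleton_mem_sets (c : M) : {c} ∈ sets M := by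
  obtain ⟨X, hX⟩ := L2Structure.sets_nonempty (M := M)
  obtain ⟨Y, hY, h⟩ := hM.out.delta1_comprehension (.eq (.var 1) (.var 2)) (.eq (.var 1) (.var 2))
    (fun _ => c) (fun _ => X) (fun _ => hX)
    (fun n => by
      change (∃ _ : M, n = c) ↔ ∀ _ : M, n = c
      simp)
  convert hY
  ext n
  rw [h]
  simp [BddFormula.Sat, NumTerm.eval, push]

theorem setOf_mem_sets {P : M → Prop} {Q R : (ℕ → M) → Prop} (hQ : IsSigma Q) (hR : IsSigma R)
    (hPQ : ∀ n e, P n ↔ Q (push n e)) (hPR : ∀ n e, ¬ P n ↔ R (push n e)) :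
    {n | P n} ∈ sets M := by
  obtain ⟨Q', hQ', hQQ'⟩ := hQ
  obtain ⟨R', hR', hRR'⟩ := hR
  obtain ⟨φ, ψ, X, hX, hφ, hψ⟩ := hQ'.common hR'.not
  obtain ⟨Y, hY, h⟩ := hM.out.delta1_comprehension φ ψ (fun _ => 0) X hX (fun n => by
    simp only [hφ, hψ]
    rw [← hQQ', ← hPQ, ← not_exists, ← hRR', ← hPR, not_not])
  convert hY
  ext n
  rw [h, Set.mem_ofPred_eq, hPQ n (fun _ => 0), hQQ']
  simp only [hφ]

theorem IsSigma.induction {P : M → Prop} {Q : (ℕ → M) → Prop} (hQ : IsSigma Q)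
    (hPQ : ∀ n e, P n ↔ Q (push n e)) (h0 : P 0) (hs : ∀ n, P n → P (n + 1)) (n : M) : P n := by
  obtain ⟨Q', ⟨φ, X, hX, hφ⟩, hQQ'⟩ := hQ
  have key (n : M) : P n ↔ ∃ x, φ.Sat X (push x (push n fun _ => 0)) := by
    rw [hPQ n fun _ => 0, hQQ']
    simp only [hφ]
  rw [key]
  exact hM.out.sigma1_induction φ _ X hX ((key _).1 h0) (fun n => by
    rw [← key, ← key]
    exact hs n) n

end Formulas

/-! ### The pairing function. -/

section Pairing

variable {M : Type u} [L2Structure M] [hM : Fact (ModelsRCA0 M)]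

theorem left_lt_pair (a b : M) : a < pair a b :=
  lt_add_one_iff'.2 le_add_self

theorem add_lt_pair (a b : M) : a + b < pair a b := by
  rw [pair, lt_add_one_iff']
  rcases (zero_le' (a + b)).eq_or_lt with h | h
  · rw [← h]
    exact zero_le' _
  · exact (le_mul_of_one_le_right (zero_le' _)
      (by simpa using add_one_le_iff'.2 h)).trans le_self_add

theorem right_lt_pair (a b : M) : b < pair a b :=
  le_add_self.trans_lt (add_lt_pair a b)

theorem pair_ne_zero (a b : M) : pair a b ≠ 0 := hM.out.succ_ne_zero _

/-- Because codes grow with the sum of the components, recursion on a + b is course-of-values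
recursion on the code of (a, b). -/
theorem pair_lt_pair {a b c d : M} (h : a + b < c + d) : pair a b < pair c d := by
  obtain ⟨x, hx⟩ := lt_iff_exists_add_succ.1 h
  unfold pair
  rw [hx]
  refine lt_iff_exists_add_succ.2 ⟨x * x + 2 * (a + b) * x + 2 * x + a + b + b + c, ?_⟩
  ring

theorem pair_injective {a b c d : M} (h : pair a b = pair c d) : a = c ∧ b = d := by
  rcases lt_trichotomy (a + b) (c + d) with h' | h' | h'
  · exact absurd h (pair_lt_pair h').ne
  · unfold pair at h
    rw [h'] at h
    have h1 : a = c := by grind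
    exact ⟨h1, by grind⟩
  · exact absurd h (pair_lt_pair h').ne'

theorem pair_inj {a b c d : M} : pair a b = pair c d ↔ a = c ∧ b = d :=
  ⟨pair_injective, fun h => by rw [h.1, h.2]⟩

/-- The term for the pairing function. -/
def NumTerm.pair (s t : NumTerm) : NumTerm :=
  .add (.add (.mul (.add s t) (.add s t)) s) .one

theorem IsBdd.eq_pair (i j k : ℕ) : IsBdd fun e : ℕ → M => e i = RevMath.pair (e j) (e k) :=
  IsBdd.eq (.var i) (.pair (.var j) (.var k))

end Pairing

/-! ### Coded types. -/

/-- Types whose elements are coded by numbers of `M`. -/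
class Coded (M : Type u) [L2Structure M] (γ : Type v) where
  /-- the code of an element -/
  enc : γ → M
  enc_injective : Function.Injective enc
  range_bdd : IsBdd fun e : ℕ → M => ∃ a, enc a = e 0

section Codes

variable {M : Type u} [L2Structure M]

open Coded

instance Coded.self : Coded M M where
  enc := id
  enc_injective := Function.injective_id
  range_bdd := (IsBdd.eq .zero .zero).congr fun e => by simp

variable [hM : Fact (ModelsRCA0 M)]

instance Coded.prod {γ : Type v} {δ : Type w} [Coded M γ] [Coded M δ] : Coded M (γ × δ) where
  enc a := pair (enc a.1) (enc a.2)
  enc_injective a b h := by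
    obtain ⟨h1, h2⟩ := pair_injective h
    exact Prod.ext (enc_injective h1) (enc_injective h2)
  range_bdd := by
    have h : IsBdd fun e : ℕ → M => ∃ x, x < e 0 ∧ ∃ y, y < e 0 ∧
        (e 0 = pair x y ∧ (∃ a : γ, enc a = x) ∧ ∃ b : δ, enc b = y) :=
      (((IsBdd.eq_pair 2 1 0).and (((range_bdd (M := M) (γ := γ)).ren fun i => i + 1).and
        (range_bdd (M := M) (γ := δ)))).bex (.var 1)).bex (.var 0)
    refine h.congr fun e => ⟨?_, ?_⟩
    · rintro ⟨⟨a, b⟩, h⟩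
      rw [← h]
      exact ⟨_, left_lt_pair _ _, _, right_lt_pair _ _, rfl, ⟨a, rfl⟩, b, rfl⟩
    · rintro ⟨_, -, _, -, h, ⟨a, rfl⟩, b, rfl⟩
      exact ⟨(a, b), h.symm⟩

-- With truth values coded, a decidable predicate is simply a computable function into `Prop`, and
-- one calculus serves both.
open Classical in
noncomputable instance Coded.prop : Coded M Prop where
  enc p := if p then 1 else 0
  enc_injective p q h := by
    by_cases hp : p <;> by_cases hq : q <;> simp_all
  range_bdd := by
    refine ((IsBdd.eq (.var 0) .zero).or (IsBdd.eq (.var 0) .one)).congr fun e => ⟨?_, ?_⟩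
    · rintro ⟨p, h⟩
      by_cases hp : p
      · exact Or.inr (by rw [if_pos hp] at h; exact h.symm)
      · exact Or.inl (by rw [if_neg hp] at h; exact h.symm)
    · rintro (h | h)
      · exact ⟨False, by rw [if_neg not_false]; exact h.symm⟩
      · exact ⟨True, by rw [if_pos trivial]; exact h.symm⟩

end Codes

/-! ### Calculus of Σ⁰₁ predicates and computable functions, with the available induction
principles. -/

section Computable

open Coded

variable (M : Type u) [L2Structure M]

/-- `Σ⁰₁` predicates, with set parameters, on a coded type. -/
def Sig {γ : Type v} [Coded M γ] (P : γ → Prop) : Prop :=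
  ∃ Q : (ℕ → M) → Prop, IsSigma Q ∧ ∀ a e, P a ↔ Q (push (enc a) e)

/-- Functions between coded types with a `Σ⁰₁` graph, where set parameters are allowed. For
functions with values in `Prop` these are the `Δ⁰₁` predicates. -/
@[fun_prop]
def Comp {γ : Type v} {δ : Type w} [Coded M γ] [Coded M δ] (f : γ → δ) : Prop :=
  ∃ G : (ℕ → M) → Prop, IsSigma G ∧ ∀ a y e, y = enc (f a) ↔ G (push y (push (enc a) e))

variable {M} [hM : Fact (ModelsRCA0 M)] {γ : Type v} {δ : Type w} {ε : Type z} [Coded M γ]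
  [Coded M δ] [Coded M ε]

theorem Sig.congr {P Q : γ → Prop} (hP : Sig M P) (h : ∀ a, Q a ↔ P a) : Sig M Q := by
  obtain ⟨R, hR, hRP⟩ := hP
  exact ⟨R, hR, fun a e => (h a).trans (hRP a e)⟩

theorem Sig.and {P Q : γ → Prop} (hP : Sig M P) (hQ : Sig M Q) : Sig M fun a => P a ∧ Q a := by
  obtain ⟨R, hR, hRP⟩ := hP
  obtain ⟨S, hS, hSQ⟩ := hQ
  exact ⟨_, hR.and hS, fun a e => and_congr (hRP a e) (hSQ a e)⟩

theorem Sig.or {P Q : γ → Prop} (hP : Sig M P) (hQ : Sig M Q) : Sig M fun a => P a ∨ Q a := by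
  obtain ⟨R, hR, hRP⟩ := hP
  obtain ⟨S, hS, hSQ⟩ := hQ
  exact ⟨_, hR.or hS, fun a e => or_congr (hRP a e) (hSQ a e)⟩

theorem Sig.comp {P : δ → Prop} {f : γ → δ} (hP : Sig M P) (hf : Comp M f) :
    Sig M fun a => P (f a) := by
  obtain ⟨R, hR, hRP⟩ := hP
  obtain ⟨G, hG, hGf⟩ := hf
  refine ⟨_, (hG.and hR).ex, fun a e => ⟨fun h => ⟨_, (hGf a _ e).1 rfl, (hRP _ _).1 h⟩, ?_⟩⟩
  rintro ⟨y, h1, h2⟩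
  obtain rfl := (hGf a _ e).2 h1
  exact (hRP _ _).2 h2

theorem push_swap {M : Type u} (x y z : M) (e : ℕ → M) :
    (fun i => push z (push y (push x e)) (liftRen Nat.succ i)) = push z (push x e) := by
  funext i
  cases i <;> rfl

theorem push_two {M : Type u} (x y : M) (e : ℕ → M) :
    (fun i => push x (push y e) (if i = 0 then 1 else if i = 1 then 0 else i))
      = push y (push x e) := by
  funext i
  match i with
  | 0 => rfl
  | 1 => rfl
  | i + 2 => simp [push]

theorem Comp.comp {g : δ → ε} {f : γ → δ} (hg : Comp M g) (hf : Comp M f) :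
    Comp M fun a => g (f a) := by
  obtain ⟨G, hG, hGf⟩ := hf
  obtain ⟨H, hH, hHg⟩ := hg
  refine ⟨_, ((hG.ren (liftRen Nat.succ)).and
    (hH.ren fun i => if i = 0 then 1 else if i = 1 then 0 else i)).ex, fun a y e => ?_⟩
  simp only [push_swap, push_two]
  refine ⟨?_, ?_⟩
  · rintro rfl
    exact ⟨_, (hGf _ _ _).1 rfl, (hHg _ _ _).1 rfl⟩
  · rintro ⟨z, h1, h2⟩
    obtain rfl := (hGf _ _ _).2 h1
    exact (hHg _ _ _).2 h2

theorem Comp.id : Comp M fun a : γ => a :=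
  ⟨_, (IsBdd.eq (.var 0) (.var 1)).isSigma, fun _ _ _ => Iff.rfl⟩

theorem Comp.const (c : δ) : Comp M fun _ : γ => c :=
  ⟨_, (IsBdd.mem (.var 0) (singleton_mem_sets (enc c))).isSigma, fun _ _ _ => Iff.rfl⟩

theorem Comp.fst' : Comp M (Prod.fst : γ × δ → γ) := by
  have h : IsBdd fun e : ℕ → M => ∃ x, x < e 1 ∧ e 1 = pair (e 0) x :=
    (IsBdd.eq_pair 2 1 0).bex (.var 1)
  refine ⟨_, h.isSigma, fun a y e => ⟨?_, ?_⟩⟩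
  · rintro rfl
    exact ⟨enc a.2, right_lt_pair _ _, rfl⟩
  · rintro ⟨x, -, h⟩
    exact (pair_injective h).1.symm

theorem Comp.snd' : Comp M (Prod.snd : γ × δ → δ) := by
  have h : IsBdd fun e : ℕ → M => ∃ x, x < e 1 ∧ e 1 = pair x (e 0) :=
    (IsBdd.eq_pair 2 0 1).bex (.var 1)
  refine ⟨_, h.isSigma, fun a y e => ⟨?_, ?_⟩⟩
  · rintro rfl
    exact ⟨enc a.1, left_lt_pair _ _, rfl⟩
  · rintro ⟨x, -, h⟩
    exact (pair_injective h).2.symm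

theorem Comp.prodMk {f : γ → δ} {g : γ → ε} (hf : Comp M f) (hg : Comp M g) :
    Comp M fun a => (f a, g a) := by
  obtain ⟨F, hF, hFf⟩ := hf
  obtain ⟨G, hG, hGg⟩ := hg
  let ρ : ℕ → ℕ := liftRen fun i => i + 2
  let σ : ℕ → ℕ := fun i => if i = 0 then 1 else i + 2
  have hρ (x y z : M) (e : ℕ → M) :
      (fun i => push x (push y (push z e)) (ρ i)) = push x e := by
    funext i
    cases i <;> rfl
  have hσ (x y z : M) (e : ℕ → M) :
      (fun i => push x (push y (push z e)) (σ i)) = push y e := by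
    funext i
    cases i <;> rfl
  refine ⟨_, (((IsBdd.eq_pair 2 1 0).isSigma.and ((hF.ren σ).and (hG.ren ρ))).ex).ex,
    fun a y e => ?_⟩
  simp only [hρ, hσ]
  constructor
  · rintro rfl
    exact ⟨_, _, rfl, (hFf _ _ _).1 rfl, (hGg _ _ _).1 rfl⟩
  · rintro ⟨u, v, h, h1, h2⟩
    obtain rfl := (hFf _ _ _).2 h1
    obtain rfl := (hGg _ _ _).2 h2
    exact h

attribute [fun_prop] Comp.comp Comp.id Comp.const Comp.prodMk

@[fun_prop]
theorem Comp.fst {f : γ → δ × ε} (hf : Comp M f) : Comp M fun a => (f a).1 := Comp.fst'.comp hf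

@[fun_prop]
theorem Comp.snd {f : γ → δ × ε} (hf : Comp M f) : Comp M fun a => (f a).2 := Comp.snd'.comp hf

theorem Sig.ex {P : γ → δ → Prop} (hP : Sig M fun x : γ × δ => P x.1 x.2) :
    Sig M fun a => ∃ b, P a b := by
  obtain ⟨R, hR, hRP⟩ := hP
  refine ⟨_, (((IsBdd.eq_pair 1 2 0).isSigma.and ((Coded.range_bdd (M := M)
    (γ := δ)).isSigma.and (hR.ren fun i => i + 1))).ex).ex, fun a e => ?_⟩
  constructor
  · rintro ⟨b, h⟩
    exact ⟨_, _, rfl, ⟨b, rfl⟩, (hRP (a, b) _).1 h⟩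
  · rintro ⟨z, _, h1, ⟨b, rfl⟩, h2⟩
    obtain rfl : z = pair (enc a) (enc b) := h1
    exact ⟨b, (hRP (a, b) _).2 h2⟩

theorem Sig.ball {P : γ → M → Prop} {g : γ → M} (hg : Comp M g)
    (hP : Sig M fun x : γ × M => P x.1 x.2) :
    Sig M fun a => ∀ b < g a, P a b := by
  obtain ⟨R, hR, hRP⟩ := hP
  obtain ⟨G, hG, hGg⟩ := hg
  have h1 : IsSigma fun e : ℕ → M => ∀ b, b < e 0 → ∃ z, z = pair (e 1) b ∧
      R (push z fun i => push b e (i + 1)) := by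
    refine IsSigma.ball (.var 0) (P := fun e => ∃ z, z = pair (e 2) (e 0) ∧
      R (push z fun i => e (i + 1))) ?_
    refine IsSigma.ex (P := fun e => e 0 = pair (e 3) (e 1) ∧
      R (push (e 0) fun i => e (i + 2))) ?_
    refine ((IsBdd.eq_pair 0 3 1).isSigma.and (hR.ren (fun i => if i = 0 then 0 else i + 1))).congr
      fun e => and_congr_right fun _ => iff_of_eq (congrArg R ?_)
    funext i
    cases i <;> rfl
  refine ⟨_, (hG.and h1).ex, fun a e => ?_⟩
  constructor
  · intro h
    exact ⟨_, (hGg _ _ _).1 rfl, fun b hb => ⟨_, rfl, (hRP (a, b) _).1 (h b hb)⟩⟩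
  · rintro ⟨n, h1, h2⟩ b hb
    obtain rfl := (hGg _ _ _).2 h1
    obtain ⟨z, h3, h4⟩ := h2 b hb
    obtain rfl : z = pair (enc a) b := h3
    exact (hRP (a, b) _).2 h4

theorem Comp.sig_eq {f : γ → δ} (hf : Comp M f) : Sig M fun x : γ × δ => x.2 = f x.1 := by
  obtain ⟨G, hG, hGf⟩ := hf
  refine ⟨_, ((IsBdd.eq_pair 2 1 0).isSigma.and (hG.ren
    (fun i => if i = 0 then 0 else i))).ex.ex, fun a e => ?_⟩
  have h0 (e : ℕ → M) : (fun i => e (if i = 0 then 0 else i)) = e := by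
    funext i
    cases i <;> rfl
  simp only [h0]
  constructor
  · intro h
    exact ⟨enc a.1, enc a.2, rfl, (hGf _ _ _).1 (by rw [h])⟩
  · rintro ⟨x, y, h1, h2⟩
    obtain ⟨rfl, rfl⟩ := pair_injective (show pair (enc a.1) (enc a.2) = pair x y from h1)
    exact enc_injective ((hGf _ _ _).2 h2)

theorem Comp.of_graph {f : γ → δ} (hf : Sig M fun x : γ × δ => x.2 = f x.1) : Comp M f := by
  obtain ⟨G, hG, hGf⟩ := hf
  refine ⟨_, ((IsBdd.eq_pair 0 2 1).isSigma.and (((Coded.range_bdd (M := M)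
    (γ := δ)).ren (fun i => i + 1)).isSigma.and hG)).ex, fun a y e => ?_⟩
  constructor
  · rintro rfl
    exact ⟨_, rfl, ⟨_, rfl⟩, (hGf (a, f a) _).1 rfl⟩
  · rintro ⟨z, h1, ⟨b, h2⟩, h3⟩
    obtain rfl : enc b = y := h2
    obtain rfl : z = pair (enc a) (enc b) := h1
    exact congrArg enc ((hGf (a, b) _).2 h3)

theorem Comp.sig {P : γ → Prop} (hP : Comp M P) : Sig M P :=
  ((hP.sig_eq).comp (Comp.prodMk Comp.id (Comp.const True))).congr fun a => by simp

theorem Comp.sig_not {P : γ → Prop} (hP : Comp M P) : Sig M fun a => ¬ P a :=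
  ((hP.sig_eq).comp (Comp.prodMk Comp.id (Comp.const False))).congr fun a => by simp

theorem Sig.eq_const (c : δ) : Sig M fun x : δ => x = c :=
  (Comp.const (M := M) (γ := δ) c).sig_eq.comp (Comp.prodMk Comp.id Comp.id)

/-- The graph of P is the union of a part with value true, described by P, and a part with value
false, described by its negation. -/
theorem Comp.of_sig {P : γ → Prop} (hP : Sig M P) (hP' : Sig M fun a => ¬ P a) : Comp M P :=
  .of_graph <| ((((Sig.eq_const True).comp Comp.snd').and (hP.comp Comp.fst')).or
    (((Sig.eq_const False).comp Comp.snd').and (hP'.comp Comp.fst'))).congr fun ⟨a, p⟩ => by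
      by_cases h : p <;> by_cases h' : P a <;> simp [h, h']

theorem Comp.congr {f g : γ → δ} (hf : Comp M f) (h : ∀ a, g a = f a) : Comp M g := by
  rwa [show g = f from funext h]

theorem Comp.congr_iff {P Q : γ → Prop} (hf : Comp M P) (h : ∀ a, Q a ↔ P a) : Comp M Q :=
  hf.congr fun a => propext (h a)

@[fun_prop]
theorem Comp.not {P : γ → Prop} (hP : Comp M P) : Comp M fun a => ¬ P a :=
  .of_sig hP.sig_not (hP.sig.congr fun a => by simp)

@[fun_prop]
theorem Comp.and {P Q : γ → Prop} (hP : Comp M P) (hQ : Comp M Q) :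
    Comp M fun a => P a ∧ Q a :=
  .of_sig (hP.sig.and hQ.sig) ((hP.sig_not.or hQ.sig_not).congr fun a => by tauto)

@[fun_prop]
theorem Comp.or {P Q : γ → Prop} (hP : Comp M P) (hQ : Comp M Q) :
    Comp M fun a => P a ∨ Q a :=
  .of_sig (hP.sig.or hQ.sig) ((hP.sig_not.and hQ.sig_not).congr fun a => by tauto)

theorem Comp.imp {P Q : γ → Prop} (hP : Comp M P) (hQ : Comp M Q) :
    Comp M fun a => P a → Q a :=
  (hP.not.or hQ).congr_iff fun a => by tauto

theorem IsBdd.of_pair {P : (ℕ → M) → Prop} (hP : IsBdd P) :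
    IsBdd fun e => ∃ y, y < e 0 ∧ ∃ x, x < e 0 ∧ e 0 = pair x y ∧ P (push x (push y e)) :=
  (((IsBdd.eq_pair 2 0 1).and hP).bex (.var 1)).bex (.var 0)

theorem Comp.lt' : Comp M fun x : M × M => x.1 < x.2 := by
  have h := (IsBdd.lt (M := M) (.var 0) (.var 1)).of_pair
  have h' := (IsBdd.lt (M := M) (.var 0) (.var 1)).not.of_pair
  refine .of_sig ⟨_, h.isSigma, fun a e => ⟨fun ha => ?_, ?_⟩⟩
    ⟨_, h'.isSigma, fun a e => ⟨fun ha => ?_, ?_⟩⟩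
  · exact ⟨a.2, right_lt_pair _ _, a.1, left_lt_pair _ _, rfl, ha⟩
  · rintro ⟨y, -, x, -, h1, h2⟩
    obtain ⟨rfl, rfl⟩ := pair_injective (show pair a.1 a.2 = pair x y from h1)
    exact h2
  · exact ⟨a.2, right_lt_pair _ _, a.1, left_lt_pair _ _, rfl, ha⟩
  · rintro ⟨y, -, x, -, h1, h2⟩
    obtain ⟨rfl, rfl⟩ := pair_injective (show pair a.1 a.2 = pair x y from h1)
    exact h2

@[fun_prop]
theorem Comp.lt {f g : γ → M} (hf : Comp M f) (hg : Comp M g) : Comp M fun a => f a < g a :=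
  Comp.lt'.comp (hf.prodMk hg)

@[fun_prop]
theorem Comp.le {f g : γ → M} (hf : Comp M f) (hg : Comp M g) : Comp M fun a => f a ≤ g a :=
  (hg.lt hf).not.congr_iff fun _ => by simp

theorem Comp.eq' : Comp M fun x : γ × γ => x.1 = x.2 := by
  have h' := (IsBdd.eq (M := M) (.var 0) (.var 1)).not.of_pair
  refine .of_sig ((Comp.id (M := M) (γ := γ)).sig_eq.congr fun _ => eq_comm)
    ⟨_, h'.isSigma, fun a e => ⟨fun ha => ?_, ?_⟩⟩
  · exact ⟨enc a.2, right_lt_pair _ _, enc a.1, left_lt_pair _ _, rfl,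
      fun h => ha (enc_injective h)⟩
  · rintro ⟨y, -, x, -, h1, h2⟩
    obtain ⟨rfl, rfl⟩ := pair_injective (show pair (enc a.1) (enc a.2) = pair x y from h1)
    exact fun h => h2 (congrArg enc h)

@[fun_prop]
theorem Comp.eq {f g : γ → δ} (hf : Comp M f) (hg : Comp M g) : Comp M fun a => f a = g a :=
  Comp.eq'.comp (hf.prodMk hg)

@[fun_prop]
theorem Comp.ne {f g : γ → δ} (hf : Comp M f) (hg : Comp M g) : Comp M fun a => f a ≠ g a :=
  (hf.eq hg).not

theorem Comp.add' : Comp M fun x : M × M => x.1 + x.2 := by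
  have h : IsBdd fun e : ℕ → M => ∃ y, y < e 1 ∧ ∃ x, x < e 1 ∧ e 1 = pair x y ∧ e 0 = x + y :=
    (((IsBdd.eq_pair 3 0 1).and (IsBdd.eq (.var 2) (.add (.var 0) (.var 1)))).bex (.var 2)).bex
      (.var 1)
  refine ⟨_, h.isSigma, fun a y e => ⟨fun ha => ?_, ?_⟩⟩
  · exact ⟨a.2, right_lt_pair _ _, a.1, left_lt_pair _ _, rfl, ha⟩
  · rintro ⟨y, -, x, -, h1, h2⟩
    obtain ⟨rfl, rfl⟩ := pair_injective (show pair a.1 a.2 = pair x y from h1)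
    exact h2

theorem Comp.mul' : Comp M fun x : M × M => x.1 * x.2 := by
  have h : IsBdd fun e : ℕ → M => ∃ y, y < e 1 ∧ ∃ x, x < e 1 ∧ e 1 = pair x y ∧ e 0 = x * y :=
    (((IsBdd.eq_pair 3 0 1).and (IsBdd.eq (.var 2) (.mul (.var 0) (.var 1)))).bex (.var 2)).bex
      (.var 1)
  refine ⟨_, h.isSigma, fun a y e => ⟨fun ha => ?_, ?_⟩⟩
  · exact ⟨a.2, right_lt_pair _ _, a.1, left_lt_pair _ _, rfl, ha⟩
  · rintro ⟨y, -, x, -, h1, h2⟩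
    obtain ⟨rfl, rfl⟩ := pair_injective (show pair a.1 a.2 = pair x y from h1)
    exact h2

@[fun_prop]
theorem Comp.add {f g : γ → M} (hf : Comp M f) (hg : Comp M g) : Comp M fun a => f a + g a :=
  Comp.add'.comp (hf.prodMk hg)

@[fun_prop]
theorem Comp.mul {f g : γ → M} (hf : Comp M f) (hg : Comp M g) : Comp M fun a => f a * g a :=
  Comp.mul'.comp (hf.prodMk hg)

@[fun_prop]
theorem Comp.pair {f g : γ → M} (hf : Comp M f) (hg : Comp M g) :
    Comp M fun a => pair (f a) (g a) := by
  unfold RevMath.pair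
  fun_prop

/-- The positive half is Σ⁰₁ collection; the negation is an ordinary existential statement. -/
theorem Comp.ball {P : γ → M → Prop} {g : γ → M} (hg : Comp M g)
    (hP : Comp M fun x : γ × M => P x.1 x.2) : Comp M fun a => ∀ b < g a, P a b := by
  have hlt : Comp M fun x : γ × M => x.2 < g x.1 := by fun_prop
  exact .of_sig (.ball hg hP.sig) ((Sig.ex (P := fun a b => b < g a ∧ ¬ P a b)
    (hlt.sig.and hP.sig_not)).congr fun a => by simp)

theorem Comp.bex {P : γ → M → Prop} {g : γ → M} (hg : Comp M g)
    (hP : Comp M fun x : γ × M => P x.1 x.2) : Comp M fun a => ∃ b < g a, P a b :=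
  (Comp.ball (P := fun a b => ¬ P a b) hg hP.not).not.congr_iff fun a => by simp

theorem Comp.mem {X : Set M} (hX : X ∈ sets M) : Comp M fun n : M => n ∈ X :=
  .of_sig ⟨_, (IsBdd.mem (.var 0) hX).isSigma, fun _ _ => Iff.rfl⟩
    ⟨_, (IsBdd.mem (.var 0) hX).not.isSigma, fun _ _ => Iff.rfl⟩

theorem Comp.setOf_mem {P : M → Prop} (hP : Comp M P) : {n | P n} ∈ sets M := by
  obtain ⟨Q, hQ, hPQ⟩ := hP.sig
  obtain ⟨R, hR, hPR⟩ := hP.sig_not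
  exact setOf_mem_sets hQ hR hPQ hPR

@[fun_prop]
theorem Comp.ite {P : γ → Prop} [∀ a, Decidable (P a)] {f g : γ → δ} (hP : Comp M P)
    (hf : Comp M f) (hg : Comp M g) : Comp M fun a => if P a then f a else g a :=
  .of_graph <| (((hP.sig.comp Comp.fst').and hf.sig_eq).or
    ((hP.sig_not.comp Comp.fst').and hg.sig_eq)).congr fun a => by
      by_cases h : P a.1 <;> simp [h]

theorem Sig.induction {P : M → Prop} (hP : Sig M P) (h0 : P 0) (hs : ∀ n, P n → P (n + 1))
    (n : M) : P n := by
  obtain ⟨Q, hQ, hPQ⟩ := hP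
  exact hQ.induction hPQ h0 hs n

theorem Comp.induction {P : M → Prop} (hP : Comp M P) (h0 : P 0) (hs : ∀ n, P n → P (n + 1))
    (n : M) : P n := hP.sig.induction h0 hs n

/-- Induction for `Π⁰₁` predicates. -/
theorem Comp.pi_induction {P : M → γ → Prop} (hP : Comp M fun x : M × γ => P x.1 x.2)
    (h0 : ∀ a, P 0 a) (hs : ∀ n, (∀ a, P n a) → ∀ a, P (n + 1) a) (n : M) (a : γ) : P n a := by
  by_contra hn
  -- A counterexample at n is pushed down one step at a time: Σ⁰₁ induction on i provides one at n -
  -- i, and i = n contradicts the base case.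
  have key : ∀ i, ∃ m a, ¬ P m a ∧ (m + i = n ∨ n < i) := by
    refine Sig.induction (.ex (P := fun i m => ∃ a, ¬ P m a ∧ (m + i = n ∨ n < i))
      (.ex (P := fun (x : M × M) a => ¬ P x.2 a ∧ (x.2 + x.1 = n ∨ n < x.1)) (Comp.sig ?_)))
      ⟨n, a, hn, by simp⟩ ?_
    · refine .and (.not (hP.comp (f := fun x : (M × M) × γ => (x.1.2, x.2)) ?_)) ?_ <;> fun_prop
    · rintro i ⟨m, b, hb, h⟩
      have hm : m ≠ 0 := fun h => hb (h ▸ h0 b)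
      obtain ⟨k, rfl⟩ : ∃ k, m = k + 1 := by
        obtain ⟨k, hk⟩ := lt_iff_exists_add_succ.1 (pos_iff_ne_zero.2 hm)
        exact ⟨k, by simpa using hk⟩
      obtain ⟨c, hc⟩ : ∃ c, ¬ P k c := by
        by_contra! h'
        exact hb (hs k h' b)
      refine ⟨k, c, hc, ?_⟩
      rcases h with h | h
      · exact Or.inl (by rw [← h]; ring)
      · exact Or.inr (h.trans (lt_add_one_iff'.2 le_rfl))
  obtain ⟨m, b, hb, h⟩ := key n
  rcases h with h | h
  · exact hb ((show m = 0 by grind) ▸ h0 b)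
  · exact lt_irrefl _ h

/-- Induction along a computable measure. -/
theorem Comp.measure_induction {P : γ → Prop} (hP : Comp M P) {μ : γ → M} (hμ : Comp M μ)
    (h : ∀ a, (∀ b, μ b < μ a → P b) → P a) (a : γ) : P a := by
  -- All arguments of measure below n are treated at once; this quantifier over arguments makes the
  -- induction Π⁰₁.
  have key := Comp.pi_induction (M := M) (P := fun n a => μ a < n → P a)
    (.imp (by fun_prop) (by fun_prop)) (fun a h => absurd h (not_lt.2 (zero_le' _)))
    (fun n ih a ha => h a fun b hb => ih b (hb.trans_le (lt_add_one_iff'.1 ha)))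
  exact key _ a (lt_add_one_iff'.2 le_rfl)

theorem Comp.strong_induction {P : M → Prop} (hP : Comp M P)
    (h : ∀ n, (∀ m < n, P m) → P n) (n : M) : P n :=
  hP.measure_induction Comp.id h n

theorem Comp.exists_least {P : M → Prop} (hP : Comp M P) (h : ∃ n, P n) :
    ∃ n, P n ∧ ∀ m < n, ¬ P m := by
  by_contra! h'
  obtain ⟨n, hn⟩ := h
  exact hP.not.strong_induction (fun n ih hn => by
    obtain ⟨m, hm, hm'⟩ := h' n hn
    exact ih m hm hm') n hn

/-- Search for a witness of a decidable predicate. -/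
theorem Comp.exists_choice {P : γ → M → Prop} (hP : Comp M fun x : γ × M => P x.1 x.2)
    (h : ∀ a, ∃ n, P a n) : ∃ f : γ → M, Comp M f ∧ ∀ a, P a (f a) := by
  have h1 (a : γ) := Comp.exists_least (hP.comp (f := fun n => (a, n)) (by fun_prop)) (h a)
  choose f hf hf' using h1
  refine ⟨f, .of_graph ?_, hf⟩
  -- The least witness is singled out by a decidable condition, so choosing it has a Σ⁰₁ graph.
  have h2 : Comp M fun x : γ × M => P x.1 x.2 ∧ ∀ m < x.2, ¬ P x.1 m :=
    hP.and (.ball (by fun_prop) (.not (hP.comp (f := fun x : (γ × M) × M => (x.1.1, x.2))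
      (by fun_prop))))
  refine h2.sig.congr fun ⟨a, n⟩ => ⟨?_, ?_⟩
  · intro h
    obtain rfl : n = f a := h
    exact ⟨hf a, hf' a⟩
  · rintro ⟨h3, h4⟩
    rcases lt_trichotomy n (f a) with h | h | h
    · exact absurd h3 (hf' a n h)
    · exact h
    · exact absurd (hf a) (h4 _ h)

end Computable

/-! ### Coding of finite sequences by the β function, and recursion. -/

section Recursion

variable {M : Type u} [L2Structure M] [hM : Fact (ModelsRCA0 M)] {γ : Type v} [Coded M γ]

theorem Comp.const_left {δ : Type w} {ε : Type z} [Coded M δ] [Coded M ε] {f : γ × δ → ε}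
    (hf : Comp M f) (a : γ) : Comp M fun x => f (a, x) :=
  hf.comp (by fun_prop)

theorem exists_left : ∃ f : M → M, Comp M f ∧ ∀ a b, f (pair a b) = a := by
  obtain ⟨f, hf, h⟩ := Comp.exists_choice (M := M) (γ := M)
    -- The premise makes the search terminate also at numbers that are not pairs, where the value is
    -- irrelevant.
    (P := fun n a => (∃ c < n, ∃ b < n, n = pair c b) → ∃ b < n, n = pair a b)
    (.imp (.bex (by fun_prop) (.bex (by fun_prop) (by fun_prop)))
      (.bex (by fun_prop) (by fun_prop))) (fun n => by
        by_cases h : ∃ c < n, ∃ b < n, n = pair c b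
        · obtain ⟨c, -, b, hb, h⟩ := h
          exact ⟨c, fun _ => ⟨b, hb, h⟩⟩
        · exact ⟨0, fun h' => absurd h' h⟩)
  refine ⟨f, hf, fun a b => ?_⟩
  obtain ⟨c, -, hc⟩ := h (pair a b) ⟨a, left_lt_pair _ _, b, right_lt_pair _ _, rfl⟩
  exact (pair_injective hc).1.symm

theorem exists_right : ∃ f : M → M, Comp M f ∧ ∀ a b, f (pair a b) = b := by
  obtain ⟨f, hf, h⟩ := Comp.exists_choice (M := M) (γ := M)
    (P := fun n b => (∃ c < n, ∃ b < n, n = pair c b) → ∃ a < n, n = pair a b)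
    (.imp (.bex (by fun_prop) (.bex (by fun_prop) (by fun_prop)))
      (.bex (by fun_prop) (by fun_prop))) (fun n => by
        by_cases h : ∃ c < n, ∃ b < n, n = pair c b
        · obtain ⟨c, hc, b, -, h⟩ := h
          exact ⟨b, fun _ => ⟨c, hc, h⟩⟩
        · exact ⟨0, fun h' => absurd h' h⟩)
  refine ⟨f, hf, fun a b => ?_⟩
  obtain ⟨c, -, hc⟩ := h (pair a b) ⟨a, left_lt_pair _ _, b, right_lt_pair _ _, rfl⟩
  exact (pair_injective hc).2.symm

/-- The first component of a pair. -/
noncomputable def left : M → M := exists_left.choose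

/-- The second component of a pair. -/
noncomputable def right : M → M := exists_right.choose

@[simp] theorem left_pair (a b : M) : left (pair a b) = a := exists_left.choose_spec.2 a b

@[simp] theorem right_pair (a b : M) : right (pair a b) = b := exists_right.choose_spec.2 a b

@[fun_prop]
theorem Comp.left {f : γ → M} (hf : Comp M f) : Comp M fun a => left (f a) :=
  exists_left.choose_spec.1.comp hf

@[fun_prop]
theorem Comp.right {f : γ → M} (hf : Comp M f) : Comp M fun a => right (f a) :=
  exists_right.choose_spec.1.comp hf

theorem exists_rem : ∃ f : M × M → M, Comp M f ∧ ∀ q m r, r < m → f (q * m + r, m) = r := by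
  obtain ⟨f, hf, h⟩ := Comp.exists_choice (M := M) (γ := M × M)
    (P := fun x r => (∃ q < x.1 + 1, ∃ r < x.2, x.1 = q * x.2 + r) →
      r < x.2 ∧ ∃ q < x.1 + 1, x.1 = q * x.2 + r)
    (.imp (.bex (by fun_prop) (.bex (by fun_prop) (by fun_prop)))
      (.and (by fun_prop) (.bex (by fun_prop) (by fun_prop)))) (fun x => by
        by_cases h : ∃ q < x.1 + 1, ∃ r < x.2, x.1 = q * x.2 + r
        · obtain ⟨q, hq, r, hr, h⟩ := h
          exact ⟨r, fun _ => ⟨hr, q, hq, h⟩⟩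
        · exact ⟨0, fun h' => absurd h' h⟩)
  refine ⟨f, hf, fun q m r hr => ?_⟩
  have hm : 0 < m := (zero_le' r).trans_lt hr
  have hq : q < q * m + r + 1 := lt_add_one_iff'.2 ((le_mul_of_one_le_right (zero_le' _)
    (by simpa using add_one_le_iff'.2 hm)).trans le_self_add)
  obtain ⟨h1, q', -, h2⟩ := h (q * m + r, m) ⟨q, hq, r, hr, rfl⟩
  dsimp only at h1 h2
  rcases lt_trichotomy q q' with h' | rfl | h'
  · obtain ⟨x, rfl⟩ := lt_iff_exists_add_succ.1 h'
    have : r = x * m + m + f (q * m + r, m) := by grind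
    exact absurd hr (not_lt.2 (by rw [this]; exact le_add_self.trans le_self_add))
  · grind
  · obtain ⟨x, rfl⟩ := lt_iff_exists_add_succ.1 h'
    have : f ((q' + x + 1) * m + r, m) = x * m + m + r := by grind
    exact absurd h1 (not_lt.2 (by rw [this]; exact le_add_self.trans le_self_add))

/-- The moduli of Gödel's `β` function. -/
def modulus (b i : M) : M := 1 + (i + 1) * b

@[fun_prop]
theorem Comp.modulus {f g : γ → M} (hf : Comp M f) (hg : Comp M g) :
    Comp M fun a => modulus (f a) (g a) := by
  unfold RevMath.modulus
  fun_prop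

/-- `look c i` is entry `i` of the finite sequence coded by `c`. -/
noncomputable def look (c i : M) : M := exists_rem.choose (left c, modulus (right c) i)

@[fun_prop]
theorem Comp.look {f g : γ → M} (hf : Comp M f) (hg : Comp M g) :
    Comp M fun a => look (f a) (g a) := by
  unfold RevMath.look
  exact exists_rem.choose_spec.1.comp (by fun_prop)

theorem look_pair {a b i q r : M} (h : a = q * modulus b i + r) (hr : r < modulus b i) :
    look (pair a b) i = r := by
  simp only [look, left_pair, right_pair]
  rw [h]
  exact exists_rem.choose_spec.2 q _ r hr

theorem exists_bound {x : M → M} (hx : Comp M x) (n : M) : ∃ B, ∀ i < n, x i ≤ B := by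
  refine Sig.induction (P := fun n => ∃ B, ∀ i < n, x i ≤ B) (.ex (.ball (by fun_prop)
    (Comp.sig (by fun_prop)))) ⟨0, fun i hi => absurd hi (not_lt.2 (zero_le' _))⟩ ?_ n
  rintro n ⟨B, hB⟩
  refine ⟨max B (x n), fun i hi => ?_⟩
  rcases (lt_add_one_iff'.1 hi).lt_or_eq with h | rfl
  · exact (hB i h).trans (le_max_left _ _)
  · exact le_max_right _ _

/-- Takes the place of a factorial, which would need recursion before recursion is available. The
requirement L ≠ 0 excludes the trivial common multiple. -/
theorem exists_common_multiple (n : M) : ∃ L : M, L ≠ 0 ∧ ∀ d < n, d ≠ 0 → ∃ e, L = d * e := by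
  refine Sig.induction (P := fun n : M => ∃ L : M, L ≠ 0 ∧ ∀ d < n, d ≠ 0 → ∃ e, L = d * e)
    (.ex (.and (Comp.sig (by fun_prop)) (.ball (by fun_prop) ?_)))
    ⟨1, one_ne_zero, fun i hi => absurd hi (not_lt.2 (zero_le' _))⟩ ?_ n
  · exact (Sig.or (P := fun x : (M × M) × M => x.2 = 0) (Comp.sig (by fun_prop))
      (Sig.ex (P := fun x e => x.1.2 = x.2 * e) (Comp.sig (by fun_prop)))).congr
        fun x => by tauto
  · rintro n ⟨L, hL, h⟩
    by_cases hn : n = 0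
    · refine ⟨L, hL, fun d hd hd0 => ?_⟩
      rw [hn, lt_add_one_iff'] at hd
      exact absurd (le_antisymm hd (zero_le' _)) hd0
    · refine ⟨L * n, mul_ne_zero hL hn, fun d hd hd0 => ?_⟩
      rcases (lt_add_one_iff'.1 hd).lt_or_eq with h' | rfl
      · obtain ⟨e, rfl⟩ := h d h' hd0
        exact ⟨e * n, by ring⟩
      · exact ⟨L, by ring⟩

/-- Modulo m = 1 + (i + d + 1)b one has (i + d + 1)b ≡ -1, and the modulus at i is ≡ -db. With de =
b, multiplying the latter by u = eb(i + d + 1)³ gives -(b(i + d + 1))³ ≡ 1. -/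
theorem modulus_coprime {b d e i : M} (hb : b = d * e) (h0 : b ≠ 0) :
    ∃ u v, u * modulus b i = v * modulus b (i + d) + 1 := by
  obtain ⟨b', hb'⟩ : ∃ b', b = b' + 1 := by
    obtain ⟨k, hk⟩ := lt_iff_exists_add_succ.1 (pos_iff_ne_zero.2 h0)
    exact ⟨k, by simpa using hk⟩
  -- The Bézout identity with one extra copy of the second modulus on both sides, so that no
  -- negative terms occur.
  have key : e * b * (i + d + 1) ^ 3 * modulus b i + modulus b (i + d) =
      (e * b * (i + d + 1) ^ 2 * (i + 1) + b * (i + d + 1)) * modulus b (i + d) + 1 := by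
    have : d * e * b = b * b := by rw [← hb]
    unfold modulus
    have h1 : e * b * (i + d + 1) ^ 3 * (1 + (i + 1) * b) + (1 + (i + d + 1) * b) =
      e * b * (i + d + 1) ^ 3 * (i + 1) * b + e * b * (i + d + 1) ^ 2 * (i + 1)
        + (i + d + 1) ^ 2 * (d * e * b) + 1 + (i + d + 1) * b := by ring
    rw [h1, this]
    ring
  -- The extra copy is cancelled by lowering the cofactor by 1; writing b = b' + 1 expresses this
  -- without subtraction.
  refine ⟨_, e * b * (i + d + 1) ^ 2 * (i + 1) + b' * (i + d + 1) + i + d,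
    add_right_cancel (b := modulus b (i + d)) (key.trans ?_)⟩
  have : b * (i + d + 1) = b' * (i + d + 1) + i + d + 1 := by rw [hb']; ring
  rw [this]
  ring

/-- Every finite initial part of a computable sequence has a code. -/
theorem exists_code {x : M → M} (hx : Comp M x) (n : M) : ∃ c, ∀ i < n, look c i = x i := by
  obtain ⟨B, hB⟩ := exists_bound hx n
  obtain ⟨L, hL, hLd⟩ := exists_common_multiple n
  -- The factor L makes the moduli with index below n pairwise coprime; the factor B + 1 makes them
  -- exceed all entries.
  obtain ⟨b, hb⟩ : ∃ b, b = L * (B + 1) := ⟨_, rfl⟩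
  have hb0 : b ≠ 0 := by
    rw [hb]
    exact mul_ne_zero hL (hM.out.succ_ne_zero B)
  have hbB : B < b := by
    rw [hb]
    exact add_one_le_iff'.1 (le_mul_of_one_le_left (zero_le' _)
      (by simpa using add_one_le_iff'.2 (pos_iff_ne_zero.2 hL)))
  have hlt (i : M) (hi : i < n) : x i < modulus b i := by
    refine ((hB i hi).trans_lt hbB).trans_le ?_
    unfold modulus
    exact (le_mul_of_one_le_left (zero_le' _) le_add_self).trans le_add_self
  -- Chinese remaindering, one modulus at a time: a has the prescribed residues at indices below k,
  -- P is a multiple of those moduli, and P is invertible modulo the remaining ones. The alternative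
  -- n < k stops the induction at n.
  have key (k : M) : ∃ a, ∃ P, (∀ i < k, ∃ q, a = q * modulus b i + x i) ∧
      (∀ i < k, ∃ q, P = q * modulus b i) ∧
      (∀ j < n, j < k ∨ ∃ u, ∃ v, u * P = v * modulus b j + 1) ∨ n < k := by
    refine Sig.induction (P := fun k => ∃ a, ∃ P, (∀ i < k, ∃ q, a = q * modulus b i + x i) ∧
      (∀ i < k, ∃ q, P = q * modulus b i) ∧
      (∀ j < n, j < k ∨ ∃ u, ∃ v, u * P = v * modulus b j + 1) ∨ n < k) ?_ ?_ ?_ k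
    · refine .ex (.ex (.or (.and (.ball (by fun_prop) (.ex (Comp.sig (by fun_prop))))
        (.and (.ball (by fun_prop) (.ex (Comp.sig (by fun_prop)))) (.ball (by fun_prop)
          (.or (Comp.sig (by fun_prop)) (.ex (.ex (Comp.sig (by fun_prop))))))))
        (Comp.sig (by fun_prop))))
    · exact ⟨0, 1, Or.inl ⟨fun i hi => absurd hi (not_lt.2 (zero_le' _)),
        fun i hi => absurd hi (not_lt.2 (zero_le' _)), fun j _ => Or.inr ⟨1, 0, by simp⟩⟩⟩
    · rintro k ⟨a, P, h⟩
      rcases lt_or_ge k n with hk | hk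
      swap
      · exact ⟨0, 0, Or.inr (lt_add_one_iff'.2 hk)⟩
      rcases h with ⟨h1, h2, h3⟩ | h
      swap
      · exact absurd h (not_lt.2 hk.le)
      obtain ⟨u, v, huv⟩ := (h3 k hk).resolve_left (lt_irrefl _)
      -- Modulo the new modulus uP ≡ 1 and (k + 1)b ≡ -1, so the correction amounts to x k - a; the
      -- earlier moduli divide P and are not affected.
      refine ⟨a + u * P * (x k + (k + 1) * b * a), P * modulus b k, Or.inl ⟨?_, ?_, ?_⟩⟩
      · intro i hi
        rcases (lt_add_one_iff'.1 hi).lt_or_eq with hi | rfl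
        · obtain ⟨q, hq⟩ := h1 i hi
          obtain ⟨p, hp⟩ := h2 i hi
          refine ⟨q + u * p * (x k + (k + 1) * b * a), ?_⟩
          conv_lhs => rw [hp]
          conv_lhs => enter [1]; rw [hq]
          ring
        · refine ⟨v * (x i + (i + 1) * b * a) + a, ?_⟩
          rw [huv]
          unfold modulus
          ring
      · intro i hi
        rcases (lt_add_one_iff'.1 hi).lt_or_eq with hi | rfl
        · obtain ⟨p, hp⟩ := h2 i hi
          exact ⟨p * modulus b k, by rw [hp]; ring⟩
        · exact ⟨P, rfl⟩
      · intro j hj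
        rcases h3 j hj with h | ⟨u', v', h'⟩
        · exact Or.inl (h.trans (lt_add_one_iff'.2 le_rfl))
        rcases lt_or_ge j (k + 1) with hjk | hjk
        · exact Or.inl hjk
        · obtain ⟨d, hd⟩ := lt_iff_exists_add_succ.1 (add_one_le_iff'.1 hjk)
          -- The index distance j - k is below n, so it divides L and therefore b. The moduli k and
          -- j are then coprime, and P times modulus k stays invertible modulo modulus j.
          obtain ⟨e, he⟩ := hLd (d + 1) (by
            refine lt_of_le_of_lt ?_ hj
            rw [hd, add_assoc]
            exact le_add_self) (hM.out.succ_ne_zero d)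
          obtain ⟨u, v, h⟩ := modulus_coprime (b := b) (d := d + 1) (e := e * (B + 1)) (i := k)
            (by rw [hb, he]; ring) hb0
          rw [← add_assoc, ← hd] at h
          refine Or.inr ⟨u' * u, v' * v * modulus b j + v + v', ?_⟩
          calc u' * u * (P * modulus b k) = (u' * P) * (u * modulus b k) := by ring
            _ = _ := by rw [h', h]; ring
  obtain ⟨a, P, ⟨h, -⟩ | h⟩ := key n
  · refine ⟨pair a b, fun i hi => ?_⟩
    obtain ⟨q, hq⟩ := h i hi
    exact look_pair hq (hlt i hi)
  · exact absurd h (lt_irrefl _)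

theorem exists_append : ∃ f : M × M × M → M, Comp M f ∧ ∀ c n y,
    (∀ i < n, look (f (c, n, y)) i = look c i) ∧ look (f (c, n, y)) n = y := by
  classical
  obtain ⟨f, hf, h⟩ := Comp.exists_choice (M := M) (γ := M × M × M)
    (P := fun x c' => (∀ i < x.2.1, look c' i = look x.1 i) ∧ look c' x.2.1 = x.2.2)
    (.and (.ball (by fun_prop) (by fun_prop)) (by fun_prop)) (fun ⟨c, n, y⟩ => by
      obtain ⟨c', hc'⟩ := exists_code (M := M) (x := fun i => if i = n then y else look c i)
        (.ite (by fun_prop) (by fun_prop) (by fun_prop)) (n + 1)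
      refine ⟨c', fun i hi => ?_, ?_⟩
      · rw [hc' i (hi.trans (lt_add_one_iff'.2 le_rfl)), if_neg (ne_of_lt hi)]
      · rw [hc' n (lt_add_one_iff'.2 le_rfl), if_pos rfl])
  exact ⟨f, hf, fun c n y => h (c, n, y)⟩

/-- Primitive recursion. -/
theorem exists_primrec {g : γ → M} {s : γ × M × M → M} (hg : Comp M g) (hs : Comp M s) :
    ∃ f : γ → M → M, (Comp M fun x : γ × M => f x.1 x.2) ∧ (∀ a, f a 0 = g a) ∧
      ∀ a n, f a (n + 1) = s (a, n, f a n) := by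
  let R : γ × M → M → Prop := fun x c =>
    look c 0 = g x.1 ∧ ∀ i < x.2, look c (i + 1) = s (x.1, i, look c i)
  have hR : Comp M fun x : (γ × M) × M => R x.1 x.2 :=
    .and (by fun_prop) (.ball (by fun_prop) (by fun_prop))
  obtain ⟨app, -, happ⟩ := exists_append (M := M)
  have hex (a : γ) (n : M) : ∃ c, R (a, n) c := by
    refine Sig.induction (P := fun n => ∃ c, R (a, n) c)
      (.ex (hR.comp (f := fun x : M × M => ((a, x.1), x.2)) (by fun_prop)).sig) ?_ ?_ n
    · exact ⟨app (0, 0, g a), (happ _ _ _).2, fun i hi => absurd hi (not_lt.2 (zero_le' _))⟩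
    · rintro n ⟨c, h0, h1⟩
      obtain ⟨h2, h3⟩ := happ c (n + 1) (s (a, n, look c n))
      refine ⟨app (c, n + 1, s (a, n, look c n)), ?_, fun i hi => ?_⟩
      · rw [h2 0 (lt_add_one_iff'.2 (zero_le' _)), h0]
      · dsimp only at hi
        rcases (lt_add_one_iff'.1 hi).lt_or_eq with h | rfl
        · rw [h2 _ (add_lt_add_left h 1), h2 i hi, h1 i h]
        · rw [h3, h2 i hi]
  -- The search may return different codes for different lengths; computations agree wherever both
  -- are defined, which makes the values fit together.
  have huniq (a : γ) (n c n' c' : M) (h : R (a, n) c) (h' : R (a, n') c') (i : M) :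
      i ≤ n → i ≤ n' → look c i = look c' i := by
    refine Comp.induction (P := fun i => i ≤ n → i ≤ n' → look c i = look c' i)
      (.imp (by fun_prop) (.imp (by fun_prop) (by fun_prop))) ?_ ?_ i
    · intro _ _
      rw [h.1, h'.1]
    · intro i ih hi hi'
      rw [h.2 i (add_one_le_iff'.1 hi), h'.2 i (add_one_le_iff'.1 hi'),
        ih (add_one_le_iff'.1 hi).le (add_one_le_iff'.1 hi').le]
  obtain ⟨F, hF, hFR⟩ := hR.exists_choice fun x => hex x.1 x.2
  refine ⟨fun a n => look (F (a, n)) n, by fun_prop, fun a => (hFR (a, 0)).1, fun a n => ?_⟩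
  have := (hFR (a, n + 1)).2 n (lt_add_one_iff'.2 le_rfl)
  dsimp only at this ⊢
  rw [this, huniq a _ _ _ _ (hFR (a, n + 1)) (hFR (a, n)) n
    (lt_add_one_iff'.2 le_rfl).le le_rfl]

/-- Course-of-values recursion: `S` is given a code of the sequence of the previous values. -/
theorem exists_course_rec {S : γ × M × M → M} (hS : Comp M S) :
    ∃ f t : γ → M → M, (Comp M fun x : γ × M => f x.1 x.2) ∧
      (Comp M fun x : γ × M => t x.1 x.2) ∧
      (∀ a n, f a n = S (a, n, t a n)) ∧ ∀ a n, ∀ m < n, look (t a n) m = f a m := by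
  obtain ⟨app, hc, happ⟩ := exists_append (M := M)
  obtain ⟨t, ht, ht0, hts⟩ := exists_primrec (M := M) (γ := γ) (g := fun _ => 0)
    (s := fun x => app (x.2.2, x.2.1, S x)) (by fun_prop) (by fun_prop)
  refine ⟨fun a n => S (a, n, t a n), t, by fun_prop, ht, fun _ _ => rfl, fun a n => ?_⟩
  refine Comp.induction (P := fun n => ∀ m < n, look (t a n) m = S (a, m, t a m)) ?_ ?_ ?_ n
  · refine .ball (by fun_prop) ?_
    exact (Comp.eq (f := fun x : γ × M × M => look (t x.1 x.2.1) x.2.2)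
      (g := fun x : γ × M × M => S (x.1, x.2.2, t x.1 x.2.2)) (by fun_prop)
      (by fun_prop)).const_left a
  · exact fun m hm => absurd hm (not_lt.2 (zero_le' _))
  · intro n ih m hm
    rw [hts]
    rcases (lt_add_one_iff'.1 hm).lt_or_eq with h | rfl
    · rw [(happ _ _ _).1 m h, ih m h]
    · rw [(happ _ _ _).2]

end Recursion

/-! ### Simultaneous recursive definition of two relations. -/

section RelationRecursion

variable {M : Type u} [L2Structure M] [hM : Fact (ModelsRCA0 M)] {γ : Type v} [Coded M γ]

/-- The set coding a relation. -/
def relSet (P : M → M → Prop) : Set M := {n | n = pair (left n) (right n) ∧ P (left n) (right n)}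

theorem rel_relSet {P : M → M → Prop} {a b : M} : Rel (relSet P) a b ↔ P a b := by
  simp [Rel, relSet]

theorem relSet_mem {P : M → M → Prop} (hP : Comp M fun x : M × M => P x.1 x.2) :
    relSet P ∈ sets M :=
  Comp.setOf_mem (by fun_prop)

theorem Comp.rel {R : Set M} (hR : R ∈ sets M) : Comp M fun x : M × M => Rel R x.1 x.2 :=
  (Comp.mem hR).comp (by fun_prop)

theorem Comp.srel {R : Set M} (hR : R ∈ sets M) : Comp M fun x : M × M => SRel R x.1 x.2 := by
  have := Comp.rel hR
  unfold SRel
  fun_prop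

open Classical in
/-- Two truth values as a number. -/
noncomputable def bits (p q : Prop) : M := pair (if p then 1 else 0) (if q then 1 else 0)

@[fun_prop]
theorem Comp.bits {p q : γ → Prop} (hp : Comp M p) (hq : Comp M q) :
    Comp M fun a => (bits (p a) (q a) : M) := by
  unfold RevMath.bits
  fun_prop

/-- The first truth value stored for the pair `a, b` in the table `c`. -/
noncomputable def fstBit (c a b : M) : Prop := left (look c (pair a b)) = 1

/-- The second truth value stored for the pair `a, b` in the table `c`. -/
noncomputable def sndBit (c a b : M) : Prop := right (look c (pair a b)) = 1

@[fun_prop]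
theorem Comp.fstBit {f g h : γ → M} (hf : Comp M f) (hg : Comp M g) (hh : Comp M h) :
    Comp M fun a => fstBit (f a) (g a) (h a) := by
  unfold RevMath.fstBit
  fun_prop

@[fun_prop]
theorem Comp.sndBit {f g h : γ → M} (hf : Comp M f) (hg : Comp M g) (hh : Comp M h) :
    Comp M fun a => sndBit (f a) (g a) (h a) := by
  unfold RevMath.sndBit
  fun_prop

/-- Simultaneous definition of two relations by recursion on the sum of the arguments. -/
theorem exists_rec_rel {Φ Ψ : M → M → M → Prop} (hΦ : Comp M fun x : M × M × M => Φ x.1 x.2.1 x.2.2)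
    (hΨ : Comp M fun x : M × M × M => Ψ x.1 x.2.1 x.2.2) :
    ∃ P Q : M → M → Prop, (Comp M fun x : M × M => P x.1 x.2) ∧
      (Comp M fun x : M × M => Q x.1 x.2) ∧ ∀ a b, ∃ c, (P a b ↔ Φ c a b) ∧ (Q a b ↔ Ψ c a b) ∧
      ∀ x y, x + y < a + b → (fstBit c x y ↔ P x y) ∧ (sndBit c x y ↔ Q x y) := by
  obtain ⟨f, t, hf, ht, h1, h2⟩ := exists_course_rec (M := M) (γ := M)
    (S := fun x => bits (Φ x.2.2 (left x.2.1) (right x.2.1)) (Ψ x.2.2 (left x.2.1) (right x.2.1)))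
    (by fun_prop)
  refine ⟨fun a b => left (f 0 (pair a b)) = 1, fun a b => right (f 0 (pair a b)) = 1,
    by fun_prop, by fun_prop, fun a b => ⟨t 0 (pair a b), ?_, ?_, fun x y hxy => ?_⟩⟩
  · dsimp only
    rw [h1]
    simp [bits]
  · dsimp only
    rw [h1]
    simp [bits]
  · rw [fstBit, sndBit, h2 _ _ _ (pair_lt_pair hxy)]
    exact ⟨Iff.rfl, Iff.rfl⟩

end RelationRecursion

/-! ### Existence of ε_Ω and of T_f(Q). -/

section Notation

variable {M : Type u} [L2Structure M] [hM : Fact (ModelsRCA0 M)] {γ : Type v} [Coded M γ]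

@[fun_prop]
theorem Comp.epsC {f : γ → M} (hf : Comp M f) : Comp M fun a => epsC (f a) := by
  unfold RevMath.epsC
  fun_prop

@[fun_prop]
theorem Comp.seqC {f : γ → M} (hf : Comp M f) : Comp M fun a => seqC (f a) := by
  unfold RevMath.seqC
  fun_prop

@[fun_prop]
theorem Comp.leafC {f : γ → M} (hf : Comp M f) : Comp M fun a => leafC (f a) := by
  unfold RevMath.leafC
  fun_prop

@[fun_prop]
theorem Comp.nodeC {f : γ → M} (hf : Comp M f) : Comp M fun a => nodeC (f a) := by
  unfold RevMath.nodeC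
  fun_prop

@[fun_prop]
theorem Comp.labelOf {f : γ → M} (hf : Comp M f) : Comp M fun a => labelOf (f a) := by
  unfold RevMath.labelOf
  fun_prop

theorem one_ne_two : (1 : M) ≠ 1 + 1 := by norm_num

theorem zero_ne_two : (0 : M) ≠ 1 + 1 := by norm_num

theorem comp_isConst {A : Set M} (hA : A ∈ sets M) : Comp M fun c : M => IsConst A c := by
  have hA' := Comp.mem hA
  have : Comp M fun c : M => c = zeroC ∨ c = omegaC ∨ (right c ∈ A ∧ c = epsC (right c)) := by
    fun_prop
  refine this.congr_iff fun c => or_congr_right (or_congr_right ⟨?_, ?_⟩)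
  · rintro ⟨α, hα, rfl⟩
    simpa [RevMath.epsC] using hα
  · exact fun h => ⟨_, h⟩

theorem IsConst.left_ne {A : Set M} {c : M} (h : IsConst A c) : left c ≠ 1 + 1 := by
  rcases h with rfl | rfl | ⟨α, -, rfl⟩
  · simpa [zeroC] using zero_ne_two
  · simpa [omegaC] using zero_ne_two
  · simp [epsC]

theorem zeroC_ne_omegaC : (zeroC : M) ≠ omegaC := fun h => zero_ne_one (pair_injective h).2

theorem zeroC_ne_epsC (α : M) : zeroC ≠ epsC α := fun h => zero_ne_one (pair_injective h).1

theorem omegaC_ne_epsC (α : M) : omegaC ≠ epsC α := fun h => zero_ne_one (pair_injective h).1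

theorem seqC_injective {k l : M} (h : seqC k = seqC l) : k = l := (pair_injective h).2

theorem lt_seqC (k : M) : k < seqC k := right_lt_pair _ _

/-- The notation system `ε_Ω` exists. -/
theorem nonempty_epsilonNotation {A LA : Set M} (hA : A ∈ sets M) (hLA : LA ∈ sets M) :
    Nonempty (EpsilonNotation A LA) := by
  have cA := Comp.mem hA
  have cLA := Comp.rel hLA
  have cC := comp_isConst hA
  -- Both orders are defined on arbitrary numbers first, because membership in the descending lists
  -- refers to the strict order.
  obtain ⟨le, lex, cle, clex, hrec⟩ := exists_rec_rel (M := M)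
    (Φ := fun c a b =>
      (left a = 1 + 1 ∧ left b = 1 + 1 ∧ sndBit c (right a) (right b)) ∨
      (left a = 1 + 1 ∧ left b ≠ 1 + 1 ∧ fstBit c (left (right a)) b ∧
        ¬ fstBit c b (left (right a))) ∨
      (left a ≠ 1 + 1 ∧ left b = 1 + 1 ∧ fstBit c a (left (right b))) ∨
      (left a ≠ 1 + 1 ∧ left b ≠ 1 + 1 ∧ (a = zeroC ∨ (a = omegaC ∧ b ≠ zeroC) ∨
        (a = epsC (right a) ∧ b = epsC (right b) ∧ Rel LA (right a) (right b)))))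
    (Ψ := fun c k l => k = 0 ∨ (l ≠ 0 ∧
      ((fstBit c (left k) (left l) ∧ ¬ fstBit c (left l) (left k)) ∨
        (fstBit c (left k) (left l) ∧ fstBit c (left l) (left k) ∧
          sndBit c (right k) (right l)))))
    (by fun_prop) (by fun_prop)
  have hs : Comp M fun x : M × M => SRel (relSet le) x.1 x.2 := Comp.srel (relSet_mem cle)
  -- Terms and lists are unary; they are handled as binary relations whose second argument is the
  -- dummy 0.
  obtain ⟨T, L, cT, cL, hrec'⟩ := exists_rec_rel (M := M)
    (Φ := fun c n _ => IsConst A n ∨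
      (n = seqC (pair (left (right n)) (right (right n))) ∧ sndBit c (right n) 0 ∧
        (right (right n) ≠ 0 ∨ (left (right n) ≠ omegaC ∧
          ¬ (left (right n) = epsC (right (left (right n))) ∧ right (left (right n)) ∈ A)))))
    (Ψ := fun c n _ => n = 0 ∨ (n = pair (left n) (right n) ∧ fstBit c (left n) 0 ∧
      sndBit c (right n) 0 ∧ (right n ≠ pair (left (right n)) (right (right n)) ∨
        SRel (relSet le) (left (right n)) (left n))))
    (by fun_prop) (by fun_prop)
  have hcc (a b : M) (ha : left a ≠ 1 + 1) (hb : left b ≠ 1 + 1) :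
      Rel (relSet le) a b ↔ (a = zeroC ∨ (a = omegaC ∧ b ≠ zeroC) ∨
        (a = epsC (right a) ∧ b = epsC (right b) ∧ Rel LA (right a) (right b))) := by
    obtain ⟨c, h1, -⟩ := hrec a b
    rw [rel_relSet, h1]
    simp [ha, hb]
  have h0 : left (zeroC : M) ≠ 1 + 1 := IsConst.left_ne (A := A) (Or.inl rfl)
  have h1 : left (omegaC : M) ≠ 1 + 1 := IsConst.left_ne (A := A) (Or.inr (Or.inl rfl))
  have h2 (α : M) : left (epsC α) ≠ 1 + 1 := by simp [epsC]
  have hT (n : M) : T n 0 ↔ IsConst A n ∨ ∃ t ℓ, n = seqC (pair t ℓ) ∧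
      L (pair t ℓ) 0 ∧ (ℓ = 0 → t ≠ omegaC ∧ ∀ α ∈ A, t ≠ epsC α) := by
    obtain ⟨c, h1, -, h3⟩ := hrec' n 0
    rw [h1]
    refine or_congr_right ⟨?_, ?_⟩
    · rintro ⟨hn, hl, h⟩
      refine ⟨_, _, hn, ?_, ?_⟩
      · rw [(h3 _ _ _).2] at hl
        · nth_rw 1 [hn] at hl
          simpa [seqC] using hl
        · simp only [add_zero]
          rw [hn]
          simpa [seqC] using right_lt_pair _ _
      · intro h'
        refine ⟨(h.resolve_left (not_not.2 h')).1, fun α hα hα' => ?_⟩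
        refine (h.resolve_left (not_not.2 h')).2 ?_
        rw [hα']
        simpa [epsC] using hα
    · rintro ⟨t, ℓ, rfl, hl, h⟩
      refine ⟨by simp [seqC], ?_, ?_⟩
      · rw [(h3 _ _ _).2]
        · simpa [seqC] using hl
        · simpa [seqC] using right_lt_pair _ _
      · by_cases hℓ : ℓ = 0
        · refine Or.inr ⟨by simpa [seqC] using (h hℓ).1, ?_⟩
          simp only [seqC, right_pair, left_pair]
          exact fun h' => (h hℓ).2 _ h'.2 h'.1
        · exact Or.inl (by simpa [seqC] using hℓ)
  have hL (n : M) : L n 0 ↔ n = 0 ∨ ∃ t ℓ, n = pair t ℓ ∧ T t 0 ∧ L ℓ 0 ∧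
      ∀ t' ℓ', ℓ = pair t' ℓ' → SRel (relSet le) t' t := by
    obtain ⟨c, -, h2, h3⟩ := hrec' n 0
    rw [h2]
    refine or_congr_right ⟨?_, ?_⟩
    · rintro ⟨hn, ht, hl, h⟩
      refine ⟨_, _, hn, ?_, ?_, ?_⟩
      · refine ((h3 _ _ ?_).1).1 ht
        rw [add_zero, add_zero]
        conv_rhs => rw [hn]
        exact left_lt_pair _ _
      · refine ((h3 _ _ ?_).2).1 hl
        rw [add_zero, add_zero]
        conv_rhs => rw [hn]
        exact right_lt_pair _ _
      · intro t' ℓ' h'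
        rw [h'] at h
        simpa using h
    · rintro ⟨t, ℓ, rfl, ht, hl, h⟩
      refine ⟨by simp, ?_, ?_, ?_⟩
      · refine ((h3 _ _ ?_).1).2 (by simpa using ht)
        simpa using left_lt_pair _ _
      · refine ((h3 _ _ ?_).2).2 (by simpa using hl)
        simpa using right_lt_pair _ _
      · simp only [right_pair, left_pair]
        by_cases h' : ℓ = pair (left ℓ) (right ℓ)
        · exact Or.inr (h _ _ h')
        · exact Or.inl h'
  refine ⟨⟨{n | T n 0}, relSet le, {n | L n 0}, relSet lex, Comp.setOf_mem (by fun_prop),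
    relSet_mem cle, Comp.setOf_mem (by fun_prop), relSet_mem clex, hT, hL,
    ?_, ?_, ?_, ?_, ?_, ?_, ?_, ?_, ?_, ?_, ?_, ?_⟩⟩
  · rw [SRel, hcc _ _ h0 h1, hcc _ _ h1 h0]
    simp [zeroC_ne_omegaC.symm, omegaC_ne_epsC]
  · intro α _
    rw [SRel, hcc _ _ h0 (h2 α), hcc _ _ (h2 α) h0]
    simp [(zeroC_ne_epsC α).symm, zeroC_ne_epsC]
  · intro α _
    rw [SRel, hcc _ _ h1 (h2 α), hcc _ _ (h2 α) h1]
    simp [(zeroC_ne_epsC α).symm, omegaC_ne_epsC, (omegaC_ne_epsC α).symm]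
  · rw [hcc _ _ h0 h0]
    simp
  · rw [hcc _ _ h1 h1]
    simp [zeroC_ne_omegaC.symm]
  · intro α _ β _
    rw [hcc _ _ (h2 α) (h2 β)]
    simp [(zeroC_ne_epsC α).symm, (omegaC_ne_epsC α).symm]
    simp [epsC]
  · intro c t ℓ hc _
    obtain ⟨d, h, -, h3⟩ := hrec c (seqC (pair t ℓ))
    have h4 := (h3 c t (add_lt_add_right ((left_lt_pair t ℓ).trans (lt_seqC _)) c)).1
    rw [rel_relSet, rel_relSet, h, ← h4]
    have := hc.left_ne
    simp [this, seqC]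
  · intro c t ℓ hc _
    obtain ⟨d, h, -, h3⟩ := hrec (seqC (pair t ℓ)) c
    have hlt := add_lt_add_left ((left_lt_pair t ℓ).trans (lt_seqC _)) c
    have h4 := (h3 t c hlt).1
    have h5 := (h3 c t (by rwa [add_comm c t])).1
    rw [SRel, rel_relSet, rel_relSet, rel_relSet, h, ← h4, ← h5]
    have := hc.left_ne
    simp [this, seqC]
  · intro k ℓ _ _
    obtain ⟨d, h, -, h3⟩ := hrec (seqC k) (seqC ℓ)
    have h4 := (h3 k ℓ (add_lt_add (lt_seqC _) (lt_seqC _))).2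
    rw [rel_relSet, rel_relSet, h, ← h4]
    simp [seqC]
  · intro ℓ _
    obtain ⟨d, -, h, -⟩ := hrec 0 ℓ
    rw [rel_relSet, h]
    exact Or.inl rfl
  · intro t ℓ _
    obtain ⟨d, -, h, -⟩ := hrec (pair t ℓ) 0
    rw [rel_relSet, h]
    simp [pair_ne_zero]
  · intro s k t ℓ _ _
    obtain ⟨d, -, h, h3⟩ := hrec (pair s k) (pair t ℓ)
    have h4 := (h3 s t (add_lt_add (left_lt_pair _ _) (left_lt_pair _ _))).1
    have h5 := (h3 t s (by
      rw [add_comm t s]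
      exact add_lt_add (left_lt_pair _ _) (left_lt_pair _ _))).1
    have h6 := (h3 k ℓ (add_lt_add (right_lt_pair _ _) (right_lt_pair _ _))).2
    rw [SRel, rel_relSet, rel_relSet, rel_relSet, rel_relSet, h, ← h4, ← h5, ← h6]
    simp [pair_ne_zero]

theorem comp_inTwoUnion {A : Set M} (hA : A ∈ sets M) : Comp M fun x : M => InTwoUnion A x := by
  have hA' := Comp.mem hA
  have : Comp M fun c : M => c = label0 ∨ c = label1 ∨
      (right c ∈ A ∧ c = labelOf (right c)) := by fun_prop
  refine this.congr_iff fun c => or_congr_right (or_congr_right ⟨?_, ?_⟩)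
  · rintro ⟨α, hα, rfl⟩
    simpa [RevMath.labelOf] using hα
  · exact fun h => ⟨_, h⟩

theorem comp_leTwoUnion {A LA : Set M} (hA : A ∈ sets M) (hLA : LA ∈ sets M) :
    Comp M fun x : M × M => LeTwoUnion A LA x.1 x.2 := by
  have hA' := Comp.mem hA
  have cLA := Comp.rel hLA
  have cI := comp_inTwoUnion hA
  have : Comp M fun z : M × M => (z.1 = label0 ∧ InTwoUnion A z.2) ∨
      (z.1 = label1 ∧ (z.2 = label1 ∨ (right z.2 ∈ A ∧ z.2 = labelOf (right z.2)))) ∨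
      (right z.1 ∈ A ∧ right z.2 ∈ A ∧ z.1 = labelOf (right z.1) ∧
        z.2 = labelOf (right z.2) ∧ Rel LA (right z.1) (right z.2)) := by fun_prop
  refine this.congr_iff fun c => or_congr_right (or_congr (and_congr_right fun _ =>
    or_congr_right ⟨?_, fun h => ⟨_, h⟩⟩) ⟨?_, ?_⟩)
  · rintro ⟨α, hα, h⟩
    rw [h]
    simpa [RevMath.labelOf] using hα
  · rintro ⟨α, hα, β, hβ, h, h', hαβ⟩
    rw [h, h']
    simpa [RevMath.labelOf] using ⟨hα, hβ, hαβ⟩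
  · rintro ⟨h1, h2, h⟩
    exact ⟨_, h1, _, h2, h⟩

theorem lt_nodeC (k : M) : k < nodeC k := right_lt_pair _ _

/-- The quasi-order `T_f(Q)` exists. -/
theorem nonempty_leafTrees {inQ : M → Prop} {leQ : M → M → Prop} (hQ : Comp M inQ)
    (hleQ : Comp M fun x : M × M => leQ x.1 x.2) : Nonempty (LeafTrees inQ leQ) := by
  obtain ⟨T, L, cT, cL, hrec⟩ := exists_rec_rel (M := M)
    (Φ := fun c n _ => (n = leafC (right n) ∧ inQ (right n)) ∨
      (n = nodeC (right n) ∧ right n ≠ 0 ∧ sndBit c (right n) 0))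
    (Ψ := fun c n _ => n = 0 ∨ (n = pair (left n) (right n) ∧ fstBit c (left n) 0 ∧
      sndBit c (right n) 0))
    (by fun_prop) (by fun_prop)
  -- The entry relation comes first, so that the recursion for ≤_T can quantify over children by
  -- bounded quantifiers.
  obtain ⟨en, _, cen, _, hrecE⟩ := exists_rec_rel (M := M)
    (Φ := fun c σ ℓ => ℓ = pair (left ℓ) (right ℓ) ∧ (σ = left ℓ ∨ fstBit c σ (right ℓ)))
    (Ψ := fun _ _ _ => True) (by fun_prop) (by fun_prop)
  obtain ⟨le, _, cle, _, hrecL⟩ := exists_rec_rel (M := M)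
    (Φ := fun c a b =>
      (left a = 0 ∧ left b = 0 ∧ leQ (right a) (right b)) ∨
      (left a = 0 ∧ left b = 1 ∧ ∃ τ < b, en τ (right b) ∧ fstBit c a τ) ∨
      (left a = 1 ∧ left b = 1 ∧ ∀ σ < a, ¬ en σ (right a) ∨
        ∃ τ < b, en τ (right b) ∧ fstBit c σ τ))
    (Ψ := fun _ _ _ => True)
    (by
      refine .or (by fun_prop) (.or (.and (by fun_prop) (.and (by fun_prop)
        (.bex (by fun_prop) (by fun_prop)))) (.and (by fun_prop) (.and (by fun_prop)
        (.ball (by fun_prop) (.or (by fun_prop) (.bex (by fun_prop) (by fun_prop))))))))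
    (by fun_prop)
  have hcons (σ τ ℓ : M) : Rel (relSet en) σ (pair τ ℓ) ↔ σ = τ ∨ Rel (relSet en) σ ℓ := by
    obtain ⟨c, h, -, h3⟩ := hrecE σ (pair τ ℓ)
    have := (h3 σ ℓ (add_lt_add_right (right_lt_pair _ _) σ)).1
    rw [rel_relSet, rel_relSet, h, ← this]
    simp
  have hnil (σ : M) : ¬ Rel (relSet en) σ 0 := by
    obtain ⟨c, h, -, -⟩ := hrecE σ 0
    rw [rel_relSet, h]
    exact fun h => pair_ne_zero _ _ h.1.symm
  -- Entries are smaller than their list, so the bounded quantifiers of the recursion agree with the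
  -- unbounded ones in the required clauses.
  have hlt (σ ℓ : M) : Rel (relSet en) σ ℓ → σ < ℓ := by
    have cr := Comp.rel (relSet_mem cen)
    refine Comp.strong_induction (P := fun ℓ => Rel (relSet en) σ ℓ → σ < ℓ)
      (.imp (by fun_prop) (by fun_prop)) (fun ℓ ih h => ?_) ℓ
    have h' := h
    obtain ⟨c, h1, -⟩ := hrecE σ ℓ
    rw [rel_relSet, h1] at h'
    rw [h'.1, hcons] at h
    rcases h with h | h
    · rw [h'.1, h]
      exact left_lt_pair _ _
    · rw [h'.1]
      refine (ih _ ?_ h).trans (right_lt_pair _ _)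
      conv_rhs => rw [h'.1]
      exact right_lt_pair _ _
  refine ⟨⟨{n | T n 0}, relSet le, {n | L n 0}, relSet en, Comp.setOf_mem (by fun_prop),
    relSet_mem cle, Comp.setOf_mem (by fun_prop), relSet_mem cen, ?_, ?_, hnil,
    fun σ τ ℓ _ => hcons σ τ ℓ, ?_, ?_, ?_, ?_⟩⟩
  · intro n
    obtain ⟨c, h1, -, h3⟩ := hrec n 0
    rw [Set.mem_ofPred_eq, h1]
    refine or_congr ⟨?_, ?_⟩ ⟨?_, ?_⟩
    · exact fun h => ⟨_, h.2, h.1⟩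
    · rintro ⟨q, hq, rfl⟩
      simpa [leafC] using hq
    · rintro ⟨hn, h0, h⟩
      refine ⟨right n, ((h3 _ _ ?_).2).1 h, h0, hn⟩
      simp only [add_zero]
      conv_rhs => rw [hn]
      exact lt_nodeC _
    · rintro ⟨ℓ, hℓ, h0, rfl⟩
      refine ⟨by simp [nodeC], by simpa [nodeC] using h0, ?_⟩
      simp only [nodeC, right_pair] at h3 ⊢
      exact ((h3 _ _ (by simpa using right_lt_pair _ _)).2).2 hℓ
  · intro n
    obtain ⟨c, -, h1, h3⟩ := hrec n 0
    rw [Set.mem_ofPred_eq, h1]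
    refine or_congr_right ⟨?_, ?_⟩
    · rintro ⟨hn, ht, hl⟩
      refine ⟨_, _, hn, ((h3 _ _ ?_).1).1 ht, ((h3 _ _ ?_).2).1 hl⟩
      · simp only [add_zero]
        conv_rhs => rw [hn]
        exact left_lt_pair _ _
      · simp only [add_zero]
        conv_rhs => rw [hn]
        exact right_lt_pair _ _
    · rintro ⟨τ, ℓ, rfl, ht, hl⟩
      simp only [right_pair, left_pair, true_and]
      exact ⟨((h3 _ _ (by simpa using left_lt_pair _ _)).1).2 ht,
        ((h3 _ _ (by simpa using right_lt_pair _ _)).2).2 hl⟩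
  · intro x y _ _
    obtain ⟨c, h, -, -⟩ := hrecL (leafC x) (leafC y)
    rw [rel_relSet, h]
    simp [leafC]
  · intro x ℓ _ _
    obtain ⟨c, h, -, h3⟩ := hrecL (leafC x) (nodeC ℓ)
    have h4 : Rel (relSet le) (leafC x) (nodeC ℓ) ↔
        ∃ τ < nodeC ℓ, en τ ℓ ∧ fstBit c (leafC x) τ := by
      rw [rel_relSet, h]
      simp [leafC, nodeC]
    rw [h4]
    constructor
    · rintro ⟨τ, h5, h6, h7⟩
      exact ⟨τ, rel_relSet.2 h6, rel_relSet.2 (((h3 _ _ (add_lt_add_right h5 _)).1).1 h7)⟩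
    · rintro ⟨τ, h6, h7⟩
      have h5 := (hlt _ _ h6).trans (lt_nodeC ℓ)
      exact ⟨τ, h5, rel_relSet.1 h6, ((h3 _ _ (add_lt_add_right h5 _)).1).2 (rel_relSet.1 h7)⟩
  · intro k y _ _
    obtain ⟨c, h, -, -⟩ := hrecL (nodeC k) (leafC y)
    rw [rel_relSet, h]
    simp [leafC, nodeC]
  · intro k ℓ _ _
    obtain ⟨c, h, -, h3⟩ := hrecL (nodeC k) (nodeC ℓ)
    have h4 : Rel (relSet le) (nodeC k) (nodeC ℓ) ↔
        ∀ σ < nodeC k, ¬ en σ k ∨ ∃ τ < nodeC ℓ, en τ ℓ ∧ fstBit c σ τ := by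
      rw [rel_relSet, h]
      simp [nodeC]
    rw [h4]
    constructor
    · intro h' σ hσ
      have hσ' := (hlt _ _ hσ).trans (lt_nodeC k)
      obtain ⟨τ, h5, h6, h7⟩ := (h' σ hσ').resolve_left (not_not.2 (rel_relSet.1 hσ))
      exact ⟨τ, rel_relSet.2 h6, rel_relSet.2 (((h3 _ _ (add_lt_add hσ' h5)).1).1 h7)⟩
    · intro h' σ hσ'
      refine or_iff_not_imp_left.2 fun hσ => ?_
      obtain ⟨τ, h6, h7⟩ := h' σ (rel_relSet.2 (not_not.1 hσ))
      have h5 := (hlt _ _ h6).trans (lt_nodeC ℓ)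
      exact ⟨τ, h5, rel_relSet.1 h6, ((h3 _ _ (add_lt_add hσ' h5)).1).2 (rel_relSet.1 h7)⟩

end Notation

/-! ### The order of ε_Ω is total and transitive. -/

namespace EpsilonNotation

variable {M : Type u} [L2Structure M] [hM : Fact (ModelsRCA0 M)] {A LA : Set M}
  (E : EpsilonNotation A LA)

theorem comp_terms : Comp M fun n : M => n ∈ E.terms := Comp.mem E.terms_mem

theorem comp_lists : Comp M fun n : M => n ∈ E.lists := Comp.mem E.lists_mem

theorem comp_le : Comp M fun x : M × M => Rel E.le x.1 x.2 := Comp.rel E.le_mem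

theorem comp_lt : Comp M fun x : M × M => SRel E.le x.1 x.2 := Comp.srel E.le_mem

theorem comp_lex : Comp M fun x : M × M => Rel E.lex x.1 x.2 := Comp.rel E.lex_mem

theorem const_mem {c : M} (hc : IsConst A c) : c ∈ E.terms := (E.mem_terms_iff c).2 (Or.inl hc)

theorem omegaC_mem : omegaC ∈ E.terms := E.const_mem (Or.inr (Or.inl rfl))

theorem cons_mem {t ℓ : M} (h : pair t ℓ ∈ E.lists) : t ∈ E.terms ∧ ℓ ∈ E.lists ∧
    ∀ t' ℓ', ℓ = pair t' ℓ' → SRel E.le t' t := by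
  rcases (E.mem_lists_iff _).1 h with h | ⟨t', ℓ', h, h'⟩
  · exact absurd h (pair_ne_zero _ _)
  · obtain ⟨rfl, rfl⟩ := pair_injective h
    exact h'

theorem list_cases {n : M} (h : n ∈ E.lists) : n = 0 ∨ ∃ t ℓ, n = pair t ℓ := by
  rcases (E.mem_lists_iff _).1 h with h | ⟨t', ℓ', h, h'⟩
  · exact Or.inl h
  · exact Or.inr ⟨_, _, h⟩

theorem seq_list_mem {k : M} (h : seqC k ∈ E.terms) : k ∈ E.lists := by
  rcases (E.mem_terms_iff _).1 h with h | ⟨t', ℓ', h, h', -⟩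
  · exact absurd (by simp [seqC]) h.left_ne
  · rw [seqC_injective h]
    exact h'

theorem term_cases {n : M} (h : n ∈ E.terms) : IsConst A n ∨ ∃ t ℓ, n = seqC (pair t ℓ) := by
  rcases (E.mem_terms_iff _).1 h with h | ⟨t', ℓ', h, h'⟩
  · exact Or.inl h
  · exact Or.inr ⟨_, _, h⟩

theorem const_total (hlin : IsLinearOrder A LA) {a b : M} (ha : IsConst A a) (hb : IsConst A b) :
    Rel E.le a b ∨ Rel E.le b a := by
  rcases ha with rfl | rfl | ⟨α, hα, rfl⟩ <;> rcases hb with rfl | rfl | ⟨β, hβ, rfl⟩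
  · exact Or.inl E.zero_le_zero
  · exact Or.inl E.zero_lt_omega.1
  · exact Or.inl (E.zero_lt_eps β hβ).1
  · exact Or.inr E.zero_lt_omega.1
  · exact Or.inl E.omega_le_omega
  · exact Or.inl (E.omega_lt_eps β hβ).1
  · exact Or.inr (E.zero_lt_eps α hα).1
  · exact Or.inr (E.omega_lt_eps α hα).1
  · rw [E.eps_le_eps α hα β hβ, E.eps_le_eps β hβ α hα]
    exact hlin.total α hα β hβ

theorem const_trans (hlin : IsLinearOrder A LA) {a b c : M} (ha : IsConst A a) (hb : IsConst A b)
    (hc : IsConst A c) (hab : Rel E.le a b) (hbc : Rel E.le b c) : Rel E.le a c := by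
  rcases ha with rfl | rfl | ⟨α, hα, rfl⟩
  · rcases hc with rfl | rfl | ⟨γ, hγ, rfl⟩
    · exact E.zero_le_zero
    · exact E.zero_lt_omega.1
    · exact (E.zero_lt_eps γ hγ).1
  · rcases hc with rfl | rfl | ⟨γ, hγ, rfl⟩
    · rcases hb with rfl | rfl | ⟨β, hβ, rfl⟩
      · exact hab
      · exact hbc
      · exact absurd hbc (E.zero_lt_eps β hβ).2
    · exact E.omega_le_omega
    · exact (E.omega_lt_eps γ hγ).1
  · rcases hb with rfl | rfl | ⟨β, hβ, rfl⟩
    · exact absurd hab (E.zero_lt_eps α hα).2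
    · exact absurd hab (E.omega_lt_eps α hα).2
    · rcases hc with rfl | rfl | ⟨γ, hγ, rfl⟩
      · exact absurd hbc (E.zero_lt_eps β hβ).2
      · exact absurd hbc (E.omega_lt_eps β hβ).2
      · rw [E.eps_le_eps α hα β hβ] at hab
        rw [E.eps_le_eps β hβ γ hγ] at hbc
        rw [E.eps_le_eps α hα γ hγ]
        exact hlin.trans α hα β hβ γ hγ hab hbc

/-- Terms and lists need each other, so both claims go by one induction on the sum of the two codes;
each clause of the order passes to pairs with a smaller sum. -/
theorem le_total_aux (hlin : IsLinearOrder A LA) (x : M × M) :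
    (x.1 ∈ E.terms → x.2 ∈ E.terms → Rel E.le x.1 x.2 ∨ Rel E.le x.2 x.1) ∧
    (x.1 ∈ E.lists → x.2 ∈ E.lists → Rel E.lex x.1 x.2 ∨ Rel E.lex x.2 x.1) := by
  have c1 := E.comp_terms
  have c2 := E.comp_lists
  have c3 := E.comp_le
  have c4 := E.comp_lex
  refine Comp.measure_induction (M := M) (P := fun x : M × M =>
    (x.1 ∈ E.terms → x.2 ∈ E.terms → Rel E.le x.1 x.2 ∨ Rel E.le x.2 x.1) ∧
    (x.1 ∈ E.lists → x.2 ∈ E.lists → Rel E.lex x.1 x.2 ∨ Rel E.lex x.2 x.1))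
    (.and (.imp (by fun_prop) (.imp (by fun_prop) (by fun_prop)))
      (.imp (by fun_prop) (.imp (by fun_prop) (by fun_prop)))) (μ := fun x => x.1 + x.2)
    (by fun_prop) ?_ x
  rintro ⟨s, t⟩ ih
  replace ih (a b : M) := ih (a, b)
  dsimp only at ih ⊢
  constructor
  · intro hs ht
    rcases E.term_cases hs with cs | ⟨s', k, rfl⟩ <;> rcases E.term_cases ht with ct | ⟨t', ℓ, rfl⟩
    · exact E.const_total hlin cs ct
    · have hm := E.cons_mem (E.seq_list_mem ht)
      have hlt := (left_lt_pair t' ℓ).trans (lt_seqC _)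
      have := (ih s t' (add_lt_add_right hlt s)).1 hs hm.1
      rw [E.const_le_seq _ _ _ cs ht, E.seq_le_const _ _ _ cs ht, SRel]
      tauto
    · have hm := E.cons_mem (E.seq_list_mem hs)
      have hlt := (left_lt_pair s' k).trans (lt_seqC _)
      have := (ih s' t (add_lt_add_left hlt t)).1 hm.1 ht
      rw [E.const_le_seq _ _ _ ct hs, E.seq_le_const _ _ _ ct hs, SRel]
      tauto
    · rw [E.seq_le_seq _ _ hs ht, E.seq_le_seq _ _ ht hs]
      exact (ih _ _ (add_lt_add (lt_seqC _) (lt_seqC _))).2 (E.seq_list_mem hs) (E.seq_list_mem ht)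
  · intro hs ht
    rcases E.list_cases hs with rfl | ⟨s', k, rfl⟩
    · exact Or.inl (E.nil_lex _ ht)
    rcases E.list_cases ht with rfl | ⟨t', ℓ, rfl⟩
    · exact Or.inr (E.nil_lex _ hs)
    have hms := E.cons_mem hs
    have hmt := E.cons_mem ht
    have h1 := (ih s' t' (add_lt_add (left_lt_pair _ _) (left_lt_pair _ _))).1 hms.1 hmt.1
    have h2 := (ih k ℓ (add_lt_add (right_lt_pair _ _) (right_lt_pair _ _))).2 hms.2.1 hmt.2.1
    rw [E.cons_lex_cons _ _ _ _ hs ht, E.cons_lex_cons _ _ _ _ ht hs, SRel, SRel]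
    tauto

theorem le_total (hlin : IsLinearOrder A LA) {s t : M} (hs : s ∈ E.terms) (ht : t ∈ E.terms) :
    Rel E.le s t ∨ Rel E.le t s :=
  (E.le_total_aux hlin (s, t)).1 hs ht

/-- Strictness of a conclusion is proved by transitivity for a permuted triple. The sum of the three
codes is a symmetric measure, so the induction hypothesis covers every permutation of smaller
triples. -/
theorem le_trans_aux (hlin : IsLinearOrder A LA) (x : M × M × M) :
    (x.1 ∈ E.terms → x.2.1 ∈ E.terms → x.2.2 ∈ E.terms → Rel E.le x.1 x.2.1 →
      Rel E.le x.2.1 x.2.2 → Rel E.le x.1 x.2.2) ∧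
    (x.1 ∈ E.lists → x.2.1 ∈ E.lists → x.2.2 ∈ E.lists → Rel E.lex x.1 x.2.1 →
      Rel E.lex x.2.1 x.2.2 → Rel E.lex x.1 x.2.2) := by
  have c1 := E.comp_terms
  have c2 := E.comp_lists
  have c3 := E.comp_le
  have c4 := E.comp_lex
  refine Comp.measure_induction (M := M) (P := fun x : M × M × M =>
    (x.1 ∈ E.terms → x.2.1 ∈ E.terms → x.2.2 ∈ E.terms → Rel E.le x.1 x.2.1 →
      Rel E.le x.2.1 x.2.2 → Rel E.le x.1 x.2.2) ∧
    (x.1 ∈ E.lists → x.2.1 ∈ E.lists → x.2.2 ∈ E.lists → Rel E.lex x.1 x.2.1 →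
      Rel E.lex x.2.1 x.2.2 → Rel E.lex x.1 x.2.2))
    (.and (.imp (by fun_prop) (.imp (by fun_prop) (.imp (by fun_prop)
      (.imp (by fun_prop) (.imp (by fun_prop) (by fun_prop))))))
      (.imp (by fun_prop) (.imp (by fun_prop) (.imp (by fun_prop)
      (.imp (by fun_prop) (.imp (by fun_prop) (by fun_prop)))))))
    (μ := fun x => x.1 + x.2.1 + x.2.2) (by fun_prop) ?_ x
  rintro ⟨r, s, t⟩ ih
  replace ih (a b c : M) := ih (a, b, c)
  dsimp only at ih ⊢
  have key (p q : M) : p < seqC (pair p q) := (left_lt_pair p q).trans (lt_seqC _)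
  constructor
  · intro hr hs ht
    rcases E.term_cases hr with cr | ⟨a, k, rfl⟩ <;>
      rcases E.term_cases hs with cs | ⟨b, ℓ, rfl⟩ <;>
      rcases E.term_cases ht with ct | ⟨c, m, rfl⟩
    · exact E.const_trans hlin cr cs ct
    · have hm := (E.cons_mem (E.seq_list_mem ht)).1
      rw [E.const_le_seq _ _ _ cs ht, E.const_le_seq _ _ _ cr ht]
      have := key c m
      exact (ih r s c (by gcongr)).1 hr hs hm
    · have hm := (E.cons_mem (E.seq_list_mem hs)).1
      rw [E.const_le_seq _ _ _ cr hs, E.seq_le_const _ _ _ ct hs]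
      have := key b ℓ
      exact fun h h' => (ih r b t (by gcongr)).1 hr hm ht h h'.1
    · have hm := (E.cons_mem (E.seq_list_mem hs)).1
      have hm' := (E.cons_mem (E.seq_list_mem ht)).1
      rw [E.const_le_seq _ _ _ cr hs, E.seq_le_seq _ _ hs ht, E.const_le_seq _ _ _ cr ht,
        E.cons_lex_cons _ _ _ _ (E.seq_list_mem hs) (E.seq_list_mem ht), SRel]
      have := key b ℓ
      have := key c m
      have := (ih r b c (by gcongr)).1 hr hm hm'
      tauto
    · have hm := (E.cons_mem (E.seq_list_mem hr)).1
      rw [E.seq_le_const _ _ _ cs hr, E.seq_le_const _ _ _ ct hr, SRel, SRel]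
      have := key a k
      have h1 := (ih a s t (by gcongr)).1 hm hs ht
      have h2 := (ih s t a (by
        rw [add_comm (s + t) a, ← add_assoc]
        gcongr)).1 hs ht hm
      tauto
    · have hm := (E.cons_mem (E.seq_list_mem hr)).1
      have hm' := (E.cons_mem (E.seq_list_mem ht)).1
      rw [E.seq_le_const _ _ _ cs hr, E.const_le_seq _ _ _ cs ht, E.seq_le_seq _ _ hr ht,
        E.cons_lex_cons _ _ _ _ (E.seq_list_mem hr) (E.seq_list_mem ht), SRel, SRel]
      have := key a k
      have := key c m
      have h1 := (ih a s c (by gcongr)).1 hm hs hm'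
      have h2 := (ih s c a (by
        rw [add_comm (s + c) a, ← add_assoc]
        gcongr)).1 hs hm' hm
      tauto
    · have hm := (E.cons_mem (E.seq_list_mem hr)).1
      have hm' := (E.cons_mem (E.seq_list_mem hs)).1
      rw [E.seq_le_seq _ _ hr hs, E.seq_le_const _ _ _ ct hs, E.seq_le_const _ _ _ ct hr,
        E.cons_lex_cons _ _ _ _ (E.seq_list_mem hr) (E.seq_list_mem hs), SRel, SRel, SRel]
      have := key a k
      have := key b ℓ
      have h1 := (ih a b t (by gcongr)).1 hm hm' ht
      have h2 := (ih t a b (by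
        rw [add_comm t a, add_right_comm]
        gcongr)).1 ht hm hm'
      tauto
    · rw [E.seq_le_seq _ _ hr hs, E.seq_le_seq _ _ hs ht, E.seq_le_seq _ _ hr ht]
      exact (ih _ _ _ (add_lt_add (add_lt_add (lt_seqC _) (lt_seqC _)) (lt_seqC _))).2
        (E.seq_list_mem hr) (E.seq_list_mem hs) (E.seq_list_mem ht)
  · intro hr hs ht
    rcases E.list_cases hr with rfl | ⟨a, k, rfl⟩
    · exact fun _ _ => E.nil_lex _ ht
    rcases E.list_cases hs with rfl | ⟨b, ℓ, rfl⟩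
    · exact fun h => absurd h (E.cons_lex_nil _ _ hr)
    rcases E.list_cases ht with rfl | ⟨c, m, rfl⟩
    · exact fun _ h => absurd h (E.cons_lex_nil _ _ hs)
    have hmr := E.cons_mem hr
    have hms := E.cons_mem hs
    have hmt := E.cons_mem ht
    have := left_lt_pair a k
    have := left_lt_pair b ℓ
    have := left_lt_pair c m
    have h1 := (ih a b c (by gcongr)).1 hmr.1 hms.1 hmt.1
    have h2 := (ih b c a (by
      rw [add_comm (b + c) a, ← add_assoc]
      gcongr)).1 hms.1 hmt.1 hmr.1
    have h3 := (ih c a b (by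
      rw [add_assoc c a b, add_comm c]
      gcongr)).1 hmt.1 hmr.1 hms.1
    have h4 := (ih c b a (by
      rw [add_comm (c + b) a, add_comm c b, ← add_assoc]
      gcongr)).1 hmt.1 hms.1 hmr.1
    have h5 := (ih k ℓ m (add_lt_add (add_lt_add (right_lt_pair _ _) (right_lt_pair _ _))
      (right_lt_pair _ _))).2 hmr.2.1 hms.2.1 hmt.2.1
    rw [E.cons_lex_cons _ _ _ _ hr hs, E.cons_lex_cons _ _ _ _ hs ht,
      E.cons_lex_cons _ _ _ _ hr ht, SRel, SRel, SRel]
    rintro (⟨p, q⟩ | ⟨p, q, w⟩) (⟨p', q'⟩ | ⟨p', q', w'⟩)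
    · exact Or.inl ⟨h1 p p', fun h => q (h2 p' h)⟩
    · exact Or.inl ⟨h1 p p', fun h => q (h2 p' h)⟩
    · exact Or.inl ⟨h1 p p', fun h => q' (h3 h p)⟩
    · exact Or.inr ⟨h1 p p', h4 q' q, h5 w w'⟩

theorem le_trans (hlin : IsLinearOrder A LA) {r s t : M} (hr : r ∈ E.terms) (hs : s ∈ E.terms)
    (ht : t ∈ E.terms) (h : Rel E.le r s) (h' : Rel E.le s t) : Rel E.le r t :=
  (E.le_trans_aux hlin (r, s, t)).1 hr hs ht h h'

theorem lt_of_not_le (hlin : IsLinearOrder A LA) {s t : M} (hs : s ∈ E.terms) (ht : t ∈ E.terms)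
    (h : ¬ Rel E.le s t) : SRel E.le t s :=
  ⟨(E.le_total hlin hs ht).resolve_left h, h⟩

theorem lt_of_lt_of_le (hlin : IsLinearOrder A LA) {r s t : M} (hr : r ∈ E.terms)
    (hs : s ∈ E.terms) (ht : t ∈ E.terms) (h : SRel E.le r s) (h' : Rel E.le s t) :
    SRel E.le r t :=
  ⟨E.le_trans hlin hr hs ht h.1 h', fun h2 => h.2 (E.le_trans hlin hs ht hr h' h2)⟩

theorem zero_le {t : M} (ht : t ∈ E.terms) : Rel E.le zeroC t := by
  have c1 := E.comp_terms
  have c3 := E.comp_le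
  refine Comp.strong_induction (P := fun t => t ∈ E.terms → Rel E.le zeroC t)
    (.imp (by fun_prop) (by fun_prop)) (fun t ih ht => ?_) t ht
  rcases E.term_cases ht with ct | ⟨t', ℓ, rfl⟩
  · rcases ct with rfl | rfl | ⟨γ, hγ, rfl⟩
    · exact E.zero_le_zero
    · exact E.zero_lt_omega.1
    · exact (E.zero_lt_eps γ hγ).1
  · rw [E.const_le_seq _ _ _ (Or.inl rfl) ht]
    exact ih _ ((left_lt_pair t' ℓ).trans (lt_seqC _)) (E.cons_mem (E.seq_list_mem ht)).1

end EpsilonNotation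

/-! ### Powers of two, weights and heights of terms, and the building blocks of the trees. -/

section Functions

variable {M : Type u} [L2Structure M] [hM : Fact (ModelsRCA0 M)] {γ : Type v} [Coded M γ]

theorem eq_zero_or_succ (n : M) : n = 0 ∨ ∃ m, n = m + 1 := by
  rcases eq_or_ne n 0 with h | h
  · exact Or.inl h
  · obtain ⟨k, hk⟩ := lt_iff_exists_add_succ.1 (pos_iff_ne_zero.2 h)
    exact Or.inr ⟨k, by simpa using hk⟩

theorem exists_iterate {s : M → M} (hs : Comp M s) (x : M) :
    ∃ f : M → M, Comp M f ∧ f 0 = x ∧ ∀ n, f (n + 1) = s (f n) := by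
  obtain ⟨f, hf, h0, h1⟩ := exists_primrec (M := M) (γ := M) (g := fun _ => x)
    (s := fun y => s y.2.2) (by fun_prop) (by fun_prop)
  exact ⟨f 0, by fun_prop, h0 0, h1 0⟩

theorem exists_pow2 : ∃ f : M → M, Comp M f ∧ f 0 = 1 ∧ ∀ n, f (n + 1) = f n + f n :=
  exists_iterate (s := fun x => x + x) (by fun_prop) 1

/-- Powers of two. -/
noncomputable def pow2 : M → M := exists_pow2.choose

@[fun_prop]
theorem Comp.pow2 {f : γ → M} (hf : Comp M f) : Comp M fun a => pow2 (f a) :=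
  exists_pow2.choose_spec.1.comp hf

theorem pow2_zero : pow2 (0 : M) = 1 := exists_pow2.choose_spec.2.1

theorem pow2_succ (n : M) : pow2 (n + 1) = pow2 n + pow2 n := exists_pow2.choose_spec.2.2 n

theorem lt_pow2 (n : M) : n < pow2 n := by
  refine Comp.induction (P := fun n => n < pow2 n) (by fun_prop) ?_ (fun n ih => ?_) n
  · rw [pow2_zero]
    exact zero_lt_one
  · rw [pow2_succ]
    exact add_lt_add_of_lt_of_le ih (by simpa using add_one_le_iff'.2 ((zero_le' n).trans_lt ih))

theorem pow2_pos (n : M) : 0 < pow2 n := (zero_le' n).trans_lt (lt_pow2 n)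

theorem pow2_mono {m n : M} (h : m ≤ n) : pow2 m ≤ pow2 n := by
  obtain ⟨k, rfl⟩ := exists_add_of_le h
  refine Comp.induction (P := fun k => pow2 m ≤ pow2 (m + k)) (by fun_prop) (by simp)
    (fun k ih => ?_) k
  rw [← add_assoc, pow2_succ]
  exact ih.trans le_self_add

theorem exists_monus : ∃ f : M × M → M, Comp M f ∧ ∀ a b, f (a + b, b) = a := by
  obtain ⟨f, hf, h⟩ := Comp.exists_choice (M := M) (γ := M × M)
    (P := fun x y => x.2 ≤ x.1 → x.1 = y + x.2) (.imp (by fun_prop) (by fun_prop)) (fun x => by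
      by_cases hx : x.2 ≤ x.1
      · obtain ⟨y, hy⟩ := exists_add_of_le hx
        exact ⟨y, fun _ => by rw [hy, add_comm]⟩
      · exact ⟨0, fun h => absurd h hx⟩)
  exact ⟨f, hf, fun a b => (add_right_cancel (h (a + b, b) le_add_self)).symm⟩

/-- Subtraction, meaningful only where the result is not negative. -/
noncomputable def monus (a b : M) : M := exists_monus.choose (a, b)

@[fun_prop]
theorem Comp.monus {f g : γ → M} (hf : Comp M f) (hg : Comp M g) :
    Comp M fun a => monus (f a) (g a) :=
  exists_monus.choose_spec.1.comp (hf.prodMk hg)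

theorem add_monus (a b : M) : monus (a + b) b = a := exists_monus.choose_spec.2 a b

-- Weight and height are mutually recursive; the height is inlined to leave one recursion over codes
-- of lists. The exponent h + 3 is chosen because a bar below the child formed from an entry of
-- height h can gain three levels over one below the tree of the entry, two from the guard and one
-- from the child, and h + 3 < 2 ^ (h + 3).
open Classical in
theorem exists_weight : ∃ f : M → M, Comp M f ∧ f 0 = 0 ∧ ∀ t ℓ, f (pair t ℓ) =
    pow2 ((if t = seqC (right t) then f (right t) + 1 else 0) + 1 + 1 + 1) + f ℓ := by
  obtain ⟨f, t, hf, -, h1, h2⟩ := exists_course_rec (M := M) (γ := M)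
    (S := fun x => if x.2.1 = 0 then 0 else pow2 ((if left x.2.1 = seqC (right (left x.2.1)) then
      look x.2.2 (right (left x.2.1)) + 1 else 0) + 1 + 1 + 1) + look x.2.2 (right x.2.1))
    (by fun_prop)
  refine ⟨f 0, by fun_prop, by rw [h1]; simp, fun s ℓ => ?_⟩
  rw [h1]
  simp only [pair_ne_zero, if_false, left_pair, right_pair]
  rw [h2 _ _ _ (right_lt_pair _ _)]
  split_ifs with h
  · rw [h2]
    conv_rhs => rw [h]
    exact (lt_seqC _).trans (left_lt_pair _ _)
  · rfl

/-- The weight of a list of terms: the sum of `2 ^ (h + 3)` over the heights `h` of its entries. -/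
noncomputable def weight : M → M := exists_weight.choose

open Classical in
/-- The height of a term: an upper bound for the height of the tree assigned to it. -/
noncomputable def height (t : M) : M := if t = seqC (right t) then weight (right t) + 1 else 0

@[fun_prop]
theorem Comp.weight {f : γ → M} (hf : Comp M f) : Comp M fun a => weight (f a) :=
  exists_weight.choose_spec.1.comp hf

@[fun_prop]
theorem Comp.height {f : γ → M} (hf : Comp M f) : Comp M fun a => height (f a) := by
  unfold RevMath.height
  fun_prop

theorem weight_nil : weight (0 : M) = 0 := exists_weight.choose_spec.2.1

theorem weight_cons (t ℓ : M) : weight (pair t ℓ) = pow2 (height t + 1 + 1 + 1) + weight ℓ :=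
  exists_weight.choose_spec.2.2 t ℓ

theorem height_seq (k : M) : height (seqC k) = weight k + 1 := by
  simp [height, seqC]

theorem height_const {A : Set M} {c : M} (h : IsConst A c) : height c = 0 := by
  refine if_neg fun h' => h.left_ne ?_
  rw [h']
  simp [seqC]

theorem exists_bar : ∃ f : M → M, Comp M f ∧ f 0 = leafC label0 ∧
    ∀ n, f (n + 1) = nodeC (pair (f n) 0) :=
  exists_iterate (s := fun x => nodeC (pair x 0)) (by fun_prop) _

/-- The linear tree of the given height, with label `0`. -/
noncomputable def bar : M → M := exists_bar.choose

@[fun_prop]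
theorem Comp.bar {f : γ → M} (hf : Comp M f) : Comp M fun a => bar (f a) :=
  exists_bar.choose_spec.1.comp hf

theorem bar_zero : bar (0 : M) = leafC label0 := exists_bar.choose_spec.2.1

theorem bar_succ (n : M) : bar (n + 1) = nodeC (pair (bar n) 0) := exists_bar.choose_spec.2.2 n

/-- The tree with two immediate subtrees. -/
def node2 (x y : M) : M := nodeC (pair x (pair y 0))

/-- The tree `{1, {x}}`. -/
def guard (x : M) : M := node2 (leafC label1) (nodeC (pair x 0))

@[fun_prop]
theorem Comp.node2 {f g : γ → M} (hf : Comp M f) (hg : Comp M g) :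
    Comp M fun a => node2 (f a) (g a) := by
  unfold RevMath.node2
  fun_prop

@[fun_prop]
theorem Comp.guard {f : γ → M} (hf : Comp M f) : Comp M fun a => guard (f a) := by
  unfold RevMath.guard
  fun_prop

end Functions

/-! ### The tree of a term, and monotonicity of heights below ω. -/

namespace EpsilonNotation

variable {M : Type u} [L2Structure M] [hM : Fact (ModelsRCA0 M)] {A LA : Set M}
  (E : EpsilonNotation A LA)

/-- Here w is the weight of the whole list, and subtracting the weight of the current suffix leaves
the weight of the preceding entries. The function g is kept abstract: it is first a lookup in the
table of values already computed, later the finished tree function. -/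
theorem exists_children {g : M → M → M} (hg : Comp M fun x : M × M => g x.1 x.2) :
    ∃ G : M → M → M → M, (Comp M fun x : M × M × M => G x.1 x.2.1 x.2.2) ∧
      (∀ c w, G c w 0 = 0) ∧ ∀ c w t ℓ, G c w (pair t ℓ) =
        pair (node2 (guard (g c t)) (bar (monus w (weight (pair t ℓ))))) (G c w ℓ) := by
  classical
  obtain ⟨f, t, hf, -, h1, h2⟩ := exists_course_rec (M := M) (γ := M × M)
    (S := fun x => if x.2.1 = 0 then 0 else
      pair (node2 (guard (g x.1.1 (left x.2.1))) (bar (monus x.1.2 (weight x.2.1))))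
        (look x.2.2 (right x.2.1))) (by fun_prop)
  refine ⟨fun c w ℓ => f (c, w) ℓ, by fun_prop, fun c w => ?_, fun c w s ℓ => ?_⟩
  · dsimp only
    rw [h1]
    simp
  · dsimp only
    rw [h1]
    simp only [pair_ne_zero, if_false, left_pair, right_pair]
    rw [h2 _ _ _ (right_lt_pair _ _)]

theorem exists_tree : ∃ (tr : M → M) (G : M → M → M), Comp M tr ∧
    (Comp M fun x : M × M => G x.1 x.2) ∧ tr zeroC = leafC label0 ∧ tr omegaC = leafC label1 ∧
    (∀ α, tr (epsC α) = leafC (labelOf α)) ∧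
    (∀ k, SRel E.le (seqC k) omegaC → tr (seqC k) = bar (weight k + 1)) ∧
    (∀ k ∈ E.lists, ¬ SRel E.le (seqC k) omegaC → tr (seqC k) = nodeC (G (weight k) k)) ∧
    (∀ w, G w 0 = 0) ∧ ∀ w t ℓ, G w (pair t ℓ) =
        pair (node2 (guard (tr t)) (bar (monus w (weight (pair t ℓ))))) (G w ℓ) := by
  classical
  have cl := E.comp_lt
  obtain ⟨Gc, cGc, hGc0, hGc⟩ := exists_children (M := M) (g := look) (by fun_prop)
  obtain ⟨f, t, hf, ht, h1, h2⟩ := exists_course_rec (M := M) (γ := M)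
    (S := fun x => if x.2.1 = zeroC then leafC label0 else if x.2.1 = omegaC then leafC label1 else
      if x.2.1 = epsC (right x.2.1) then leafC (labelOf (right x.2.1)) else
      if SRel E.le x.2.1 omegaC then bar (weight (right x.2.1) + 1) else
      nodeC (Gc x.2.2 (weight (right x.2.1)) (right x.2.1))) (by fun_prop)
  have cf : Comp M (f 0) := by fun_prop
  obtain ⟨G, cG, hG0, hG⟩ := exists_children (M := M) (g := fun _ => f 0) (by fun_prop)
  have hs (k : M) : seqC k ≠ zeroC ∧ seqC k ≠ omegaC ∧ seqC k ≠ epsC (right (seqC k)) := by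
    refine ⟨fun h => ?_, fun h => ?_, fun h => ?_⟩
    · exact zero_ne_two (pair_injective h).1.symm
    · exact zero_ne_two (pair_injective h).1.symm
    · exact one_ne_two (pair_injective h).1.symm
  -- The table available at the code of a sequence already contains the trees of all its entries, so
  -- the children built from the table are the intended ones.
  have hGG (k w ℓ : M) : ℓ ∈ E.lists → ℓ < seqC k → Gc (t 0 (seqC k)) w ℓ = G 0 w ℓ := by
    have cL := E.comp_lists
    refine Comp.strong_induction (P := fun ℓ => ℓ ∈ E.lists → ℓ < seqC k →
      Gc (t 0 (seqC k)) w ℓ = G 0 w ℓ) (.imp (by fun_prop) (.imp (by fun_prop) (.eq ?_ ?_)))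
      (fun ℓ ih hℓ hlt => ?_) ℓ
    · exact cGc.comp (f := fun ℓ => (t 0 (seqC k), w, ℓ)) (by fun_prop)
    · exact cG.comp (f := fun ℓ => (0, w, ℓ)) (by fun_prop)
    rcases E.list_cases hℓ with rfl | ⟨s, m, rfl⟩
    · rw [hGc0, hG0]
    · rw [hGc, hG, h2 _ _ _ ((left_lt_pair _ _).trans hlt),
        ih m (right_lt_pair _ _) (E.cons_mem hℓ).2.1 ((right_lt_pair _ _).trans hlt)]
  refine ⟨f 0, G 0, cf, cG.comp (f := fun x : M × M => (0, x.1, x.2)) (by fun_prop), ?_, ?_,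
    fun α => ?_, fun k hk => ?_, fun k hkl hk => ?_, hG0 0, hG 0⟩
  · rw [h1]
    exact if_pos rfl
  · rw [h1]
    exact (if_neg zeroC_ne_omegaC.symm).trans (if_pos rfl)
  · rw [h1]
    refine (if_neg (zeroC_ne_epsC α).symm).trans ((if_neg (omegaC_ne_epsC α).symm).trans ?_)
    simp [epsC]
  · rw [h1]
    refine (if_neg (hs k).1).trans ((if_neg (hs k).2.1).trans ((if_neg (hs k).2.2).trans
      ((if_pos hk).trans ?_)))
    simp [seqC]
  · rw [h1]
    refine (if_neg (hs k).1).trans ((if_neg (hs k).2.1).trans ((if_neg (hs k).2.2).trans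
      ((if_neg hk).trans ?_)))
    have : right (seqC k) = k := right_pair _ _
    simp only [this]
    rw [hGG _ _ _ hkl (lt_seqC k)]

/-- The tree assigned to a term. -/
noncomputable def tree : M → M := E.exists_tree.choose

/-- The list of the immediate subtrees of the tree assigned to an infinite term. -/
noncomputable def children : M → M → M := E.exists_tree.choose_spec.choose

theorem comp_tree : Comp M E.tree := E.exists_tree.choose_spec.choose_spec.1

theorem comp_children : Comp M fun x : M × M => E.children x.1 x.2 :=
  E.exists_tree.choose_spec.choose_spec.2.1

theorem tree_zeroC : E.tree zeroC = leafC label0 := E.exists_tree.choose_spec.choose_spec.2.2.1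

theorem tree_omegaC : E.tree omegaC = leafC label1 := E.exists_tree.choose_spec.choose_spec.2.2.2.1

theorem tree_epsC (α : M) : E.tree (epsC α) = leafC (labelOf α) :=
  E.exists_tree.choose_spec.choose_spec.2.2.2.2.1 α

theorem tree_seq_of_lt {k : M} (h : SRel E.le (seqC k) omegaC) :
    E.tree (seqC k) = bar (weight k + 1) :=
  E.exists_tree.choose_spec.choose_spec.2.2.2.2.2.1 k h

theorem tree_seq_of_not_lt {k : M} (hk : k ∈ E.lists) (h : ¬ SRel E.le (seqC k) omegaC) :
    E.tree (seqC k) = nodeC (E.children (weight k) k) :=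
  E.exists_tree.choose_spec.choose_spec.2.2.2.2.2.2.1 k hk h

theorem children_nil (w : M) : E.children w 0 = 0 :=
  E.exists_tree.choose_spec.choose_spec.2.2.2.2.2.2.2.1 w

/-- Writing the total as n + weight replaces the subtraction by an offset n, the weight of what
precedes; passing to the tail increases it by the summand of the head. -/
theorem children_cons (n t ℓ : M) : E.children (n + weight (pair t ℓ)) (pair t ℓ) =
    pair (node2 (guard (E.tree t)) (bar n))
      (E.children (n + pow2 (height t + 1 + 1 + 1) + weight ℓ) ℓ) := by
  refine (E.exists_tree.choose_spec.choose_spec.2.2.2.2.2.2.2.2 _ t ℓ).trans ?_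
  rw [add_monus, weight_cons, add_assoc n]
  rfl

/-- Distinct elements of Ω may be equivalent, so equivalent terms need not coincide. Heights depend
only on the shape of a term, with all constants at height 0, and equivalent terms have the same
shape. -/
theorem height_eq_aux (x : M × M) :
    (x.1 ∈ E.terms → x.2 ∈ E.terms → Rel E.le x.1 x.2 → Rel E.le x.2 x.1 →
      height x.1 = height x.2) ∧
    (x.1 ∈ E.lists → x.2 ∈ E.lists → Rel E.lex x.1 x.2 → Rel E.lex x.2 x.1 →
      weight x.1 = weight x.2) := by
  have c1 := E.comp_terms
  have c2 := E.comp_lists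
  have c3 := E.comp_le
  have c4 := E.comp_lex
  refine Comp.measure_induction (M := M) (P := fun x : M × M =>
    (x.1 ∈ E.terms → x.2 ∈ E.terms → Rel E.le x.1 x.2 → Rel E.le x.2 x.1 →
      height x.1 = height x.2) ∧
    (x.1 ∈ E.lists → x.2 ∈ E.lists → Rel E.lex x.1 x.2 → Rel E.lex x.2 x.1 →
      weight x.1 = weight x.2))
    (.and (.imp (by fun_prop) (.imp (by fun_prop) (.imp (by fun_prop)
        (.imp (by fun_prop) (by fun_prop)))))
      (.imp (by fun_prop) (.imp (by fun_prop) (.imp (by fun_prop)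
        (.imp (by fun_prop) (by fun_prop)))))) (μ := fun x => x.1 + x.2) (by fun_prop) ?_ x
  rintro ⟨s, t⟩ ih
  replace ih (a b : M) := ih (a, b)
  dsimp only at ih ⊢
  constructor
  · intro hs ht
    rcases E.term_cases hs with cs | ⟨s', k, rfl⟩ <;> rcases E.term_cases ht with ct | ⟨t', ℓ, rfl⟩
    · rw [height_const cs, height_const ct]
      exact fun _ _ => rfl
    · rw [E.const_le_seq _ _ _ cs ht, E.seq_le_const _ _ _ cs ht]
      exact fun h h' => absurd h h'.2
    · rw [E.const_le_seq _ _ _ ct hs, E.seq_le_const _ _ _ ct hs]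
      exact fun h h' => absurd h' h.2
    · rw [E.seq_le_seq _ _ hs ht, E.seq_le_seq _ _ ht hs, height_seq, height_seq]
      intro h h'
      rw [(ih _ _ (add_lt_add (lt_seqC _) (lt_seqC _))).2 (E.seq_list_mem hs)
        (E.seq_list_mem ht) h h']
  · intro hs ht
    rcases E.list_cases hs with rfl | ⟨s', k, rfl⟩ <;>
      rcases E.list_cases ht with rfl | ⟨t', ℓ, rfl⟩
    · exact fun _ _ => rfl
    · exact fun _ h => absurd h (E.cons_lex_nil _ _ ht)
    · exact fun h => absurd h (E.cons_lex_nil _ _ hs)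
    have hms := E.cons_mem hs
    have hmt := E.cons_mem ht
    have h1 := (ih s' t' (add_lt_add (left_lt_pair _ _) (left_lt_pair _ _))).1 hms.1 hmt.1
    have h2 := (ih k ℓ (add_lt_add (right_lt_pair _ _) (right_lt_pair _ _))).2 hms.2.1 hmt.2.1
    rw [E.cons_lex_cons _ _ _ _ hs ht, E.cons_lex_cons _ _ _ _ ht hs, weight_cons, weight_cons]
    rintro (h | ⟨h3, h4, h5⟩) (h' | ⟨h3', h4', h5'⟩)
    · exact absurd h.1 h'.2
    · exact absurd h3' h.2
    · exact absurd h3 h'.2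
    · rw [h1 h3 h4, h2 h5 h5']

theorem height_eq {s t : M} (hs : s ∈ E.terms) (ht : t ∈ E.terms)
    (h : Rel E.le s t) (h' : Rel E.le t s) : height s = height t :=
  (E.height_eq_aux (s, t)).1 hs ht h h'

theorem const_eq_zeroC {c : M} (hc : IsConst A c) (h : SRel E.le c omegaC) : c = zeroC := by
  rcases hc with rfl | rfl | ⟨α, hα, rfl⟩
  · rfl
  · exact absurd h.1 h.2
  · exact absurd (E.omega_lt_eps α hα).1 h.2

theorem seq_lt_omega {t ℓ : M} (h : seqC (pair t ℓ) ∈ E.terms) :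
    SRel E.le (seqC (pair t ℓ)) omegaC ↔ SRel E.le t omegaC := by
  have hc : IsConst A omegaC := Or.inr (Or.inl rfl)
  rw [SRel, E.seq_le_const _ _ _ hc h, E.const_le_seq _ _ _ hc h]
  exact ⟨fun h => h.1, fun h => ⟨h, h.2⟩⟩

/-- Below ω, a descending list has strictly decreasing heights, so its weight is a sum of distinct
powers of two and stays below twice its first summand. The weight therefore compares lists
lexicographically, as binary numerals do. The three claims feed one another and are proved together.
-/
theorem height_lt_aux (hlin : IsLinearOrder A LA) (x : M × M) :
    (x.1 ∈ E.terms → x.2 ∈ E.terms → SRel E.le x.1 omegaC → SRel E.le x.2 x.1 →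
      height x.2 < height x.1) ∧
    (x.1 ∈ E.lists → x.2 ∈ E.lists → SRel E.le (left x.1) omegaC →
      Rel E.lex x.2 x.1 → ¬ Rel E.lex x.1 x.2 → weight x.2 < weight x.1) ∧
    (x.1 ∈ E.lists → x.1 ≠ 0 → SRel E.le (left x.1) omegaC →
      weight x.1 < pow2 (height (left x.1) + 1 + 1 + 1 + 1)) := by
  have c1 := E.comp_terms
  have c2 := E.comp_lists
  have c3 := E.comp_lt
  have c4 := E.comp_lex
  refine Comp.measure_induction (M := M) (P := fun x : M × M =>
    (x.1 ∈ E.terms → x.2 ∈ E.terms → SRel E.le x.1 omegaC → SRel E.le x.2 x.1 →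
      height x.2 < height x.1) ∧
    (x.1 ∈ E.lists → x.2 ∈ E.lists → SRel E.le (left x.1) omegaC →
      Rel E.lex x.2 x.1 → ¬ Rel E.lex x.1 x.2 → weight x.2 < weight x.1) ∧
    (x.1 ∈ E.lists → x.1 ≠ 0 → SRel E.le (left x.1) omegaC →
      weight x.1 < pow2 (height (left x.1) + 1 + 1 + 1 + 1)))
    (.and (.imp (by fun_prop) (.imp (by fun_prop) (.imp (by fun_prop)
        (.imp (by fun_prop) (by fun_prop))))) (.and
      (.imp (by fun_prop) (.imp (by fun_prop) (.imp (by fun_prop)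
        (.imp (by fun_prop) (.imp (by fun_prop) (by fun_prop))))))
      (.imp (by fun_prop) (.imp (by fun_prop) (.imp (by fun_prop) (by fun_prop))))))
    (μ := fun x => x.1 + x.2) (by fun_prop) ?_ x
  rintro ⟨s, t⟩ ih
  replace ih (a b : M) := ih (a, b)
  dsimp only at ih ⊢
  refine ⟨?_, ?_, ?_⟩
  · intro hs ht hω hts
    rcases E.term_cases hs with cs | ⟨s', k, rfl⟩
    · rw [E.const_eq_zeroC cs hω] at hts
      exact absurd (E.zero_le ht) hts.2
    rcases E.term_cases ht with ct | ⟨t', ℓ, rfl⟩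
    · rw [height_const ct, height_seq]
      exact lt_add_one_iff'.2 (zero_le' _)
    · rw [SRel, E.seq_le_seq _ _ hs ht, E.seq_le_seq _ _ ht hs] at hts
      rw [height_seq, height_seq]
      have := (ih _ _ (add_lt_add (lt_seqC _) (lt_seqC _))).2.1 (E.seq_list_mem hs)
        (E.seq_list_mem ht) (by simpa using (E.seq_lt_omega hs).1 hω) hts.1 hts.2
      gcongr
  · intro hs ht hω h h'
    rcases E.list_cases hs with rfl | ⟨s', k, rfl⟩
    · exact absurd (E.nil_lex _ ht) h'
    rw [left_pair] at hω
    rcases E.list_cases ht with rfl | ⟨t', ℓ, rfl⟩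
    · rw [weight_nil, weight_cons]
      exact (pow2_pos _).trans_le le_self_add
    have hms := E.cons_mem hs
    have hmt := E.cons_mem ht
    rw [E.cons_lex_cons _ _ _ _ ht hs] at h
    rw [E.cons_lex_cons _ _ _ _ hs ht] at h'
    rcases h with h | ⟨h1, h2, h3⟩
    -- A smaller head has smaller height, so doubling its summand, which bounds the weight of the
    -- whole lesser list, still does not exceed the first summand of the greater list. The third
    -- claim ignores the second component of the pair, set to 0 here.
    · have hlt := (ih s' t' (add_lt_add (left_lt_pair _ _) (left_lt_pair _ _))).1 hms.1 hmt.1 hω h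
      have h1 := (ih (pair t' ℓ) 0 (by
        rw [add_zero]
        exact lt_add_of_pos_left _ (pos_iff_ne_zero.2 (pair_ne_zero _ _)))).2.2 ht
        (pair_ne_zero _ _) (by
          rw [left_pair]
          exact E.lt_of_lt_of_le hlin hmt.1 hms.1 E.omegaC_mem h hω.1)
      rw [left_pair] at h1
      refine h1.trans_le ((pow2_mono ?_).trans ((weight_cons s' k).symm ▸ le_self_add))
      have := add_one_le_iff'.2 hlt
      gcongr
    · have h4 : ¬ Rel E.lex k ℓ := fun h => h' (Or.inr ⟨h2, h1, h⟩)
      have hk : k ≠ 0 := by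
        rintro rfl
        exact h4 (E.nil_lex _ hmt.2.1)
      obtain ⟨a, b, rfl⟩ := (E.list_cases hms.2.1).resolve_left hk
      have h5 := (ih _ ℓ (add_lt_add (right_lt_pair _ _) (right_lt_pair _ _))).2.1 hms.2.1 hmt.2.1
        (by
          rw [left_pair]
          exact E.lt_of_lt_of_le hlin (E.cons_mem hms.2.1).1 hms.1 E.omegaC_mem
            (hms.2.2 a b rfl) hω.1) h3 h4
      rw [weight_cons t', weight_cons s', E.height_eq hms.1 hmt.1 h2 h1]
      gcongr
  · intro hs h0 hω
    obtain ⟨a, k, rfl⟩ := (E.list_cases hs).resolve_left h0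
    rw [left_pair] at hω ⊢
    have hm := E.cons_mem hs
    rw [weight_cons, pow2_succ (height a + 1 + 1 + 1)]
    refine add_lt_add_right ?_ _
    rcases E.list_cases hm.2.1 with rfl | ⟨b, l, rfl⟩
    · rw [weight_nil]
      exact pow2_pos _
    · have hm' := E.cons_mem hm.2.1
      have hba := hm.2.2 _ _ rfl
      have h1 := (ih a b (((add_lt_add_right (left_lt_pair b l) a).trans
        (add_lt_pair _ _)).trans_le le_self_add)).1 hm.1 hm'.1 hω hba
      have h2 := (ih (pair b l) 0 (by
        rw [add_zero]
        exact (right_lt_pair _ _).trans_le le_self_add)).2.2 hm.2.1 (pair_ne_zero _ _) (by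
          rw [left_pair]
          exact E.lt_of_lt_of_le hlin hm'.1 hm.1 E.omegaC_mem hba hω.1)
      rw [left_pair] at h2
      refine h2.trans_le (pow2_mono ?_)
      have := add_one_le_iff'.2 h1
      gcongr

theorem height_lt (hlin : IsLinearOrder A LA) {s t : M} (hs : s ∈ E.terms) (ht : t ∈ E.terms)
    (h : SRel E.le s omegaC) (h' : SRel E.le t s) : height t < height s :=
  (E.height_lt_aux hlin (s, t)).1 hs ht h h'

end EpsilonNotation

/-! ### Comparing small trees and bars in T_f(Q). -/

namespace LeafTrees

variable {M : Type u} [L2Structure M] [hM : Fact (ModelsRCA0 M)] {inQ : M → Prop}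
  {leQ : M → M → Prop} (T : LeafTrees inQ leQ)

theorem leaf_mem {q : M} (hq : inQ q) : leafC q ∈ T.trees :=
  (T.mem_trees_iff _).2 (Or.inl ⟨q, hq, rfl⟩)

theorem nil_mem : 0 ∈ T.lists := (T.mem_lists_iff _).2 (Or.inl rfl)

theorem cons_mem {τ ℓ : M} (hτ : τ ∈ T.trees) (hℓ : ℓ ∈ T.lists) : pair τ ℓ ∈ T.lists :=
  (T.mem_lists_iff _).2 (Or.inr ⟨τ, ℓ, rfl, hτ, hℓ⟩)

theorem node_mem {τ ℓ : M} (hτ : τ ∈ T.trees) (hℓ : ℓ ∈ T.lists) : nodeC (pair τ ℓ) ∈ T.trees :=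
  (T.mem_trees_iff _).2 (Or.inr ⟨_, T.cons_mem hτ hℓ, pair_ne_zero _ _, rfl⟩)

theorem node2_mem {σ τ : M} (hσ : σ ∈ T.trees) (hτ : τ ∈ T.trees) : node2 σ τ ∈ T.trees :=
  T.node_mem hσ (T.cons_mem hτ T.nil_mem)

theorem entry_single {σ τ : M} (hτ : τ ∈ T.trees) : Rel T.entry σ (pair τ 0) ↔ σ = τ := by
  rw [T.entry_cons _ _ _ (T.cons_mem hτ T.nil_mem)]
  simp [T.not_entry_nil]

theorem entry_double {σ τ ρ : M} (hτ : τ ∈ T.trees) (hρ : ρ ∈ T.trees) :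
    Rel T.entry σ (pair τ (pair ρ 0)) ↔ σ = τ ∨ σ = ρ := by
  rw [T.entry_cons _ _ _ (T.cons_mem hτ (T.cons_mem hρ T.nil_mem)), T.entry_single hρ]

theorem leaf_le_single {q x : M} (hq : inQ q) (hx : x ∈ T.trees) :
    Rel T.le (leafC q) (nodeC (pair x 0)) ↔ Rel T.le (leafC q) x := by
  rw [T.leaf_le_node _ _ hq (T.node_mem hx T.nil_mem)]
  simp [T.entry_single hx]

theorem leaf_le_node2 {q x y : M} (hq : inQ q) (hx : x ∈ T.trees) (hy : y ∈ T.trees) :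
    Rel T.le (leafC q) (node2 x y) ↔ Rel T.le (leafC q) x ∨ Rel T.le (leafC q) y := by
  rw [node2, T.leaf_le_node _ _ hq (T.node2_mem hx hy)]
  simp [T.entry_double hx hy]

theorem single_le_single {x y : M} (hx : x ∈ T.trees) (hy : y ∈ T.trees) :
    Rel T.le (nodeC (pair x 0)) (nodeC (pair y 0)) ↔ Rel T.le x y := by
  rw [T.node_le_node _ _ (T.node_mem hx T.nil_mem) (T.node_mem hy T.nil_mem)]
  simp [T.entry_single hx, T.entry_single hy]

theorem single_le_node2 {x y z : M} (hx : x ∈ T.trees) (hy : y ∈ T.trees) (hz : z ∈ T.trees) :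
    Rel T.le (nodeC (pair x 0)) (node2 y z) ↔ Rel T.le x y ∨ Rel T.le x z := by
  rw [node2, T.node_le_node _ _ (T.node_mem hx T.nil_mem) (T.node2_mem hy hz)]
  simp [T.entry_single hx, T.entry_double hy hz]

theorem node2_le_single {x y z : M} (hx : x ∈ T.trees) (hy : y ∈ T.trees) (hz : z ∈ T.trees) :
    Rel T.le (node2 x y) (nodeC (pair z 0)) ↔ Rel T.le x z ∧ Rel T.le y z := by
  rw [node2, T.node_le_node _ _ (T.node2_mem hx hy) (T.node_mem hz T.nil_mem)]
  simp [T.entry_double hx hy, T.entry_single hz]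

theorem node2_le_node2 {x y z w : M} (hx : x ∈ T.trees) (hy : y ∈ T.trees) (hz : z ∈ T.trees)
    (hw : w ∈ T.trees) : Rel T.le (node2 x y) (node2 z w) ↔
      (Rel T.le x z ∨ Rel T.le x w) ∧ (Rel T.le y z ∨ Rel T.le y w) := by
  rw [node2, node2, T.node_le_node _ _ (T.node2_mem hx hy) (T.node2_mem hz hw)]
  simp [T.entry_double hx hy, T.entry_double hz hw]

theorem entry_lt {σ ℓ : M} (hℓ : ℓ ∈ T.lists) : Rel T.entry σ ℓ → σ < ℓ := by
  have c1 := Comp.mem T.lists_mem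
  have c2 := Comp.rel T.entry_mem
  refine Comp.strong_induction (P := fun ℓ => ℓ ∈ T.lists → Rel T.entry σ ℓ → σ < ℓ)
    (.imp (by fun_prop) (.imp (by fun_prop) (by fun_prop))) (fun ℓ ih hℓ h => ?_) ℓ hℓ
  rcases (T.mem_lists_iff _).1 hℓ with rfl | ⟨τ, k, rfl, hτ, hk⟩
  · exact absurd h (T.not_entry_nil _)
  · rcases (T.entry_cons _ _ _ hℓ).1 h with rfl | h
    · exact left_lt_pair _ _
    · exact (ih k (right_lt_pair _ _) hk h).trans (right_lt_pair _ _)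

theorem bar_mem (h0 : inQ label0) (n : M) : bar n ∈ T.trees := by
  have c1 := Comp.mem T.trees_mem
  refine Comp.induction (P := fun n => bar n ∈ T.trees) (by fun_prop) ?_ (fun n ih => ?_) n
  · rw [bar_zero]
    exact T.leaf_mem h0
  · rw [bar_succ]
    exact T.node_mem ih T.nil_mem

theorem leaf_le_bar (h0 : inQ label0) {q : M} (hq : inQ q) (n : M) :
    Rel T.le (leafC q) (bar n) → leQ q label0 := by
  have c := Comp.rel T.le_mem
  rw [← T.leaf_le_leaf _ _ hq h0]
  refine Comp.induction (P := fun n => Rel T.le (leafC q) (bar n) →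
    Rel T.le (leafC q) (leafC label0)) (.imp (by fun_prop) (by fun_prop)) ?_ (fun n ih h => ?_) n
  · rw [bar_zero]
    exact id
  · rw [bar_succ, T.leaf_le_single hq (T.bar_mem h0 n)] at h
    exact ih h

theorem bar_le_bar (h0 : inQ label0) (m n : M) : Rel T.le (bar m) (bar n) → m ≤ n := by
  have c := Comp.rel T.le_mem
  refine Comp.pi_induction (P := fun m n => Rel T.le (bar m) (bar n) → m ≤ n)
    (.imp (by fun_prop) (by fun_prop)) (fun n _ => zero_le' n) (fun m ih n h => ?_) m n
  rcases eq_zero_or_succ n with rfl | ⟨n, rfl⟩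
  · rw [bar_succ, bar_zero] at h
    exact absurd h (T.not_node_le_leaf _ _ (T.node_mem (T.bar_mem h0 m) T.nil_mem) h0)
  · rw [bar_succ, bar_succ, T.single_le_single (T.bar_mem h0 m) (T.bar_mem h0 n)] at h
    have := ih n h
    gcongr

end LeafTrees

/-! ### The order of the labels 2 ∪ Ω. -/

section Labels

variable {M : Type u} [L2Structure M] [hM : Fact (ModelsRCA0 M)] {A LA : Set M}

theorem inTwoUnion_label0 : InTwoUnion A (label0 : M) := Or.inl rfl

theorem inTwoUnion_label1 : InTwoUnion A (label1 : M) := Or.inr (Or.inl rfl)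

theorem inTwoUnion_labelOf {α : M} (h : α ∈ A) : InTwoUnion A (labelOf α) :=
  Or.inr (Or.inr ⟨α, h, rfl⟩)

theorem not_label1_le_label0 : ¬ LeTwoUnion A LA label1 (label0 : M) := by
  simp [LeTwoUnion, label1, label0, labelOf, pair_inj]

theorem not_labelOf_le_label0 (α : M) : ¬ LeTwoUnion A LA (labelOf α) (label0 : M) := by
  simp [LeTwoUnion, label1, label0, labelOf, pair_inj]

theorem not_labelOf_le_label1 (α : M) : ¬ LeTwoUnion A LA (labelOf α) (label1 : M) := by
  simp [LeTwoUnion, label1, label0, labelOf, pair_inj]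

theorem rel_of_labelOf_le {α β : M} (h : LeTwoUnion A LA (labelOf α) (labelOf β)) :
    Rel LA α β := by
  simp only [LeTwoUnion, label1, label0, labelOf, pair_inj] at h
  simp at h
  exact h.2.2

end Labels

/-! ### Guards, children of infinite terms, and the height bound. -/

section Embedding

variable {M : Type u} [L2Structure M] [hM : Fact (ModelsRCA0 M)] {A LA : Set M}
  (T : LeafTrees (InTwoUnion A) (LeTwoUnion A LA)) (E : EpsilonNotation A LA)

namespace LeafTrees

theorem guard_mem {x : M} (hx : x ∈ T.trees) : guard x ∈ T.trees :=
  T.node2_mem (T.leaf_mem inTwoUnion_label1) (T.node_mem hx T.nil_mem)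

/-- The inner vertex {x} cannot lie below the leaf 1, so it must lie below {y}. -/
theorem guard_le_guard {x y : M} (hx : x ∈ T.trees) (hy : y ∈ T.trees)
    (h : Rel T.le (guard x) (guard y)) : Rel T.le x y := by
  have h1 := T.leaf_mem (inTwoUnion_label1 (A := A))
  rw [guard, guard, T.node2_le_node2 h1 (T.node_mem hx T.nil_mem) h1 (T.node_mem hy T.nil_mem),
    T.single_le_single hx hy] at h
  exact h.2.resolve_left (T.not_node_le_leaf _ _ (T.node_mem hx T.nil_mem) inTwoUnion_label1)

/-- The guard contains a leaf labelled 1, while the only label in a bar is 0. -/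
theorem not_guard_le_bar {x : M} (hx : x ∈ T.trees) (n : M) : ¬ Rel T.le (guard x) (bar n) := by
  intro h
  rcases eq_zero_or_succ n with rfl | ⟨n, rfl⟩
  · rw [bar_zero] at h
    exact T.not_node_le_leaf _ _ (T.guard_mem hx) inTwoUnion_label0 h
  · rw [bar_succ, guard, T.node2_le_single (T.leaf_mem inTwoUnion_label1)
      (T.node_mem hx T.nil_mem) (T.bar_mem inTwoUnion_label0 n)] at h
    exact not_label1_le_label0 (T.leaf_le_bar inTwoUnion_label0 inTwoUnion_label1 n h.1)

theorem leaf_le_guard {q x : M} (hq : InTwoUnion A q) (hx : x ∈ T.trees)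
    (h : Rel T.le (leafC q) (guard x)) : LeTwoUnion A LA q label1 ∨ Rel T.le (leafC q) x := by
  rwa [guard, T.leaf_le_node2 hq (T.leaf_mem inTwoUnion_label1) (T.node_mem hx T.nil_mem),
    T.leaf_le_leaf _ _ hq inTwoUnion_label1, T.leaf_le_single hq hx] at h

/-- A guard adds at most two levels: a bar of length at least 2 has to pass through the vertex {x}.
-/
theorem bar_le_guard {m x : M} (hx : x ∈ T.trees) (h : Rel T.le (bar m) (guard x)) :
    m ≤ 1 ∨ ∃ n, m = n + 1 + 1 ∧ Rel T.le (bar n) x := by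
  have h1 := T.leaf_mem (inTwoUnion_label1 (A := A))
  have hb := T.bar_mem inTwoUnion_label0
  rcases eq_zero_or_succ m with rfl | ⟨m, rfl⟩
  · exact Or.inl (zero_le' _)
  rcases eq_zero_or_succ m with rfl | ⟨m, rfl⟩
  · exact Or.inl (by simp)
  rw [bar_succ (m + 1), guard, T.single_le_node2 (hb _) h1 (T.node_mem hx T.nil_mem), bar_succ,
    T.single_le_single (hb _) hx] at h
  exact Or.inr ⟨m, rfl, h.resolve_left
    (T.not_node_le_leaf _ _ (T.node_mem (hb _) T.nil_mem) inTwoUnion_label1)⟩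

end LeafTrees

namespace EpsilonNotation

theorem tree_const_mem {c : M} (h : IsConst A c) : E.tree c ∈ T.trees := by
  rcases h with rfl | rfl | ⟨α, hα, rfl⟩
  · rw [E.tree_zeroC]
    exact T.leaf_mem inTwoUnion_label0
  · rw [E.tree_omegaC]
    exact T.leaf_mem inTwoUnion_label1
  · rw [E.tree_epsC]
    exact T.leaf_mem (inTwoUnion_labelOf hα)

theorem tree_mem_aux (x : M × M) : (x.1 ∈ E.terms → E.tree x.1 ∈ T.trees) ∧
    (x.1 ∈ E.lists → E.children (x.2 + weight x.1) x.1 ∈ T.lists) := by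
  have c1 := E.comp_terms
  have c2 := E.comp_lists
  have c3 := E.comp_tree
  have c4 := E.comp_children
  have c5 := Comp.mem T.trees_mem
  have c6 := Comp.mem T.lists_mem
  refine Comp.measure_induction (M := M) (P := fun x : M × M =>
    (x.1 ∈ E.terms → E.tree x.1 ∈ T.trees) ∧
    (x.1 ∈ E.lists → E.children (x.2 + weight x.1) x.1 ∈ T.lists))
    (.and (.imp (by fun_prop) (by fun_prop)) (.imp (by fun_prop) (by fun_prop)))
    (μ := fun x => x.1) (by fun_prop) ?_ x
  rintro ⟨t, n⟩ ih
  replace ih (a b : M) := ih (a, b)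
  dsimp only at ih ⊢
  constructor
  · intro ht
    rcases E.term_cases ht with ct | ⟨s, k, rfl⟩
    · exact E.tree_const_mem T ct
    have hk := E.seq_list_mem ht
    by_cases hω : SRel E.le (seqC (pair s k)) omegaC
    · rw [E.tree_seq_of_lt hω]
      exact T.bar_mem inTwoUnion_label0 _
    · rw [E.tree_seq_of_not_lt hk hω]
      have h := (ih (pair s k) 0 (lt_seqC _)).2 hk
      rw [zero_add] at h
      refine (T.mem_trees_iff _).2 (Or.inr ⟨_, h, ?_, rfl⟩)
      rw [← zero_add (weight _), E.children_cons]
      exact pair_ne_zero _ _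
  · intro ht
    rcases E.list_cases ht with rfl | ⟨s, k, rfl⟩
    · rw [E.children_nil]
      exact T.nil_mem
    · have hm := E.cons_mem ht
      rw [E.children_cons]
      exact T.cons_mem (T.node2_mem (T.guard_mem ((ih s 0 (left_lt_pair _ _)).1 hm.1))
        (T.bar_mem inTwoUnion_label0 _)) ((ih k _ (right_lt_pair _ _)).2 hm.2.1)

theorem tree_mem {t : M} (h : t ∈ E.terms) : E.tree t ∈ T.trees :=
  (E.tree_mem_aux T (t, 0)).1 h

theorem children_mem {k : M} (h : k ∈ E.lists) (n : M) :
    E.children (n + weight k) k ∈ T.lists :=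
  (E.tree_mem_aux T (k, n)).2 h

theorem tree_seq_of_not_lt' {k : M} (hk : k ∈ E.lists) (h : ¬ SRel E.le (seqC k) omegaC) :
    E.tree (seqC k) = nodeC (E.children (0 + weight k) k) := by
  rw [zero_add, E.tree_seq_of_not_lt hk h]

theorem entry_children_cons {t k : M} (h : pair t k ∈ E.lists) {n σ : M} :
    Rel T.entry σ (E.children (n + weight (pair t k)) (pair t k)) ↔
      σ = node2 (guard (E.tree t)) (bar n) ∨
      Rel T.entry σ (E.children (n + pow2 (height t + 1 + 1 + 1) + weight k) k) := by
  have := E.children_mem T h n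
  rw [E.children_cons] at this ⊢
  exact T.entry_cons _ _ _ this

/-- Offsets only increase along the list and leave room for the summand of their own entry, while
entries only decrease from the head. The bounds on t and p keep the claim decidable, as the
induction requires. -/
theorem entry_children_aux (hlin : IsLinearOrder A LA) (x : M × M × M) :
    x.1 ∈ E.lists → Rel T.entry x.2.2 (E.children (x.2.1 + weight x.1) x.1) →
    ∃ t < x.1, ∃ p < x.2.1 + weight x.1, x.2.2 = node2 (guard (E.tree t)) (bar p) ∧
      t ∈ E.terms ∧ Rel E.le t (left x.1) ∧ x.2.1 ≤ p ∧
      p + pow2 (height t + 1 + 1 + 1) ≤ x.2.1 + weight x.1 := by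
  have c1 := E.comp_terms
  have c2 := E.comp_lists
  have c3 := E.comp_tree
  have c4 := E.comp_children
  have c5 := Comp.rel T.entry_mem
  have c6 := E.comp_le
  refine Comp.measure_induction (M := M) (P := fun x : M × M × M =>
    x.1 ∈ E.lists → Rel T.entry x.2.2 (E.children (x.2.1 + weight x.1) x.1) →
    ∃ t < x.1, ∃ p < x.2.1 + weight x.1, x.2.2 = node2 (guard (E.tree t)) (bar p) ∧
      t ∈ E.terms ∧ Rel E.le t (left x.1) ∧ x.2.1 ≤ p ∧
      p + pow2 (height t + 1 + 1 + 1) ≤ x.2.1 + weight x.1)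
    (.imp (by fun_prop) (.imp (by fun_prop) (.bex (by fun_prop) (.bex (by fun_prop)
      (by fun_prop))))) (μ := fun x => x.1) (by fun_prop) ?_ x
  rintro ⟨k, n, σ⟩ ih
  replace ih (a b c : M) := ih (a, b, c)
  dsimp only at ih ⊢
  intro hk hσ
  rcases E.list_cases hk with rfl | ⟨s, k, rfl⟩
  · rw [E.children_nil] at hσ
    exact absurd hσ (T.not_entry_nil _)
  have hm := E.cons_mem hk
  rw [weight_cons, left_pair]
  rcases (E.entry_children_cons T hk).1 hσ with rfl | h
  · refine ⟨s, left_lt_pair _ _, n, ?_, rfl, hm.1, ?_, le_rfl, ?_⟩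
    · exact lt_add_of_pos_right _ ((pow2_pos _).trans_le le_self_add)
    · exact (E.le_total hlin hm.1 hm.1).elim id id
    · rw [← add_assoc]
      exact le_self_add
  · obtain ⟨t, h1, p, h2, h3, h4, h5, h6, h7⟩ := ih k _ σ (right_lt_pair _ _) hm.2.1 h
    rw [← add_assoc]
    refine ⟨t, h1.trans (right_lt_pair _ _), p, h2, h3, h4, ?_, le_self_add.trans h6, h7⟩
    rcases E.list_cases hm.2.1 with rfl | ⟨s', k', rfl⟩
    · exact absurd h1 (not_lt.2 (zero_le' _))
    · rw [left_pair] at h5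
      exact E.le_trans hlin h4 (E.cons_mem hm.2.1).1 hm.1 h5 (hm.2.2 _ _ rfl).1

theorem entry_children (hlin : IsLinearOrder A LA) {t₀ k n σ : M} (hk : pair t₀ k ∈ E.lists)
    (hσ : Rel T.entry σ (E.children (n + weight (pair t₀ k)) (pair t₀ k))) :
    ∃ t < pair t₀ k, ∃ p, σ = node2 (guard (E.tree t)) (bar p) ∧ t ∈ E.terms ∧
      Rel E.le t t₀ ∧ n ≤ p ∧ p + pow2 (height t + 1 + 1 + 1) ≤ n + weight (pair t₀ k) := by
  obtain ⟨t, h1, p, -, h2, h3, h4, h5⟩ := E.entry_children_aux T hlin (pair t₀ k, n, σ) hk hσ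
  dsimp only at h4
  rw [left_pair] at h4
  exact ⟨t, h1, p, h2, h3, h4, h5⟩

theorem bar_le_leaf {m q : M} (hq : InTwoUnion A q) (h : Rel T.le (bar m) (leafC q)) : m = 0 := by
  rcases eq_zero_or_succ m with rfl | ⟨m, rfl⟩
  · rfl
  · rw [bar_succ] at h
    exact absurd h (T.not_node_le_leaf _ _
      (T.node_mem (T.bar_mem inTwoUnion_label0 m) T.nil_mem) hq)

/-- Each child of an infinite term fits within the weight of the list: the guarded entry of height h
because h + 3 < 2 ^ (h + 3), the bar p because p plus a positive summand is at most that weight. The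
root accounts for the final + 1. -/
theorem le_height_of_bar_le (hlin : IsLinearOrder A LA) (x : M × M) :
    x.1 ∈ E.terms → Rel T.le (bar x.2) (E.tree x.1) → x.2 ≤ height x.1 := by
  have c1 := E.comp_terms
  have c3 := E.comp_tree
  have c5 := Comp.rel T.le_mem
  refine Comp.measure_induction (M := M) (P := fun x : M × M =>
    x.1 ∈ E.terms → Rel T.le (bar x.2) (E.tree x.1) → x.2 ≤ height x.1)
    (.imp (by fun_prop) (.imp (by fun_prop) (by fun_prop))) (μ := fun x => x.1) (by fun_prop) ?_ x
  rintro ⟨t, m⟩ ih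
  replace ih (a b : M) := ih (a, b)
  dsimp only at ih ⊢
  intro ht h
  rcases E.term_cases ht with ct | ⟨s, k, rfl⟩
  · have : m = 0 := by
      rcases ct with rfl | rfl | ⟨α, hα, rfl⟩
      · rw [E.tree_zeroC] at h
        exact bar_le_leaf T inTwoUnion_label0 h
      · rw [E.tree_omegaC] at h
        exact bar_le_leaf T inTwoUnion_label1 h
      · rw [E.tree_epsC] at h
        exact bar_le_leaf T (inTwoUnion_labelOf hα) h
    rw [this]
    exact zero_le' _
  have hk := E.seq_list_mem ht
  have hb := T.bar_mem inTwoUnion_label0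
  rw [height_seq]
  by_cases hω : SRel E.le (seqC (pair s k)) omegaC
  · rw [E.tree_seq_of_lt hω] at h
    exact T.bar_le_bar inTwoUnion_label0 _ _ h
  have hmem := E.tree_mem T ht
  rw [E.tree_seq_of_not_lt' hk hω] at h hmem
  rcases eq_zero_or_succ m with rfl | ⟨m, rfl⟩
  · exact zero_le' _
  rw [bar_succ, T.node_le_node _ _ (T.node_mem (hb _) T.nil_mem) hmem] at h
  obtain ⟨σ, hσ, hm⟩ := h _ ((T.entry_single (hb m)).2 rfl)
  obtain ⟨t, h1, p, rfl, h3, -, -, h5⟩ := E.entry_children T hlin hk hσ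
  rw [zero_add] at h5
  have hpow := add_one_le_iff'.2 (lt_pow2 (height t + 1 + 1 + 1))
  have hw : height t + 1 + 1 + 1 + 1 ≤ weight (pair s k) :=
    (hpow.trans le_add_self).trans h5
  refine add_le_add_left ?_ 1
  rcases eq_zero_or_succ m with rfl | ⟨m, rfl⟩
  · exact zero_le' _
  rw [bar_succ, T.single_le_node2 (hb m) (T.guard_mem (E.tree_mem T h3)) (hb p)] at hm
  rcases hm with hm | hm
  -- Through the guard: apart from very short bars, two levels are removed and the induction
  -- hypothesis bounds the rest by the height of the entry.
  · rcases T.bar_le_guard (E.tree_mem T h3) hm with hm | ⟨q, rfl, hq⟩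
    · refine _root_.le_trans ?_ hw
      have : m + 1 ≤ 1 + 1 := by gcongr
      refine this.trans ?_
      gcongr
      exact le_add_self
    · have := ih t q (h1.trans (lt_seqC _)) h3 hq
      refine _root_.le_trans ?_ hw
      exact (show q + 1 + 1 + 1 ≤ height t + 1 + 1 + 1 by gcongr).trans le_self_add
  -- Through the position marker: its length plus the power of two of its entry is at most the
  -- weight.
  · have h6 := T.bar_le_bar inTwoUnion_label0 _ _ hm
    refine _root_.le_trans ?_ h5
    exact add_le_add h6 (le_add_self.trans hpow)

end EpsilonNotation
end Embedding

/-! ### The map reflects the order. -/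

section Reflection

variable {M : Type u} [L2Structure M] [hM : Fact (ModelsRCA0 M)] {A LA : Set M}
  (T : LeafTrees (InTwoUnion A) (LeTwoUnion A LA)) (E : EpsilonNotation A LA)

theorem LeafTrees.not_node2_guard_le_bar {x y : M} (hx : x ∈ T.trees) (hy : y ∈ T.trees) (n : M) :
    ¬ Rel T.le (node2 (guard x) y) (bar n) := by
  have hg := T.guard_mem hx
  intro h
  rcases eq_zero_or_succ n with rfl | ⟨n, rfl⟩
  · rw [bar_zero] at h
    exact T.not_node_le_leaf _ _ (T.node2_mem hg hy) inTwoUnion_label0 h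
  · rw [bar_succ, T.node2_le_single hg hy (T.bar_mem inTwoUnion_label0 n)] at h
    exact T.not_guard_le_bar hx n h.1

namespace EpsilonNotation

theorem const_reflects {s t : M} (cs : IsConst A s) (ct : IsConst A t)
    (h : Rel T.le (E.tree s) (E.tree t)) : Rel E.le s t := by
  have h0 := inTwoUnion_label0 (A := A)
  have h1 := inTwoUnion_label1 (A := A)
  rcases cs with rfl | rfl | ⟨α, hα, rfl⟩
  · exact E.zero_le (E.const_mem ct)
  · rcases ct with rfl | rfl | ⟨β, hβ, rfl⟩
    · rw [E.tree_omegaC, E.tree_zeroC, T.leaf_le_leaf _ _ h1 h0] at h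
      exact absurd h not_label1_le_label0
    · exact E.omega_le_omega
    · exact (E.omega_lt_eps β hβ).1
  · have h2 := inTwoUnion_labelOf hα
    rw [E.tree_epsC] at h
    rcases ct with rfl | rfl | ⟨β, hβ, rfl⟩
    · rw [E.tree_zeroC, T.leaf_le_leaf _ _ h2 h0] at h
      exact absurd h (not_labelOf_le_label0 α)
    · rw [E.tree_omegaC, T.leaf_le_leaf _ _ h2 h1] at h
      exact absurd h (not_labelOf_le_label1 α)
    · rw [E.tree_epsC, T.leaf_le_leaf _ _ h2 (inTwoUnion_labelOf hβ)] at h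
      rw [E.eps_le_eps α hα β hβ]
      exact rel_of_labelOf_le h

theorem tree_const {c : M} (h : IsConst A c) : ∃ q, InTwoUnion A q ∧ E.tree c = leafC q := by
  rcases h with rfl | rfl | ⟨α, hα, rfl⟩
  · exact ⟨_, inTwoUnion_label0, E.tree_zeroC⟩
  · exact ⟨_, inTwoUnion_label1, E.tree_omegaC⟩
  · exact ⟨_, inTwoUnion_labelOf hα, E.tree_epsC α⟩

theorem not_tree_seq_le_leaf {k q : M} (hk : seqC k ∈ E.terms) (hq : InTwoUnion A q) :
    ¬ Rel T.le (E.tree (seqC k)) (leafC q) := by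
  have hmem := E.tree_mem T hk
  by_cases hω : SRel E.le (seqC k) omegaC
  · rw [E.tree_seq_of_lt hω, bar_succ]
    exact T.not_node_le_leaf _ _ (T.node_mem (T.bar_mem inTwoUnion_label0 _) T.nil_mem) hq
  · rw [E.tree_seq_of_not_lt' (E.seq_list_mem hk) hω] at hmem ⊢
    exact T.not_node_le_leaf _ _ hmem hq

/-- Position markers contribute only the label 0 and guards only the label 1; every other leaf stems
from the tree of an entry. -/
theorem leaf_le_tree_seq (hlin : IsLinearOrder A LA) {t k q : M} (ht : seqC (pair t k) ∈ E.terms)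
    (hω : ¬ SRel E.le (seqC (pair t k)) omegaC) (hq : InTwoUnion A q)
    (h : Rel T.le (leafC q) (E.tree (seqC (pair t k)))) :
    LeTwoUnion A LA q label0 ∨ LeTwoUnion A LA q label1 ∨
      ∃ t' < pair t k, t' ∈ E.terms ∧ Rel E.le t' t ∧ Rel T.le (leafC q) (E.tree t') := by
  have hk := E.seq_list_mem ht
  have hmem := E.tree_mem T ht
  rw [E.tree_seq_of_not_lt' hk hω] at h hmem
  obtain ⟨σ, hσ, h'⟩ := (T.leaf_le_node _ _ hq hmem).1 h
  obtain ⟨t', h1, p, rfl, h3, h4, -, -⟩ := E.entry_children T hlin hk hσ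
  rw [T.leaf_le_node2 hq (T.guard_mem (E.tree_mem T h3)) (T.bar_mem inTwoUnion_label0 p)] at h'
  rcases h' with h' | h'
  · exact Or.inr ((T.leaf_le_guard hq (E.tree_mem T h3) h').imp_right
      fun h => ⟨t', h1, h3, h4, h⟩)
  · exact Or.inl (T.leaf_le_bar inTwoUnion_label0 hq p h')

/-- Reflection for terms goes together with its core for lists: if k is not lexicographically below
ℓ and both children lists start at the same offset, some child of k lies below no child of ℓ. The
offset is arbitrary because the induction passes to tails. All quantifiers over children are bounded
to keep the predicate decidable. -/
theorem reflects_aux (hlin : IsLinearOrder A LA) (x : M × M × M) :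
    (x.1 ∈ E.terms → x.2.1 ∈ E.terms → Rel T.le (E.tree x.1) (E.tree x.2.1) →
      Rel E.le x.1 x.2.1) ∧
    (x.1 ∈ E.lists → x.2.1 ∈ E.lists → ¬ Rel E.lex x.1 x.2.1 →
      ∃ σ < E.children (x.2.2 + weight x.1) x.1,
        Rel T.entry σ (E.children (x.2.2 + weight x.1) x.1) ∧
        ∀ τ < E.children (x.2.2 + weight x.2.1) x.2.1,
          ¬ (Rel T.entry τ (E.children (x.2.2 + weight x.2.1) x.2.1) ∧ Rel T.le σ τ)) := by
  have c1 := E.comp_terms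
  have c2 := E.comp_lists
  have c3 := E.comp_tree
  have c4 := E.comp_children
  have c5 := Comp.rel T.le_mem
  have c6 := Comp.rel T.entry_mem
  have c7 := E.comp_le
  have c8 := E.comp_lex
  refine Comp.measure_induction (M := M) (P := fun x : M × M × M =>
    (x.1 ∈ E.terms → x.2.1 ∈ E.terms → Rel T.le (E.tree x.1) (E.tree x.2.1) →
      Rel E.le x.1 x.2.1) ∧
    (x.1 ∈ E.lists → x.2.1 ∈ E.lists → ¬ Rel E.lex x.1 x.2.1 →
      ∃ σ < E.children (x.2.2 + weight x.1) x.1,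
        Rel T.entry σ (E.children (x.2.2 + weight x.1) x.1) ∧
        ∀ τ < E.children (x.2.2 + weight x.2.1) x.2.1,
          ¬ (Rel T.entry τ (E.children (x.2.2 + weight x.2.1) x.2.1) ∧ Rel T.le σ τ)))
    (.and (.imp (by fun_prop) (.imp (by fun_prop) (.imp (by fun_prop) (by fun_prop))))
      (.imp (by fun_prop) (.imp (by fun_prop) (.imp (by fun_prop) (.bex (by fun_prop)
        (.and (by fun_prop) (.ball (by fun_prop) (by fun_prop))))))))
    (μ := fun x => x.1 + x.2.1) (by fun_prop) ?_ x
  rintro ⟨s, t, n⟩ ih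
  replace ih (a b c : M) := ih (a, b, c)
  dsimp only at ih ⊢
  have hb := T.bar_mem (inTwoUnion_label0 (A := A))
  have h0 := inTwoUnion_label0 (A := A)
  have hone := inTwoUnion_label1 (A := A)
  constructor
  · intro hs ht h
    by_contra hst
    have hts := E.lt_of_not_le hlin hs ht hst
    rcases E.term_cases hs with cs | ⟨s', k, rfl⟩ <;> rcases E.term_cases ht with ct | ⟨t', ℓ, rfl⟩
    · exact hst (E.const_reflects T cs ct h)
    · by_cases hω : SRel E.le (seqC (pair t' ℓ)) omegaC
      · rw [E.tree_seq_of_lt hω] at h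
        rcases cs with rfl | rfl | ⟨α, hα, rfl⟩
        · exact hst (E.zero_le ht)
        · rw [E.tree_omegaC] at h
          exact not_label1_le_label0 (T.leaf_le_bar h0 hone _ h)
        · rw [E.tree_epsC] at h
          exact not_labelOf_le_label0 α (T.leaf_le_bar h0 (inTwoUnion_labelOf hα) _ h)
      · rcases cs with rfl | rfl | ⟨α, hα, rfl⟩
        · exact hst (E.zero_le ht)
        · exact hω hts
        · have hq := inTwoUnion_labelOf hα
          have hm := (E.cons_mem (E.seq_list_mem ht)).1
          rw [E.tree_epsC] at h
          rcases E.leaf_le_tree_seq T hlin ht hω hq h with h | h | ⟨r, h1, h2, h3, h4⟩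
          · exact not_labelOf_le_label0 α h
          · exact not_labelOf_le_label1 α h
          · rw [← E.tree_epsC] at h4
            -- The leaf α comes from an entry r of t, so ε_α ⪯ r by induction, and r is at most the
            -- head, which is what a constant is compared with.
            have h5 := (ih _ r 0 (add_lt_add_right (h1.trans (lt_seqC _)) _)).1 hs h2 h4
            exact hst ((E.const_le_seq _ _ _ (Or.inr (Or.inr ⟨α, hα, rfl⟩)) ht).2
              (E.le_trans hlin hs h2 hm h5 h3))
    · obtain ⟨q, hq, h'⟩ := E.tree_const ct
      rw [h'] at h
      exact E.not_tree_seq_le_leaf T hs hq h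
    · have hk := E.seq_list_mem hs
      have hℓ := E.seq_list_mem ht
      have hms := E.tree_mem T hs
      have hmt := E.tree_mem T ht
      by_cases hωs : SRel E.le (seqC (pair s' k)) omegaC
      -- Both terms are finite: their trees are bars whose lengths are the heights, in strict order.
      · have hωt := E.lt_of_lt_of_le hlin ht hs E.omegaC_mem hts hωs.1
        have hlt := E.height_lt hlin hs ht hωs hts
        rw [E.tree_seq_of_lt hωs, E.tree_seq_of_lt hωt] at h
        rw [height_seq, height_seq] at hlt
        exact absurd (T.bar_le_bar h0 _ _ h) (not_le.2 hlt)
      rw [E.tree_seq_of_not_lt' hk hωs] at h hms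
      by_cases hωt : SRel E.le (seqC (pair t' ℓ)) omegaC
      -- An infinite term against a finite one: the first child contains a guard and cannot lie
      -- below a bar.
      · rw [E.tree_seq_of_lt hωt, bar_succ] at h
        rw [T.node_le_node _ _ hms (T.node_mem (hb _) T.nil_mem)] at h
        obtain ⟨τ, hτ, h'⟩ := h _ ((E.entry_children_cons T hk).2 (Or.inl rfl))
        rw [T.entry_single (hb _)] at hτ
        rw [hτ] at h'
        exact T.not_node2_guard_le_bar (E.tree_mem T (E.cons_mem hk).1) (hb 0) _ h'
      · rw [E.tree_seq_of_not_lt' hℓ hωt] at h hmt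
        rw [E.seq_le_seq _ _ hs ht] at hst
        obtain ⟨σ, -, hσ, h'⟩ := (ih _ _ 0 (add_lt_add (lt_seqC _) (lt_seqC _))).2 hk hℓ hst
        obtain ⟨τ, hτ, hle⟩ := (T.node_le_node _ _ hms hmt).1 h σ hσ
        exact h' τ (T.entry_lt (E.children_mem T hℓ 0) hτ) ⟨hτ, hle⟩
  · intro hk hℓ hlex
    rcases E.list_cases hk with rfl | ⟨s, k, rfl⟩
    · exact absurd (E.nil_lex _ hℓ) hlex
    have hms := E.cons_mem hk
    have hcm := E.children_mem T hk n
    have hfirst : Rel T.entry (node2 (guard (E.tree s)) (bar n))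
        (E.children (n + weight (pair s k)) (pair s k)) :=
      (E.entry_children_cons T hk).2 (Or.inl rfl)
    rcases E.list_cases hℓ with rfl | ⟨t, ℓ, rfl⟩
    -- The second list is exhausted and offers no child at all.
    · refine ⟨_, T.entry_lt hcm hfirst, hfirst, fun τ hτ => ?_⟩
      rw [E.children_nil] at hτ
      exact absurd hτ (not_lt.2 (zero_le' _))
    have hmt := E.cons_mem hℓ
    rw [E.cons_lex_cons _ _ _ _ hk hℓ] at hlex
    by_cases hst : Rel E.le s t
    · have hts : Rel E.le t s := by
        by_contra h
        exact hlex (Or.inl ⟨hst, h⟩)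
      have hlex' : ¬ Rel E.lex k ℓ := fun h => hlex (Or.inr ⟨hst, hts, h⟩)
      -- Equivalent heads have the same height, so both tails continue at the same offset and the
      -- induction hypothesis applies. Only the head child of the second list remains to be
      -- excluded.
      obtain ⟨σ, -, hσ, h⟩ := (ih k ℓ (n + pow2 (height s + 1 + 1 + 1))
        (add_lt_add (right_lt_pair _ _) (right_lt_pair _ _))).2 hms.2.1 hmt.2.1 hlex'
      have hσ' := (E.entry_children_cons T hk).2 (Or.inr hσ)
      refine ⟨σ, T.entry_lt hcm hσ', hσ', fun τ hτ hle => ?_⟩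
      have heq := E.height_eq hms.1 hmt.1 hst hts
      rcases (E.entry_children_cons T hℓ).1 hle.1 with rfl | hτ'
      · have hk0 : k ≠ 0 := by
          rintro rfl
          exact hlex' (E.nil_lex _ hmt.2.1)
        obtain ⟨s', k, rfl⟩ := (E.list_cases hms.2.1).resolve_left hk0
        obtain ⟨r, -, p, rfl, h3, -, h5, -⟩ := E.entry_children T hlin hms.2.1 hσ
        have hle' := hle.2
        rw [T.node2_le_node2 (T.guard_mem (E.tree_mem T h3)) (hb p)
          (T.guard_mem (E.tree_mem T hmt.1)) (hb n)] at hle'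
        have hpow := add_one_le_iff'.2 (lt_pow2 (height s + 1 + 1 + 1))
        -- The child comes from the tail, so its position marker is at least 2 ^ (height s + 3). It
        -- is thus too long for the guard over t and also exceeds the marker n.
        have hp : height s + 1 + 1 + 1 < p :=
          (add_one_le_iff'.1 hpow).trans_le (le_add_self.trans h5)
        rcases hle'.2 with h6 | h6
        · rcases T.bar_le_guard (E.tree_mem T hmt.1) h6 with h7 | ⟨m, rfl, h7⟩
          · refine absurd (hp.trans_le h7) (not_lt.2 ?_)
            exact le_add_self
          · have := E.le_height_of_bar_le T hlin (t, m) hmt.1 h7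
            dsimp only at this
            rw [← heq] at this
            refine absurd hp (not_lt.2 ?_)
            exact (show m + 1 + 1 ≤ height s + 1 + 1 by gcongr).trans le_self_add
        · have := T.bar_le_bar h0 _ _ h6
          refine absurd (h5.trans this) (not_le.2 ?_)
          exact lt_add_of_pos_right _ (pow2_pos _)
      · rw [← heq] at hτ'
        exact h τ (T.entry_lt (E.children_mem T hmt.2.1 _) hτ') ⟨hτ', hle.2⟩
    -- Here the heads decide. All entries of the second list are at most t, so the guard over s lies
    -- below none of their guards, nor below any bar.
    · refine ⟨_, T.entry_lt hcm hfirst, hfirst, fun τ hτ hle => ?_⟩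
      obtain ⟨r, h1, p, rfl, h3, h4, -, -⟩ := E.entry_children T hlin hℓ hle.1
      have hle' := hle.2
      have hsm := E.tree_mem T hms.1
      rw [T.node2_le_node2 (T.guard_mem hsm) (hb n)
        (T.guard_mem (E.tree_mem T h3)) (hb p)] at hle'
      rcases hle'.1 with h6 | h6
      · have h7 := T.guard_le_guard hsm (E.tree_mem T h3) h6
        have h8 := (ih s r 0 (add_lt_add (left_lt_pair _ _) h1)).1 hms.1 h3 h7
        exact hst (E.le_trans hlin hms.1 h3 hmt.1 h8 h4)
      · exact T.not_guard_le_bar hsm p h6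

theorem reflects (hlin : IsLinearOrder A LA) {s t : M} (hs : s ∈ E.terms) (ht : t ∈ E.terms)
    (h : Rel T.le (E.tree s) (E.tree t)) : Rel E.le s t :=
  (E.reflects_aux T hlin (s, t, 0)).1 hs ht h

/-- The assignment of trees to terms exists as a set and is order-reflecting. -/
theorem exists_isOrderReflecting (hlin : IsLinearOrder A LA) :
    ∃ h ∈ sets M, IsOrderReflecting E.terms E.le T.trees T.le h := by
  have c1 := E.comp_terms
  have c3 := E.comp_tree
  refine ⟨relSet fun s x => s ∈ E.terms ∧ x = E.tree s, relSet_mem (by fun_prop), ?_, ?_, ?_⟩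
  · rintro n ⟨hn, hs, ht⟩
    exact ⟨_, hs, _, ht ▸ E.tree_mem T hs, hn⟩
  · intro s hs
    refine ⟨E.tree s, rel_relSet.2 ⟨hs, rfl⟩, fun y hy => (rel_relSet.1 hy).2⟩
  · intro s t x y hs ht h
    obtain ⟨hs', rfl⟩ := rel_relSet.1 hs
    obtain ⟨ht', rfl⟩ := rel_relSet.1 ht
    exact E.reflects T hlin hs' ht' h

end EpsilonNotation
end Reflection

end RevMath

/-- `RCA₀` proves: for every linear order `Ω = (A, LA)`, the notation system `ε_Ω` and the
quasi-order `T_f(2 ∪ Ω)` exist, and there is an order-reflecting map from the first to the second.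
Provability is expressed as truth in all models `M` of `RCA₀`. -/
theorem theorem3p28 {M : Type*} [RevMath.L2Structure M] (hM : RevMath.ModelsRCA0 M)
    (A LA : Set M) (hA : A ∈ RevMath.sets M) (hLA : LA ∈ RevMath.sets M)
    (hlin : RevMath.IsLinearOrder A LA) :
    Nonempty (RevMath.EpsilonNotation A LA) ∧
    Nonempty (RevMath.LeafTrees (RevMath.InTwoUnion A) (RevMath.LeTwoUnion A LA)) ∧
    ∀ (E : RevMath.EpsilonNotation A LA)
      (T : RevMath.LeafTrees (RevMath.InTwoUnion A) (RevMath.LeTwoUnion A LA)),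
      ∃ h ∈ RevMath.sets M, RevMath.IsOrderReflecting E.terms E.le T.trees T.le h := by
  have : Fact (RevMath.ModelsRCA0 M) := ⟨hM⟩
  exact ⟨RevMath.nonempty_epsilonNotation hA hLA,
    RevMath.nonempty_leafTrees (RevMath.comp_inTwoUnion hA) (RevMath.comp_leTwoUnion hA hLA),
    fun E T => E.exists_isOrderReflecting T hlin⟩
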